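/- **Theorem 1.** Let $\Omega\subset\mathbb{R}^n$, $n>2$, be a bounded domain (open and connected) of type A: there is $A>0$ with $|\Omega\cap B_r(x)|\ge A r^n$ for all $x\in\overline{\Omega}$ and $0<r<\operatorname{diam}\Omega$. Let $0<Q_{crit}\le\infty$, and let $\rho$ be a positive function of class $C^{1,\alpha}$ (locally, for some $\alpha\in(0,1]$) on $[0,Q_{crit})$ satisfying the subsonic condition $$0<\frac{\frac{d}{dQ}\left[Q\rho^2(Q)\right]}{\rho(Q)}<\infty,\qquad Q\in[0,Q_{crit}),$$ together with $\rho'(Q)\le 0$ and $0<\kappa_0\le\rho(Q)\le\rho(0)<\infty$ for all $Q\in[0,Q_{crit})$. Let $u\in L^1_{loc}(\Omega)$ be a scalar function with weak gradient $du\in L^1_{loc}(\Omega)$, put $Q(x)=|du(x)|^2$, and suppose that $Q(x)<Q_{crit}$ for almost every $x\in\Omega$. For $B\subseteq\Omega$ write $$E_{|B}=\int_B\int_0^{Q(x)}\rho(s)\,ds\,dx .$$ Suppose that $u$ is a weak solution of $\operatorname{div}[\rho(Q)\nabla u]=0$ in $\Omega$, that is, $E_{|\Omega}<\infty$ and $$\int_\Omega\langle\rho(Q)\,du,d\psi\rangle\,dx=0\qquad\text{for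 all }\psi\in H^1_0(\Omega).$$ Then for every open ball $B_R\subseteq\Omega$ of radius $R>0$ and every $\delta\in(0,1)$, $$\operatorname*{ess\,sup}_{x\in B_{R(1-\delta)}}Q(x)\le\kappa_1R^{-n}E_{|B_R},$$ where $B_{R(1-\delta)}$ is the concentric ball of radius $R(1-\delta)$ and $\kappa_1>0$ is a constant that depends only on $n,\delta,\kappa_0$ and $\rho(0)$. In particular $\kappa_1$ depends neither on $R$, $\Omega$, $u$, $Q_{crit}$ nor on any ellipticity constant of the equation, so the bound is uniform over the whole subsonic range. -/

import Mathlib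

open MeasureTheory Filter Topology
open scoped ContDiff

noncomputable section

namespace CompressibleFlow

/-- The subsonic range `[0, Qcrit)`, where the critical value `Qcrit` may be finite or `+∞`. -/
def subsonicRange (Qcrit : EReal) : Set ℝ :=
  {s : ℝ | 0 ≤ s ∧ (s : EReal) < Qcrit}

/-- A mass density on the subsonic range: positive, of class `C^{1,α}` (locally, for some
`0 < α ≤ 1`; derivatives at `0` are one-sided), and satisfying the subsonic condition
`0 < (d/dQ [Q ρ²(Q)]) / ρ(Q) < ∞`. The upper bound is the finiteness of a real number. -/
structure IsSubsonicDensity (ρ : ℝ → ℝ) (Qcrit : EReal) : Prop where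
  pos : ∀ s ∈ subsonicRange Qcrit, 0 < ρ s
  differentiableOn : DifferentiableOn ℝ ρ (subsonicRange Qcrit)
  holder_deriv : ∃ α : NNReal, 0 < α ∧ α ≤ 1 ∧ ∀ b ∈ subsonicRange Qcrit,
    ∃ C : NNReal, HolderOnWith C α (derivWithin ρ (subsonicRange Qcrit)) (Set.Icc 0 b)
  subsonic : ∀ s ∈ subsonicRange Qcrit,
    0 < derivWithin (fun t => t * ρ t ^ 2) (subsonicRange Qcrit) s / ρ s

/-- Type-A domains: there is `A > 0` such that `|Ω ∩ B_r(x)| ≥ A rⁿ` for every `x ∈ closure Ω`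
and every `0 < r < diam Ω`. -/
def IsTypeA {n : ℕ} (Ω : Set (EuclideanSpace ℝ (Fin n))) : Prop :=
  ∃ A : ℝ, 0 < A ∧ ∀ x ∈ closure Ω, ∀ r : ℝ, 0 < r → r < Metric.diam Ω →
    A * r ^ n ≤ volume.real (Ω ∩ Metric.ball x r)

/-- Smooth test functions with compact support in `Ω`. -/
def IsTestFunction {n : ℕ} (Ω : Set (EuclideanSpace ℝ (Fin n)))
    (φ : EuclideanSpace ℝ (Fin n) → ℝ) : Prop :=
  ContDiff ℝ ∞ φ ∧ HasCompactSupport φ ∧ tsupport φ ⊆ Ω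

/-- The locally integrable vector field `du` is the weak gradient in `Ω` of the locally
integrable function `u`. -/
structure HasWeakGradient {n : ℕ} (Ω : Set (EuclideanSpace ℝ (Fin n)))
    (u : EuclideanSpace ℝ (Fin n) → ℝ)
    (du : EuclideanSpace ℝ (Fin n) → EuclideanSpace ℝ (Fin n)) : Prop where
  locInt : LocallyIntegrableOn u Ω
  locInt_grad : LocallyIntegrableOn du Ω
  integral_eq : ∀ φ : EuclideanSpace ℝ (Fin n) → ℝ, IsTestFunction Ω φ →
    ∀ v : EuclideanSpace ℝ (Fin n),
      ∫ x in Ω, u x * fderiv ℝ φ x v = - ∫ x in Ω, inner ℝ (du x) v * φ x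

/-- `ψ ∈ H¹₀(Ω)` with gradient `dψ`: `(ψ, dψ)` is the limit in `L²(Ω) × L²(Ω)` of
`(φₖ, ∇φₖ)` for smooth functions `φₖ` with compact support in `Ω`. -/
structure IsH10 {n : ℕ} (Ω : Set (EuclideanSpace ℝ (Fin n)))
    (ψ : EuclideanSpace ℝ (Fin n) → ℝ)
    (dψ : EuclideanSpace ℝ (Fin n) → EuclideanSpace ℝ (Fin n)) : Prop where
  memLp : MemLp ψ 2 (volume.restrict Ω)
  memLp_grad : MemLp dψ 2 (volume.restrict Ω)
  approx : ∃ φ : ℕ → EuclideanSpace ℝ (Fin n) → ℝ, (∀ k, IsTestFunction Ω (φ k)) ∧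
    Tendsto (fun k => eLpNorm (fun x => φ k x - ψ x) 2 (volume.restrict Ω)) atTop (𝓝 0) ∧
    Tendsto (fun k => eLpNorm (fun x => gradient (φ k) x - dψ x) 2 (volume.restrict Ω))
      atTop (𝓝 0)

/-- The energy density `∫_0^Q ρ(s) ds` with `Q = |du|²`. -/
def energyDensity {n : ℕ} (ρ : ℝ → ℝ)
    (du : EuclideanSpace ℝ (Fin n) → EuclideanSpace ℝ (Fin n))
    (x : EuclideanSpace ℝ (Fin n)) : ℝ :=
  ∫ s in (0 : ℝ)..(‖du x‖ ^ 2), ρ s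

/-- The energy `E` restricted to the set `B`. -/
def energy {n : ℕ} (ρ : ℝ → ℝ)
    (du : EuclideanSpace ℝ (Fin n) → EuclideanSpace ℝ (Fin n))
    (B : Set (EuclideanSpace ℝ (Fin n))) : ℝ :=
  ∫ x in B, energyDensity ρ du x

/-- `u`, with weak gradient `du`, is a weak solution of `div (ρ(Q) ∇u) = 0` in `Ω`,
`Q = |du|²`: it has finite energy and `∫_Ω ⟨ρ(Q) du, dψ⟩ = 0` for all `ψ ∈ H¹₀(Ω)`. -/
structure IsWeakSolution {n : ℕ} (ρ : ℝ → ℝ) (Ω : Set (EuclideanSpace ℝ (Fin n)))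
    (u : EuclideanSpace ℝ (Fin n) → ℝ)
    (du : EuclideanSpace ℝ (Fin n) → EuclideanSpace ℝ (Fin n)) : Prop where
  hasWeakGradient : HasWeakGradient Ω u du
  finiteEnergy : IntegrableOn (energyDensity ρ du) Ω
  weak_eq : ∀ (ψ : EuclideanSpace ℝ (Fin n) → ℝ)
    (dψ : EuclideanSpace ℝ (Fin n) → EuclideanSpace ℝ (Fin n)), IsH10 Ω ψ dψ →
      ∫ x in Ω, inner ℝ (ρ (‖du x‖ ^ 2) • du x) (dψ x) = 0

end CompressibleFlow

end

open CompressibleFlow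

/-! The estimate is proved for the flux V = ρ(Q)∇u instead of ∇u. Since |V|² = Qρ(Q)² and κ₀ ≤ ρ ≤
ρ(0), the quantities |V|² and Q are comparable, so a local sup bound for |V|² by its integral
suffices. The subsonic condition makes Q ↦ Qρ(Q)² strictly increasing; hence ∇u = b(|V|²)V with
b(Qρ(Q)²) = 1/ρ(Q), and the equation becomes the system div V = 0, curl(b(|V|²)V) = 0. Here 1/ρ(0) ≤
b ≤ 1/κ₀, and ρ' ≤ 0 gives b' ≥ 0. Loss of ellipticity shows only as growth of b', and b' will
always enter with a favourable sign.

Regularity: the map from flux to gradient satisfies ⟨V - W, p - q⟩ ≥ |V - W|²/ρ(0)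
(`IsSubsonicDensity.inner_flux_sub_ge`). Testing the equation for differences bounds the difference
quotients of V in L², so V has weak derivatives N = DV in L² locally, whatever the ellipticity
(`IsMonotoneFlow.exists_weakPartial`).

Caccioppoli: put x = ½∇|V|². The derivatives of div V = 0, tested with η²f(|V|²)b(|V|²)V, produce f
b tr(N²) + 2(f'b + f b') x·NV and a cross term that contains b but not b'. The curl relation turns b
tr(N²) + 2b' x·NV into b|N|² + 2b'|x|² (`trace_sq_identity`) and also gives x·NV ≥ 0
(`sum_mul_sum_nonneg_of_curl`). For f, f' ≥ 0 every b' term can therefore be discarded, and ∫η²f|N|²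
is bounded with a constant depending only on the bounds of b (`IsApproximation.caccioppoli`). As b'
may blow up near the critical value, b is replaced by bounded C¹ extensions b_l that are exact below
levels exhausting the range; the error disappears by dominated convergence.

Sup bound: the Sobolev inequality and Chebyshev turn this into a superlinear recursion for ∫|V|²
over {|V|² > k}, and De Giorgi iteration gives |V|² ≤ C(r - s)⁻ⁿ∫|V|² (`exists_sup_bound_const`). -/

noncomputable section

namespace CompressibleFlow

open scoped Convolution ENNReal

/-- Euclidean `n`-space. -/
abbrev Euc (n : ℕ) := EuclideanSpace ℝ (Fin n)

/-- The `k`-th vector of the standard basis. -/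
abbrev basisVec {n : ℕ} (k : Fin n) : Euc n := EuclideanSpace.single k (1 : ℝ)

/-! ### Averages, translations and mollification in L². -/

theorem sq_eLpNorm_two {α F : Type*} [MeasurableSpace α] [NormedAddCommGroup F]
    (f : α → F) (μ : Measure α) : eLpNorm f 2 μ ^ 2 = ∫⁻ x, ‖f x‖ₑ ^ 2 ∂μ := by
  have := eLpNorm_nnreal_pow_eq_lintegral (f := f) (μ := μ) (p := 2) (by norm_num)
  simpa using this

/-- Minkowski's integral inequality in `L²`, for averages over a probability measure. -/
theorem eLpNorm_integral_le {α β : Type*} [MeasurableSpace α] [MeasurableSpace β]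
    {ν : Measure α} [IsProbabilityMeasure ν] {μ : Measure β} [SFinite μ] {F : α → β → ℝ}
    (hF : AEStronglyMeasurable (Function.uncurry F) (ν.prod μ)) {C : ℝ≥0∞}
    (hC : ∀ᵐ t ∂ν, eLpNorm (F t) 2 μ ≤ C) :
    eLpNorm (fun x => ∫ t, F t x ∂ν) 2 μ ≤ C := by
  -- For squares this is Jensen's inequality (the L¹ norm is at most the L² norm for a probability
  -- measure) followed by Tonelli.
  have key : eLpNorm (fun x => ∫ t, F t x ∂ν) 2 μ ^ 2 ≤ C ^ 2 := by
    rw [sq_eLpNorm_two]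
    calc ∫⁻ x, ‖∫ t, F t x ∂ν‖ₑ ^ 2 ∂μ ≤ ∫⁻ x, ∫⁻ t, ‖F t x‖ₑ ^ 2 ∂ν ∂μ := by
          refine lintegral_mono_ae ?_
          filter_upwards [hF.prodMk_right] with x hx
          have hx' : AEStronglyMeasurable (fun t => F t x) ν := hx
          calc ‖∫ t, F t x ∂ν‖ₑ ^ 2 ≤ (eLpNorm (fun t => F t x) 1 ν) ^ 2 := by
                gcongr
                rw [eLpNorm_one_eq_lintegral_enorm]
                exact enorm_integral_le_lintegral_enorm _
            _ ≤ (eLpNorm (fun t => F t x) 2 ν) ^ 2 := by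
                gcongr
                exact eLpNorm_le_eLpNorm_of_exponent_le (by norm_num) hx'
            _ = _ := sq_eLpNorm_two _ _
      _ = ∫⁻ t, ∫⁻ x, ‖F t x‖ₑ ^ 2 ∂μ ∂ν := by
          rw [lintegral_lintegral_swap]
          exact (hF.prod_swap.enorm.pow_const 2)
      _ ≤ ∫⁻ _, C ^ 2 ∂ν := by
          refine lintegral_mono_ae ?_
          filter_upwards [hC] with t ht
          rw [← sq_eLpNorm_two]
          gcongr
      _ = C ^ 2 := by simp
  exact (ENNReal.pow_le_pow_left_iff two_ne_zero).1 key

section Translation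

variable {n : ℕ}

/-- Translations depend continuously on the shift in the compact-open topology, and composition of
an L² function with measure preserving maps is continuous for that topology. -/
theorem tendsto_eLpNorm_translate {f : Euc n → ℝ} (hf : MemLp f 2 volume) :
    Tendsto (fun h : Euc n => eLpNorm (fun x => f (x + h) - f x) 2 volume) (𝓝 0) (𝓝 0) := by
  let g : Euc n → C(Euc n, Euc n) := fun h => ⟨fun x => x + h, by fun_prop⟩
  have hg : Tendsto g (𝓝 0) (𝓝 (ContinuousMap.id _)) := by
    have hc : Continuous g :=
      (ContinuousMap.curry (⟨fun q : Euc n × Euc n => q.2 + q.1, by fun_prop⟩ :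
        C(Euc n × Euc n, Euc n))).continuous
    have h0 : g 0 = ContinuousMap.id _ := by ext1 x; simp [g]
    simpa [h0] using hc.tendsto 0
  have hm : ∀ h, MeasurePreserving (g h) (volume : Measure (Euc n)) volume := fun h =>
    measurePreserving_add_right volume h
  have := (tendsto_const_nhds (x := hf.toLp f)).compMeasurePreservingLp hg hm
    (MeasurePreserving.id volume) (by norm_num)
  have h2 : ∀ h, Lp.compMeasurePreserving (g h) (hm h) (hf.toLp f)
      = (hf.comp_measurePreserving (hm h)).toLp _ := fun h => rfl
  have h3 : Lp.compMeasurePreserving (ContinuousMap.id (Euc n)) (MeasurePreserving.id volume)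
      (hf.toLp f) = hf.toLp f := rfl
  simp_rw [h2] at this
  erw [h3, Lp.tendsto_Lp_iff_tendsto_eLpNorm''] at this
  exact this

end Translation

section Mollify

variable {n : ℕ}

/-- The convolution of `f` with the normalized bump function `φ`. -/
def mollify (φ : ContDiffBump (0 : Euc n)) (f : Euc n → ℝ) (x : Euc n) : ℝ :=
  ∫ y, φ.normed volume (x - y) * f y

theorem mollify_eq_convolution (φ : ContDiffBump (0 : Euc n)) (f : Euc n → ℝ) :
    mollify φ f = φ.normed volume ⋆[ContinuousLinearMap.lsmul ℝ ℝ, volume] f := by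
  ext x
  rw [convolution_eq_swap]
  rfl

theorem contDiff_mollify (φ : ContDiffBump (0 : Euc n)) {f : Euc n → ℝ}
    (hf : LocallyIntegrable f) : ContDiff ℝ ∞ (mollify φ f) := by
  rw [mollify_eq_convolution]
  exact φ.hasCompactSupport_normed.contDiff_convolution_left _ φ.contDiff_normed hf

theorem fderiv_mollify_apply (φ : ContDiffBump (0 : Euc n)) {f : Euc n → ℝ}
    (hf : LocallyIntegrable f) (x v : Euc n) :
    fderiv ℝ (mollify φ f) x v = ∫ y, fderiv ℝ (φ.normed volume) (x - y) v * f y := by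
  have hc : HasCompactSupport (φ.normed (volume : Measure (Euc n))) := φ.hasCompactSupport_normed
  have hd : ContDiff ℝ 1 (φ.normed (volume : Measure (Euc n))) := φ.contDiff_normed
  rw [mollify_eq_convolution, (hc.hasFDerivAt_convolution_left
    (ContinuousLinearMap.lsmul ℝ ℝ) hd hf x).fderiv]
  have hex := (hc.fderiv ℝ).convolutionExists_left
    ((ContinuousLinearMap.lsmul ℝ ℝ).precompL (Euc n)) (hd.continuous_fderiv (by norm_num)) hf x
  rw [convolution_eq_swap, ContinuousLinearMap.integral_apply]
  · simp [ContinuousLinearMap.precompL_apply]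
  · exact hex.integrable_swap

theorem mollify_apply' (φ : ContDiffBump (0 : Euc n)) (f : Euc n → ℝ) (x : Euc n) :
    mollify φ f x = ∫ t, φ.normed volume t * f (x - t) := by
  rw [mollify_eq_convolution]
  rfl

/-- The probability measure with density a normalized bump function. -/
def bumpMeasure (φ : ContDiffBump (0 : Euc n)) : Measure (Euc n) :=
  volume.withDensity fun t => ENNReal.ofReal (φ.normed volume t)

theorem isProbabilityMeasure_bumpMeasure (φ : ContDiffBump (0 : Euc n)) :
    IsProbabilityMeasure (bumpMeasure φ) := by
  constructor
  rw [bumpMeasure, withDensity_apply _ MeasurableSet.univ, Measure.restrict_univ,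
    ← ofReal_integral_eq_lintegral_ofReal φ.integrable_normed
      (ae_of_all _ φ.nonneg_normed), φ.integral_normed, ENNReal.ofReal_one]

theorem integral_bumpMeasure (φ : ContDiffBump (0 : Euc n)) (f : Euc n → ℝ) :
    ∫ t, f t ∂(bumpMeasure φ) = ∫ t, φ.normed volume t * f t := by
  have hm : Measurable fun t => (φ.normed (volume : Measure (Euc n)) t).toNNReal :=
    φ.continuous_normed.measurable.real_toNNReal
  have : bumpMeasure φ = volume.withDensity
      fun t => (((φ.normed (volume : Measure (Euc n)) t).toNNReal : NNReal) : ℝ≥0∞) := rfl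
  rw [this, integral_withDensity_eq_integral_smul hm]
  refine integral_congr_ae (ae_of_all _ fun t => ?_)
  simp [NNReal.smul_def, Real.coe_toNNReal _ (φ.nonneg_normed t)]

theorem ae_bumpMeasure_mem_ball (φ : ContDiffBump (0 : Euc n)) :
    ∀ᵐ t ∂(bumpMeasure φ), t ∈ Metric.ball (0 : Euc n) φ.rOut := by
  have hm : Measurable fun t => ENNReal.ofReal (φ.normed (volume : Measure (Euc n)) t) :=
    φ.continuous_normed.measurable.ennreal_ofReal
  rw [bumpMeasure, ae_withDensity_iff hm]
  refine ae_of_all _ fun t ht => ?_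
  have h1 : t ∈ Function.support (φ.normed (volume : Measure (Euc n))) := by
    intro h0
    exact ht (by simp [h0])
  rwa [φ.support_normed_eq] at h1

theorem bumpMeasure_absolutelyContinuous (φ : ContDiffBump (0 : Euc n)) :
    bumpMeasure φ ≪ volume := withDensity_absolutelyContinuous _ _

theorem aestronglyMeasurable_sub_prod {f : Euc n → ℝ} (hf : AEStronglyMeasurable f volume)
    (φ : ContDiffBump (0 : Euc n)) :
    AEStronglyMeasurable (Function.uncurry fun t x : Euc n => f (x - t))
      ((bumpMeasure φ).prod volume) := by
  have := isProbabilityMeasure_bumpMeasure φ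
  have h1 : Measure.QuasiMeasurePreserving (fun q : Euc n × Euc n => q.2 - q.1)
      (volume.prod volume) volume :=
    ((quasiMeasurePreserving_sub_of_right_invariant volume volume).comp
      Measure.measurePreserving_swap.quasiMeasurePreserving)
  have h2 : AEStronglyMeasurable (Function.uncurry fun t x : Euc n => f (x - t))
      (volume.prod volume) := hf.comp_quasiMeasurePreserving h1
  exact h2.mono_ac ((bumpMeasure_absolutelyContinuous φ).prod Measure.AbsolutelyContinuous.rfl)

theorem eLpNorm_comp_sub {f : Euc n → ℝ} (hf : AEStronglyMeasurable f volume) (t : Euc n) :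
    eLpNorm (fun x => f (x - t)) 2 volume = eLpNorm f 2 volume :=
  eLpNorm_comp_measurePreserving hf (measurePreserving_sub_right volume t)

theorem eLpNorm_mollify_le (φ : ContDiffBump (0 : Euc n)) {f : Euc n → ℝ}
    (hf : MemLp f 2 volume) : eLpNorm (mollify φ f) 2 volume ≤ eLpNorm f 2 volume := by
  have := isProbabilityMeasure_bumpMeasure φ
  have h := eLpNorm_integral_le (aestronglyMeasurable_sub_prod hf.1 φ)
    (C := eLpNorm f 2 volume) (ae_of_all _ fun t => (eLpNorm_comp_sub hf.1 t).le)
  convert h using 2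
  ext x
  rw [integral_bumpMeasure, mollify_apply']

theorem memLp_mollify (φ : ContDiffBump (0 : Euc n)) {f : Euc n → ℝ}
    (hf : MemLp f 2 volume) : MemLp (mollify φ f) 2 volume :=
  ⟨(contDiff_mollify φ (hf.locallyIntegrable (by norm_num))).continuous.aestronglyMeasurable,
    (eLpNorm_mollify_le φ hf).trans_lt hf.2⟩

theorem mollify_sub_self (φ : ContDiffBump (0 : Euc n)) {f : Euc n → ℝ}
    (hf : LocallyIntegrable f) (x : Euc n) :
    mollify φ f x - f x = ∫ t, (f (x - t) - f x) ∂(bumpMeasure φ) := by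
  have := isProbabilityMeasure_bumpMeasure φ
  rw [integral_bumpMeasure, mollify_apply']
  have h1 : Integrable fun t => φ.normed volume t * f (x - t) := by
    have := φ.hasCompactSupport_normed (μ := (volume : Measure (Euc n))).convolutionExists_left
      (ContinuousLinearMap.lsmul ℝ ℝ) φ.continuous_normed hf x
    exact this
  have h2 : Integrable fun t => φ.normed (volume : Measure (Euc n)) t * f x :=
    φ.integrable_normed.mul_const _
  simp_rw [mul_sub]
  rw [integral_sub h1 h2, integral_mul_const, φ.integral_normed, one_mul]

/-- The error is an average of the differences f(x - t) - f(x) over shifts below the radius of the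
bump, so Minkowski's inequality reduces the claim to continuity of translations in L². -/
theorem tendsto_eLpNorm_mollify {f : Euc n → ℝ} (hf : MemLp f 2 volume)
    {φ : ℕ → ContDiffBump (0 : Euc n)} (hφ : Tendsto (fun m => (φ m).rOut) atTop (𝓝 0)) :
    Tendsto (fun m => eLpNorm (fun x => mollify (φ m) f x - f x) 2 volume) atTop (𝓝 0) := by
  rw [ENNReal.tendsto_nhds_zero]
  intro ε hε
  have h1 := (ENNReal.tendsto_nhds_zero.1 (tendsto_eLpNorm_translate hf)) ε hε
  obtain ⟨r, hr, hr'⟩ := Metric.eventually_nhds_iff.1 h1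
  filter_upwards [hφ.eventually_lt_const hr] with m hm
  have := isProbabilityMeasure_bumpMeasure (φ m)
  simp_rw [mollify_sub_self (φ m) (hf.locallyIntegrable (by norm_num))]
  refine eLpNorm_integral_le (F := fun t x => f (x - t) - f x) ?_ ?_
  · refine (aestronglyMeasurable_sub_prod hf.1 (φ m)).sub ?_
    exact hf.1.comp_snd
  · filter_upwards [ae_bumpMeasure_mem_ball (φ m)] with t ht
    have := hr' (y := -t) (by simpa using (mem_ball_zero_iff.1 ht).trans hm)
    simpa [sub_eq_add_neg] using this

theorem tendsto_mollify_ae {f : Euc n → ℝ} (hf : LocallyIntegrable f)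
    {φ : ℕ → ContDiffBump (0 : Euc n)} (hφ : Tendsto (fun m => (φ m).rOut) atTop (𝓝 0))
    (hK : ∀ m, (φ m).rOut ≤ 2 * (φ m).rIn) :
    ∀ᵐ x, Tendsto (fun m => mollify (φ m) f x) atTop (𝓝 (f x)) := by
  simp_rw [mollify_eq_convolution]
  exact ContDiffBump.ae_convolution_tendsto_right_of_locallyIntegrable hφ
    (Eventually.of_forall hK) hf

/-- A sequence of bump functions with radii tending to zero and below a given bound. -/
theorem exists_bump_seq {s : ℝ} (hs : 0 < s) : ∃ φ : ℕ → ContDiffBump (0 : Euc n),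
    Tendsto (fun m => (φ m).rOut) atTop (𝓝 0) ∧ (∀ m, (φ m).rOut ≤ 2 * (φ m).rIn) ∧
      ∀ m, (φ m).rOut < s := by
  have hp : ∀ m : ℕ, 0 < s / (m + 2) := fun m => by positivity
  refine ⟨fun m => ⟨s / (m + 2) / 2, s / (m + 2), half_pos (hp m), half_lt_self (hp m)⟩,
    ?_, fun m => by simp; linarith, fun m => ?_⟩
  · have := (tendsto_const_div_atTop_nhds_zero_nat s).comp (tendsto_add_atTop_nat 2)
    simpa [Function.comp_def] using this
  · exact div_lt_self hs (by have : (0 : ℝ) ≤ m := by positivity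
                             linarith)

end Mollify

end CompressibleFlow

end

/-! ### Convergence in L² and weak limits. -/

noncomputable section

namespace CompressibleFlow

open scoped ENNReal

section L2

variable {α : Type*} [MeasurableSpace α] {μ : Measure α}

/-- The `L²` norm as a real number. -/
def l2norm (f : α → ℝ) (μ : Measure α) : ℝ := (eLpNorm f 2 μ).toReal

theorem l2norm_nonneg (f : α → ℝ) (μ : Measure α) : 0 ≤ l2norm f μ := ENNReal.toReal_nonneg

theorem integral_mul_eq_inner {f g : α → ℝ} (hf : MemLp f 2 μ) (hg : MemLp g 2 μ) :
    ∫ x, f x * g x ∂μ = inner ℝ (hf.toLp f) (hg.toLp g) := by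
  rw [L2.inner_def]
  refine integral_congr_ae ?_
  filter_upwards [hf.coeFn_toLp, hg.coeFn_toLp] with x h1 h2
  rw [h1, h2, real_inner_eq_re_inner]
  simp [mul_comm]

theorem abs_integral_mul_le {f g : α → ℝ} (hf : MemLp f 2 μ) (hg : MemLp g 2 μ) :
    |∫ x, f x * g x ∂μ| ≤ l2norm f μ * l2norm g μ := by
  rw [integral_mul_eq_inner hf hg]
  refine (abs_real_inner_le_norm _ _).trans_eq ?_
  rw [Lp.norm_toLp, Lp.norm_toLp]
  rfl

theorem integrable_mul_of_memLp {f g : α → ℝ} (hf : MemLp f 2 μ) (hg : MemLp g 2 μ) :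
    Integrable (fun x => f x * g x) μ := hf.integrable_mul hg

theorem integral_sq_eq {f : α → ℝ} (hf : MemLp f 2 μ) : ∫ x, f x ^ 2 ∂μ = l2norm f μ ^ 2 := by
  simp_rw [sq (f _)]
  rw [integral_mul_eq_inner hf hf, real_inner_self_eq_norm_sq, Lp.norm_toLp]
  rfl

theorem tendsto_zero_of_sq {ι : Type*} {l : Filter ι} {f : ι → ℝ≥0∞}
    (h : Tendsto (fun i => f i ^ 2) l (𝓝 0)) : Tendsto f l (𝓝 0) := by
  rw [ENNReal.tendsto_nhds_zero] at h ⊢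
  intro ε hε
  filter_upwards [h (ε ^ 2) (by positivity)] with i hi
  exact (ENNReal.pow_le_pow_left_iff two_ne_zero).1 hi

/-- Convergence of a sequence of square integrable functions in `L²`. -/
structure TendstoL2 (μ : Measure α) (F : ℕ → α → ℝ) (G : α → ℝ) : Prop where
  memLp : ∀ m, MemLp (F m) 2 μ
  memLp_lim : MemLp G 2 μ
  tendsto : Tendsto (fun m => eLpNorm (fun x => F m x - G x) 2 μ) atTop (𝓝 0)

namespace TendstoL2

variable {F F' : ℕ → α → ℝ} {G G' : α → ℝ}

theorem const (hG : MemLp G 2 μ) : TendstoL2 μ (fun _ => G) G :=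
  ⟨fun _ => hG, hG, by simp⟩

theorem restrict (h : TendstoL2 μ F G) (s : Set α) : TendstoL2 (μ.restrict s) F G :=
  ⟨fun m => (h.memLp m).restrict s, h.memLp_lim.restrict s,
    tendsto_of_tendsto_of_tendsto_of_le_of_le tendsto_const_nhds h.tendsto
      (fun _ => zero_le) fun _ => eLpNorm_restrict_le _ _ _ _⟩

theorem congr (h : TendstoL2 μ F G) (hF : ∀ m, F m =ᵐ[μ] F' m) (hG : G =ᵐ[μ] G') :
    TendstoL2 μ F' G' := by
  refine ⟨fun m => (memLp_congr_ae (hF m)).1 (h.memLp m), (memLp_congr_ae hG).1 h.memLp_lim, ?_⟩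
  refine h.tendsto.congr fun m => eLpNorm_congr_ae ?_
  filter_upwards [hF m, hG] with x h1 h2
  rw [h1, h2]

theorem add (h : TendstoL2 μ F G) (h' : TendstoL2 μ F' G') :
    TendstoL2 μ (fun m x => F m x + F' m x) fun x => G x + G' x := by
  refine ⟨fun m => (h.memLp m).add (h'.memLp m), h.memLp_lim.add h'.memLp_lim, ?_⟩
  refine tendsto_of_tendsto_of_tendsto_of_le_of_le tendsto_const_nhds
    (by simpa using h.tendsto.add h'.tendsto) (fun _ => zero_le) fun m => ?_
  have := eLpNorm_add_le ((h.memLp m).sub h.memLp_lim).1 ((h'.memLp m).sub h'.memLp_lim).1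
    (by norm_num : (1 : ℝ≥0∞) ≤ 2)
  refine le_trans (le_of_eq (congrArg (fun f => eLpNorm f 2 μ) ?_)) this
  ext x
  simp
  ring

theorem sum {ι : Type*} {s : Finset ι} {F : ι → ℕ → α → ℝ} {G : ι → α → ℝ}
    (h : ∀ i ∈ s, TendstoL2 μ (F i) (G i)) :
    TendstoL2 μ (fun m x => ∑ i ∈ s, F i m x) fun x => ∑ i ∈ s, G i x := by
  classical
  induction s using Finset.induction_on with
  | empty => simpa using const (μ := μ) (G := fun _ => (0 : ℝ)) MemLp.zero
  | insert a s ha ih =>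
    simp_rw [Finset.sum_insert ha]
    exact (h a (by simp)).add (ih fun i hi => h i (by simp [hi]))

/-- Split a_m F_m - a₀G = a_m(F_m - G) + (a_m - a₀)G. The first term is controlled by the uniform
bound, the second by dominated convergence with majorant (2C|G|)². Nonlinear coefficients c(|V_m|²)
thus need to converge only almost everywhere. -/
theorem bdd_mul (h : TendstoL2 μ F G) {a : ℕ → α → ℝ} {a₀ : α → ℝ} {C : ℝ}
    (hm : ∀ m, AEStronglyMeasurable (a m) μ) (hC : ∀ m, ∀ᵐ x ∂μ, |a m x| ≤ C)
    (ha : ∀ᵐ x ∂μ, Tendsto (fun m => a m x) atTop (𝓝 (a₀ x))) :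
    TendstoL2 μ (fun m x => a m x * F m x) fun x => a₀ x * G x := by
  have hm0 : AEStronglyMeasurable a₀ μ := aestronglyMeasurable_of_tendsto_ae atTop hm ha
  have hC0 : ∀ᵐ x ∂μ, |a₀ x| ≤ C := by
    filter_upwards [ha, ae_all_iff.2 hC] with x h1 h2
    exact le_of_tendsto h1.abs (Eventually.of_forall h2)
  have mem : ∀ {b H : α → ℝ}, AEStronglyMeasurable b μ → (∀ᵐ x ∂μ, |b x| ≤ C) →
      MemLp H 2 μ → MemLp (fun x => b x * H x) 2 μ := fun hb hbC hH =>
    hH.of_le_mul (c := C) (hb.mul hH.1) (by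
      filter_upwards [hbC] with x hx
      rw [norm_mul]
      exact mul_le_mul_of_nonneg_right hx (norm_nonneg _))
  refine ⟨fun m => mem (hm m) (hC m) (h.memLp m), mem hm0 hC0 h.memLp_lim, ?_⟩
  have t1 : Tendsto (fun m => eLpNorm (fun x => a m x * (F m x - G x)) 2 μ) atTop (𝓝 0) := by
    have hb : Tendsto (fun m => ENNReal.ofReal C * eLpNorm (fun x => F m x - G x) 2 μ)
        atTop (𝓝 0) := by
      simpa using ENNReal.Tendsto.const_mul h.tendsto (Or.inr ENNReal.ofReal_ne_top)
    refine tendsto_of_tendsto_of_tendsto_of_le_of_le tendsto_const_nhds hb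
      (fun _ => zero_le) fun m => eLpNorm_le_mul_eLpNorm_of_ae_le_mul ?_ _
    filter_upwards [hC m] with x hx
    rw [norm_mul]
    exact mul_le_mul_of_nonneg_right hx (norm_nonneg _)
  have t2 : Tendsto (fun m => eLpNorm (fun x => (a m x - a₀ x) * G x) 2 μ) atTop (𝓝 0) := by
    apply tendsto_zero_of_sq
    simp_rw [sq_eLpNorm_two]
    have : Tendsto (fun m => ∫⁻ x, ‖(a m x - a₀ x) * G x‖ₑ ^ 2 ∂μ) atTop
        (𝓝 (∫⁻ _, 0 ∂μ)) := by
      refine tendsto_lintegral_of_dominated_convergence'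
        (fun x => (ENNReal.ofReal (2 * C) * ‖G x‖ₑ) ^ 2) (fun m => ?_) (fun m => ?_) ?_ ?_
      · exact (((hm m).sub hm0).mul h.memLp_lim.1).enorm.pow_const 2
      · filter_upwards [hC m, hC0] with x h1 h2
        rw [enorm_mul]
        gcongr
        rw [← ofReal_norm, Real.norm_eq_abs]
        exact ENNReal.ofReal_le_ofReal ((abs_sub _ _).trans (by linarith))
      · simp_rw [mul_pow]
        rw [lintegral_const_mul'' _ (h.memLp_lim.1.enorm.pow_const 2), ← sq_eLpNorm_two]
        exact ENNReal.mul_ne_top (ENNReal.pow_ne_top ENNReal.ofReal_ne_top)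
          (ENNReal.pow_ne_top h.memLp_lim.2.ne)
      · filter_upwards [ha] with x hx
        have h0 : Tendsto (fun m => (a m x - a₀ x) * G x) atTop (𝓝 0) := by
          simpa using (hx.sub_const (a₀ x)).mul_const (G x)
        simpa using ENNReal.Tendsto.pow (n := 2) h0.enorm
    simpa using this
  refine tendsto_of_tendsto_of_tendsto_of_le_of_le tendsto_const_nhds
    (by simpa using t1.add t2) (fun _ => zero_le) fun m => ?_
  have := eLpNorm_add_le (f := fun x => a m x * (F m x - G x))
    (g := fun x => (a m x - a₀ x) * G x) (μ := μ) (p := 2)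
    ((hm m).mul ((h.memLp m).sub h.memLp_lim).1) (((hm m).sub hm0).mul h.memLp_lim.1)
    (by norm_num)
  refine le_trans (le_of_eq (congrArg (fun f => eLpNorm f 2 μ) ?_)) this
  ext x
  simp
  ring

theorem const_mul (h : TendstoL2 μ F G) (c : ℝ) :
    TendstoL2 μ (fun m x => c * F m x) fun x => c * G x :=
  h.bdd_mul (a := fun _ _ => c) (C := |c|) (fun _ => aestronglyMeasurable_const)
    (fun _ => ae_of_all _ fun _ => le_rfl) (ae_of_all _ fun _ => tendsto_const_nhds)

theorem tendsto_integral_mul (h : TendstoL2 μ F G) (h' : TendstoL2 μ F' G') :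
    Tendsto (fun m => ∫ x, F m x * F' m x ∂μ) atTop (𝓝 (∫ x, G x * G' x ∂μ)) := by
  simp_rw [integral_mul_eq_inner h.memLp_lim h'.memLp_lim,
    fun m => integral_mul_eq_inner (h.memLp m) (h'.memLp m)]
  exact ((Lp.tendsto_Lp_iff_tendsto_eLpNorm'' _ h.memLp _ h.memLp_lim).2 h.tendsto).inner
    ((Lp.tendsto_Lp_iff_tendsto_eLpNorm'' _ h'.memLp _ h'.memLp_lim).2 h'.tendsto)

theorem tendsto_integral_sq (h : TendstoL2 μ F G) :
    Tendsto (fun m => ∫ x, F m x ^ 2 ∂μ) atTop (𝓝 (∫ x, G x ^ 2 ∂μ)) := by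
  simpa only [sq] using h.tendsto_integral_mul h

end TendstoL2

/-- Bounded sequences in a Hilbert space have weak limits along an ultrafilter. -/
theorem exists_weak_limit {H : Type*} [NormedAddCommGroup H] [InnerProductSpace ℝ H]
    [CompleteSpace H] {F : ℕ → H} {C : ℝ} (hF : ∀ j, ‖F j‖ ≤ C) :
    ∃ N : H, ∀ χ : H, Tendsto (fun j => inner ℝ (F j) χ) (hyperfilter ℕ) (𝓝 (inner ℝ N χ)) := by
  let D : ℕ → WeakDual ℝ H := fun j => StrongDual.toWeakDual (InnerProductSpace.toDual ℝ H (F j))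
  have hD : ∀ j, D j ∈ WeakDual.toStrongDual ⁻¹' Metric.closedBall (0 : StrongDual ℝ H) C := by
    intro j
    simp only [Set.mem_preimage, Metric.mem_closedBall, dist_zero_right]
    change ‖InnerProductSpace.toDual ℝ H (F j)‖ ≤ C
    simpa using hF j
  -- Banach–Alaoglu, with an ultrafilter in place of a subsequence, so that no separability is
  -- needed.
  obtain ⟨ℓ, -, hℓ⟩ := (WeakDual.isCompact_closedBall (0 : StrongDual ℝ H) C).ultrafilter_le_nhds
    ((hyperfilter ℕ).map D) (by
      rw [le_principal_iff]
      exact Filter.mem_map.2 (Filter.univ_mem' hD))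
  refine ⟨(InnerProductSpace.toDual ℝ H).symm (WeakDual.toStrongDual ℓ), fun χ => ?_⟩
  have h1 : Tendsto D (hyperfilter ℕ) (𝓝 ℓ) := hℓ
  have h2 := ((WeakDual.eval_continuous (𝕜 := ℝ) χ).tendsto ℓ).comp h1
  simp only [InnerProductSpace.toDual_symm_apply]
  exact h2

end L2

end CompressibleFlow

end

/-! ### Weak partial derivatives and monotone flows. -/

noncomputable section

namespace CompressibleFlow

open scoped ENNReal

section WeakPartial

variable {n : ℕ}

/-- `g` is the weak partial derivative of `f` in the direction `k` on `U`. -/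
def HasWeakPartial (U : Set (Euc n)) (k : Fin n) (f g : Euc n → ℝ) : Prop :=
  ∀ ζ : Euc n → ℝ, IsTestFunction U ζ →
    ∫ x, f x * fderiv ℝ ζ x (basisVec k) = -∫ x, g x * ζ x

theorem clm_apply_eq_sum (L : Euc n →L[ℝ] ℝ) (h : Euc n) :
    L h = ∑ j, h j * L (basisVec j) := by
  conv_lhs => rw [← (EuclideanSpace.basisFun (Fin n) ℝ).sum_repr h]
  simp

theorem fderiv_const_sub_apply {ψ : Euc n → ℝ} (hψ : Differentiable ℝ ψ) (x y v : Euc n) :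
    fderiv ℝ (fun y => ψ (x - y)) y v = -fderiv ℝ ψ (x - y) v := by
  have h1 : HasFDerivAt (fun y => ψ (x - y))
      ((fderiv ℝ ψ (x - y)).comp (-ContinuousLinearMap.id ℝ (Euc n))) y :=
    (hψ (x - y)).hasFDerivAt.comp y ((hasFDerivAt_id y).const_sub x)
  rw [h1.fderiv]
  simp

theorem isTestFunction_bump (φ : ContDiffBump (0 : Euc n)) {x₀ x : Euc n} {R : ℝ}
    (hx : x ∈ Metric.ball x₀ (R - φ.rOut)) :
    IsTestFunction (Metric.ball x₀ R) fun y => φ.normed volume (x - y) := by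
  have hsub : tsupport (fun y => φ.normed (volume : Measure (Euc n)) (x - y)) ⊆
      Metric.closedBall x φ.rOut := by
    refine closure_minimal (fun y hy => ?_) Metric.isClosed_closedBall
    have : x - y ∈ Function.support (φ.normed (volume : Measure (Euc n))) := hy
    rw [φ.support_normed_eq, mem_ball_zero_iff, ← dist_eq_norm, dist_comm] at this
    exact this.le
  refine ⟨φ.contDiff_normed.comp (contDiff_const.sub contDiff_id), ?_, hsub.trans fun y hy => ?_⟩
  · exact HasCompactSupport.of_support_subset_isCompact (isCompact_closedBall x φ.rOut)
      (subset_closure.trans hsub)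
  · rw [Metric.mem_ball] at hx ⊢
    rw [Metric.mem_closedBall] at hy
    linarith [dist_triangle y x x₀]

/-- The translated and reflected bump is itself an admissible test function as long as x is farther
from the boundary than the radius of the bump. -/
theorem fderiv_mollify_of_weakPartial {f g : Euc n → ℝ} (hf : LocallyIntegrable f)
    {x₀ : Euc n} {R : ℝ} {k : Fin n} (h : HasWeakPartial (Metric.ball x₀ R) k f g)
    (φ : ContDiffBump (0 : Euc n)) {x : Euc n} (hx : x ∈ Metric.ball x₀ (R - φ.rOut)) :
    fderiv ℝ (mollify φ f) x (basisVec k) = mollify φ g x := by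
  have h1 := h _ (isTestFunction_bump φ hx)
  simp_rw [fderiv_const_sub_apply
    ((φ.contDiff_normed (n := 1)).differentiable (by norm_num)) x] at h1
  rw [fderiv_mollify_apply φ hf, mollify]
  simp_rw [mul_neg, integral_neg, neg_inj] at h1
  simpa only [mul_comm] using h1

end WeakPartial

section Flow

variable {n : ℕ}

/-- A divergence free field `V` and a gradient field `p = ∇u` on a ball, related by a
cocoercive law. -/
structure IsMonotoneFlow (x₀ : Euc n) (R lam : ℝ) (u : Euc n → ℝ)
    (V p : Fin n → Euc n → ℝ) : Prop where
  memLp_flux : ∀ i, MemLp (V i) 2 volume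
  memLp_grad : ∀ i, MemLp (p i) 2 volume
  locInt : LocallyIntegrable u
  weak_div : ∀ ζ, IsTestFunction (Metric.ball x₀ R) ζ →
    ∑ i, ∫ x, V i x * fderiv ℝ ζ x (basisVec i) = 0
  weak_grad : ∀ i, HasWeakPartial (Metric.ball x₀ R) i u (p i)
  mono : ∃ S : Set (Euc n), (∀ᵐ x, x ∈ Metric.ball x₀ R → x ∈ S) ∧ ∀ x ∈ S, ∀ y ∈ S,
    lam * ∑ i, (V i x - V i y) ^ 2 ≤ ∑ i, (V i x - V i y) * (p i x - p i y)

theorem memLp_two_of_contDiff {ζ : Euc n → ℝ} (h : Continuous ζ) (hc : HasCompactSupport ζ) :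
    MemLp ζ 2 volume := h.memLp_of_hasCompactSupport hc

theorem IsTestFunction.memLp_fderiv {U : Set (Euc n)} {ζ : Euc n → ℝ} (h : IsTestFunction U ζ)
    (v : Euc n) : MemLp (fun x => fderiv ℝ ζ x v) 2 volume :=
  memLp_two_of_contDiff ((h.1.continuous_fderiv (by norm_num)).clm_apply continuous_const)
    (h.2.1.fderiv_apply ℝ v)

theorem memLp_comp_add {f : Euc n → ℝ} (hf : MemLp f 2 volume) (h : Euc n) :
    MemLp (fun x => f (x + h)) 2 volume :=
  hf.comp_measurePreserving (measurePreserving_add_right volume h)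

theorem TendstoL2.comp_add {F : ℕ → Euc n → ℝ} {G : Euc n → ℝ} (hF : TendstoL2 volume F G)
    (h : Euc n) : TendstoL2 volume (fun m x => F m (x + h)) fun x => G (x + h) := by
  refine ⟨fun m => memLp_comp_add (hF.memLp m) h, memLp_comp_add hF.memLp_lim h, ?_⟩
  refine hF.tendsto.congr fun m => ?_
  exact (eLpNorm_comp_measurePreserving ((hF.memLp m).sub hF.memLp_lim).1
    (measurePreserving_add_right volume h)).symm

theorem tendstoL2_mollify {f : Euc n → ℝ} (hf : MemLp f 2 volume)
    {φ : ℕ → ContDiffBump (0 : Euc n)} (hφ : Tendsto (fun m => (φ m).rOut) atTop (𝓝 0)) :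
    TendstoL2 volume (fun m => mollify (φ m) f) f :=
  ⟨fun m => memLp_mollify (φ m) hf, hf, tendsto_eLpNorm_mollify hf hφ⟩

/-- Shifting the test function by h keeps its support in the large ball; moving the shift onto the
field by translation invariance and subtracting gives the claim. -/
theorem IsMonotoneFlow.weak_div_difference {x₀ : Euc n} {R lam : ℝ} {u : Euc n → ℝ}
    {V p : Fin n → Euc n → ℝ} (hF : IsMonotoneFlow x₀ R lam u V p) {r : ℝ} {h : Euc n}
    (hr : r + ‖h‖ ≤ R) {ζ : Euc n → ℝ} (hζ : IsTestFunction (Metric.ball x₀ r) ζ) :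
    ∑ i, ∫ x, (V i (x + h) - V i x) * fderiv ℝ ζ x (basisVec i) = 0 := by
  have hζ1 : IsTestFunction (Metric.ball x₀ R) ζ :=
    ⟨hζ.1, hζ.2.1, hζ.2.2.trans (Metric.ball_subset_ball (by linarith [norm_nonneg h]))⟩
  have hζ2 : IsTestFunction (Metric.ball x₀ R) fun x => ζ (x - h) := by
    refine ⟨hζ.1.comp (contDiff_id.sub contDiff_const),
      hζ.2.1.comp_homeomorph (Homeomorph.subRight h), ?_⟩
    have := tsupport_comp_subset_preimage ζ (f := fun x : Euc n => x - h) (by fun_prop)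
    refine this.trans fun x hx => ?_
    have h1 := hζ.2.2 hx
    rw [Metric.mem_ball, dist_eq_norm] at h1 ⊢
    calc ‖x - x₀‖ = ‖(x - h - x₀) + h‖ := by congr 1; abel
      _ ≤ ‖x - h - x₀‖ + ‖h‖ := norm_add_le _ _
      _ < R := by linarith
  have e1 := hF.weak_div _ hζ1
  have e2 := hF.weak_div _ hζ2
  have e3 : ∀ i, ∫ x, V i x * fderiv ℝ (fun x => ζ (x - h)) x (basisVec i)
      = ∫ x, V i (x + h) * fderiv ℝ ζ x (basisVec i) := fun i => by
    rw [← integral_add_right_eq_self _ h]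
    simp [fderiv_comp_sub]
  simp_rw [e3] at e2
  have e4 : ∀ i, ∫ x, (V i (x + h) - V i x) * fderiv ℝ ζ x (basisVec i)
      = (∫ x, V i (x + h) * fderiv ℝ ζ x (basisVec i))
        - ∫ x, V i x * fderiv ℝ ζ x (basisVec i) := fun i => by
    simp_rw [sub_mul]
    exact integral_sub
      (integrable_mul_of_memLp (memLp_comp_add (hF.memLp_flux i) h) (hζ.memLp_fderiv _))
      (integrable_mul_of_memLp (hF.memLp_flux i) (hζ.memLp_fderiv _))
  rw [Finset.sum_congr rfl fun i _ => e4 i, Finset.sum_sub_distrib, e1, e2, sub_zero]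

/-- The average of `∑ j, h j * P j` over the segment from `x` to `x + h`. -/
def segmentAverage (P : Fin n → Euc n → ℝ) (h x : Euc n) : ℝ :=
  ∫ t in (0 : ℝ)..1, ∑ j, h j * P j (x + t • h)

theorem eLpNorm_segmentAverage_le {P : Fin n → Euc n → ℝ} (hP : ∀ j, MemLp (P j) 2 volume)
    (hc : ∀ j, Continuous (P j)) (h : Euc n) :
    eLpNorm (segmentAverage P h) 2 volume ≤ ENNReal.ofReal ‖h‖ * ∑ j, eLpNorm (P j) 2 volume := by
  have : IsProbabilityMeasure ((volume : Measure ℝ).restrict (Set.Ioc 0 1)) :=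
    ⟨by simp⟩
  -- Minkowski over the unit interval: all translates of P_j have the same norm, and |h_j| ≤ ‖h‖.
  have := eLpNorm_integral_le (ν := (volume : Measure ℝ).restrict (Set.Ioc 0 1))
    (μ := (volume : Measure (Euc n))) (F := fun t x => ∑ j, h j * P j (x + t • h))
    (C := ENNReal.ofReal ‖h‖ * ∑ j, eLpNorm (P j) 2 volume) ?_ (ae_of_all _ fun t => ?_)
  · have e : segmentAverage P h = fun x =>
        ∫ t in Set.Ioc (0 : ℝ) 1, ∑ j, h j * P j (x + t • h) := by
      ext x
      rw [segmentAverage, intervalIntegral.integral_of_le zero_le_one]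
    rwa [e]
  · apply Continuous.aestronglyMeasurable
    refine continuous_finsetSum _ fun j _ => ?_
    exact continuous_const.mul ((hc j).comp (by fun_prop))
  · have h1 := eLpNorm_sum_le (μ := (volume : Measure (Euc n))) (p := 2) (s := Finset.univ)
      (f := fun j x => h j * P j (x + t • h))
      (fun j _ => ((memLp_comp_add (hP j) (t • h)).const_mul (h j)).1) (by norm_num)
    have e : (∑ j, fun x => h j * P j (x + t • h)) = fun x => ∑ j, h j * P j (x + t • h) := by
      ext x; simp
    rw [e] at h1
    refine h1.trans ?_
    rw [Finset.mul_sum]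
    refine Finset.sum_le_sum fun j _ => ?_
    have h2 : eLpNorm (fun x => P j (x + t • h)) 2 volume = eLpNorm (P j) 2 volume :=
      eLpNorm_comp_measurePreserving (hP j).1 (measurePreserving_add_right volume (t • h))
    rw [← h2]
    refine eLpNorm_le_mul_eLpNorm_of_ae_le_mul (ae_of_all _ fun x => ?_) _
    rw [norm_mul]
    gcongr
    exact PiLp.norm_apply_le h j

theorem sub_eq_segmentAverage {U : Euc n → ℝ} (hU : ContDiff ℝ 1 U) {P : Fin n → Euc n → ℝ}
    {h x : Euc n} (hP : ∀ t ∈ Set.Icc (0 : ℝ) 1, ∀ j,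
      fderiv ℝ U (x + t • h) (basisVec j) = P j (x + t • h)) :
    U (x + h) - U x = segmentAverage P h x := by
  have hd : ∀ t ∈ Set.uIcc (0 : ℝ) 1, HasDerivAt (fun t : ℝ => U (x + t • h))
      (fderiv ℝ U (x + t • h) h) t := fun t _ => by
    have h1 : HasDerivAt (fun t : ℝ => x + t • h) h t := by
      simpa using ((hasDerivAt_id t).smul_const h).const_add x
    exact ((hU.differentiable (by norm_num)) (x + t • h)).hasFDerivAt.comp_hasDerivAt t h1
  have := intervalIntegral.integral_eq_sub_of_hasDerivAt hd (by
    apply Continuous.intervalIntegrable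
    exact ((hU.continuous_fderiv (by norm_num)).comp (by fun_prop)).clm_apply continuous_const)
  simp only [one_smul, zero_smul, add_zero] at this
  rw [← this, segmentAverage]
  refine intervalIntegral.integral_congr fun t ht => ?_
  rw [Set.uIcc_of_le zero_le_one] at ht
  simp only
  rw [clm_apply_eq_sum]
  exact Finset.sum_congr rfl fun j _ => by rw [hP t ht j]

theorem l2norm_le_of_le {α : Type*} [MeasurableSpace α] {μ : Measure α} {f g : α → ℝ} {c : ℝ}
    (hc : 0 ≤ c) (hg : MemLp g 2 μ) (h : ∀ x, |f x| ≤ c * |g x|) :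
    l2norm f μ ≤ c * l2norm g μ := by
  have := eLpNorm_le_mul_eLpNorm_of_ae_le_mul (μ := μ) (f := f) (g := g) (c := c)
    (ae_of_all _ h) 2
  have h2 := ENNReal.toReal_mono (ENNReal.mul_ne_top ENNReal.ofReal_ne_top hg.2.ne) this
  rwa [ENNReal.toReal_mul, ENNReal.toReal_ofReal hc] at h2

theorem IsTestFunction.exists_bound_fderiv {U : Set (Euc n)} {ζ : Euc n → ℝ}
    (h : IsTestFunction U ζ) : ∃ L : ℝ, 0 ≤ L ∧ ∀ x v, |fderiv ℝ ζ x v| ≤ L * ‖v‖ := by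
  obtain ⟨L, hL⟩ := (h.2.1.fderiv ℝ).exists_bound_of_continuous
    (h.1.continuous_fderiv (by norm_num))
  refine ⟨L, (norm_nonneg _).trans (hL 0), fun x v => ?_⟩
  exact ((fderiv ℝ ζ x).le_opNorm v).trans (by gcongr; exact hL x)

theorem IsTestFunction.exists_bound {U : Set (Euc n)} {ζ : Euc n → ℝ}
    (h : IsTestFunction U ζ) : ∃ L : ℝ, 0 ≤ L ∧ ∀ x, |ζ x| ≤ L := by
  obtain ⟨L, hL⟩ := h.2.1.exists_bound_of_continuous h.1.continuous
  exact ⟨L, (norm_nonneg _).trans (hL 0), hL⟩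

theorem IsTestFunction.eq_zero {U : Set (Euc n)} {ζ : Euc n → ℝ}
    (h : IsTestFunction U ζ) {x : Euc n} (hx : x ∉ U) : ζ x = 0 :=
  image_eq_zero_of_notMem_tsupport fun h' => hx (h.2.2 h')

theorem IsTestFunction.fderiv_eq_zero {U : Set (Euc n)} {ζ : Euc n → ℝ}
    (h : IsTestFunction U ζ) {x : Euc n} (hx : x ∉ U) : fderiv ℝ ζ x = 0 := by
  have : x ∉ tsupport (fderiv ℝ ζ) := fun h' => hx (h.2.2 (tsupport_fderiv_subset ℝ h'))
  exact image_eq_zero_of_notMem_tsupport this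

theorem memLp_test_mul {U : Set (Euc n)} {ζ f : Euc n → ℝ} (h : IsTestFunction U ζ)
    (hf : MemLp f 2 volume) : MemLp (fun x => ζ x * f x) 2 volume := by
  obtain ⟨L, -, hL⟩ := h.exists_bound
  exact hf.of_le_mul (c := L) (h.1.continuous.aestronglyMeasurable.mul hf.1) (ae_of_all _ fun x => by
    rw [norm_mul]
    exact mul_le_mul_of_nonneg_right (hL x) (norm_nonneg _))

end Flow

end CompressibleFlow

end

/-! ### Difference quotients of the flux. -/

noncomputable section

namespace CompressibleFlow

open scoped ENNReal

variable {n : ℕ}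

theorem IsMonotoneFlow.fderiv_mollify_potential {x₀ : Euc n} {R lam : ℝ} {u : Euc n → ℝ}
    {V p : Fin n → Euc n → ℝ} (hF : IsMonotoneFlow x₀ R lam u V p)
    (φ : ContDiffBump (0 : Euc n)) {x : Euc n} (hx : x ∈ Metric.ball x₀ (R - φ.rOut))
    (i : Fin n) : fderiv ℝ (mollify φ u) x (basisVec i) = mollify φ (p i) x :=
  fderiv_mollify_of_weakPartial hF.locInt (hF.weak_grad i) φ hx

theorem fderiv_sq_mul_apply {η w : Euc n → ℝ} {x : Euc n} (hη : DifferentiableAt ℝ η x)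
    (hw : DifferentiableAt ℝ w x) (v : Euc n) :
    fderiv ℝ (fun x => η x ^ 2 * w x) x v
      = 2 * η x * fderiv ℝ η x v * w x + η x ^ 2 * fderiv ℝ w x v := by
  rw [fderiv_fun_mul (hη.fun_pow 2) hw, fderiv_fun_pow 2 hη]
  simp
  ring

/-- The tested equation for the difference of the flux, with the mollified potential. -/
theorem IsMonotoneFlow.difference_identity {x₀ : Euc n} {R lam : ℝ} {u : Euc n → ℝ}
    {V p : Fin n → Euc n → ℝ} (hF : IsMonotoneFlow x₀ R lam u V p) {r : ℝ} {h : Euc n}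
    {η : Euc n → ℝ} (hη : IsTestFunction (Metric.ball x₀ r) η)
    (φ : ContDiffBump (0 : Euc n)) (hφ : φ.rOut + r + ‖h‖ ≤ R) :
    ∑ i, ∫ x, (η x * (V i (x + h) - V i x)) *
        (η x * (mollify φ (p i) (x + h) - mollify φ (p i) x)) =
      -∑ i, ∫ x, (η x * (V i (x + h) - V i x)) *
        (2 * fderiv ℝ η x (basisVec i) * segmentAverage (fun j => mollify φ (p j)) h x) := by
  have hsm : ContDiff ℝ ∞ (mollify φ u) := contDiff_mollify φ hF.locInt
  have hcP : ∀ j, Continuous (mollify φ (p j)) := fun j =>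
    (contDiff_mollify φ ((hF.memLp_grad j).locallyIntegrable (by norm_num))).continuous
  have hmP : ∀ j, MemLp (mollify φ (p j)) 2 volume := fun j => memLp_mollify φ (hF.memLp_grad j)
  have hGm : MemLp (segmentAverage (fun j => mollify φ (p j)) h) 2 volume := by
    refine ⟨?_, (eLpNorm_segmentAverage_le hmP hcP h).trans_lt ?_⟩
    · apply Continuous.aestronglyMeasurable
      refine intervalIntegral.continuous_parametric_intervalIntegral_of_continuous' ?_ _ _
      refine continuous_finsetSum _ fun j _ => ?_
      exact continuous_const.mul ((hcP j).comp (by fun_prop))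
    · exact ENNReal.mul_lt_top ENNReal.ofReal_lt_top
        (ENNReal.sum_lt_top.2 fun j _ => (hmP j).2)
  have hball : ∀ x ∈ Metric.ball x₀ r, ∀ t ∈ Set.Icc (0 : ℝ) 1,
      x + t • h ∈ Metric.ball x₀ (R - φ.rOut) := fun x hx t ht => by
    rw [Metric.mem_ball, dist_eq_norm] at hx ⊢
    calc ‖x + t • h - x₀‖ = ‖(x - x₀) + t • h‖ := by congr 1; abel
      _ ≤ ‖x - x₀‖ + ‖t • h‖ := norm_add_le _ _
      _ ≤ ‖x - x₀‖ + ‖h‖ := by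
          rw [norm_smul, Real.norm_eq_abs, abs_of_nonneg ht.1]
          gcongr
          exact mul_le_of_le_one_left (norm_nonneg _) ht.2
      _ < R - φ.rOut := by linarith
  have hw : ContDiff ℝ ∞ fun x => mollify φ u (x + h) - mollify φ u x :=
    (hsm.comp (contDiff_id.add contDiff_const)).sub hsm
  -- Only the potential is mollified, which makes η² times its difference a smooth test function.
  -- The flux stays rough, so no nonlinearity has to commute with mollification.
  have hζ : IsTestFunction (Metric.ball x₀ r)
      fun x => η x ^ 2 * (mollify φ u (x + h) - mollify φ u x) := by
    refine ⟨(hη.1.pow 2).mul hw, ?_, ?_⟩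
    · simp_rw [sq, mul_assoc]
      exact hη.2.1.mul_right
    · simp_rw [sq, mul_assoc]
      exact (tsupport_mul_subset_left).trans hη.2.2
  have e1 := hF.weak_div_difference (h := h) (by linarith [φ.rOut_pos]) hζ
  have e2 : ∀ i x, (V i (x + h) - V i x) * fderiv ℝ
      (fun x => η x ^ 2 * (mollify φ u (x + h) - mollify φ u x)) x (basisVec i) =
      (η x * (V i (x + h) - V i x)) *
        (2 * fderiv ℝ η x (basisVec i) * segmentAverage (fun j => mollify φ (p j)) h x) +
      (η x * (V i (x + h) - V i x)) *
        (η x * (mollify φ (p i) (x + h) - mollify φ (p i) x)) := fun i x => by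
    rw [fderiv_sq_mul_apply (hη.1.differentiable (by norm_num) x)
      (hw.differentiable (by norm_num) x)]
    by_cases hx : x ∈ Metric.ball x₀ r
    · have d1 : fderiv ℝ (fun x => mollify φ u (x + h) - mollify φ u x) x (basisVec i)
          = mollify φ (p i) (x + h) - mollify φ (p i) x := by
        have hds := hsm.differentiable (by norm_num)
        have hds' : DifferentiableAt ℝ (fun x => mollify φ u (x + h)) x :=
          (hds (x + h)).comp x (f := fun x => x + h) (by fun_prop)
        rw [fderiv_fun_sub hds' (hds x),
          fderiv_comp_add_right, sub_apply,
          hF.fderiv_mollify_potential φ (by simpa using hball x hx 1 (by simp)),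
          hF.fderiv_mollify_potential φ (by simpa using hball x hx 0 (by simp))]
      rw [d1, sub_eq_segmentAverage (hsm.of_le (by exact_mod_cast le_top))
        (P := fun j => mollify φ (p j)) fun t ht j =>
          hF.fderiv_mollify_potential φ (hball x hx t ht) j]
      ring
    · rw [hη.eq_zero hx]
      ring
  have hD : ∀ i, MemLp (fun x => η x * (V i (x + h) - V i x)) 2 volume := fun i =>
    memLp_test_mul hη ((memLp_comp_add (hF.memLp_flux i) h).sub (hF.memLp_flux i))
  obtain ⟨L, hL0, hL⟩ := hη.exists_bound_fderiv
  have hI1 : ∀ i, MemLp (fun x => 2 * fderiv ℝ η x (basisVec i) *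
      segmentAverage (fun j => mollify φ (p j)) h x) 2 volume := fun i => by
    refine hGm.of_le_mul (c := 2 * L) (AEStronglyMeasurable.mul ?_ hGm.1) (ae_of_all _ fun x => ?_)
    · exact ((hη.memLp_fderiv (basisVec i)).1.const_mul 2)
    · rw [norm_mul, norm_mul]
      gcongr
      · simp
      · simpa using hL x (basisVec i)
  have hI2 : ∀ i, MemLp (fun x => η x * (mollify φ (p i) (x + h) - mollify φ (p i) x)) 2 volume :=
    fun i => memLp_test_mul hη ((memLp_comp_add (hmP i) h).sub (hmP i))
  simp_rw [e2] at e1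
  simp_rw [fun i => integral_add (integrable_mul_of_memLp (hD i) (hI1 i))
    (integrable_mul_of_memLp (hD i) (hI2 i))]
    at e1
  rw [Finset.sum_add_distrib] at e1
  linarith

/-- Cocoercivity controls the difference quotients of the flux in `L²`. -/
theorem IsMonotoneFlow.exists_difference_bound {x₀ : Euc n} {R lam : ℝ} {u : Euc n → ℝ}
    {V p : Fin n → Euc n → ℝ} (hF : IsMonotoneFlow x₀ R lam u V p) (hlam : 0 < lam) {r : ℝ}
    {η : Euc n → ℝ} (hη : IsTestFunction (Metric.ball x₀ r) η) :
    ∃ C : ℝ, ∀ h : Euc n, r + ‖h‖ < R → ∀ i,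
      l2norm (fun x => η x * (V i (x + h) - V i x)) volume ≤ C * ‖h‖ := by
  obtain ⟨L, hL0, hL⟩ := hη.exists_bound_fderiv
  set Pn : ℝ := ∑ j, l2norm (p j) volume with hPn
  have hPn0 : 0 ≤ Pn := Finset.sum_nonneg fun _ _ => l2norm_nonneg _ _
  refine ⟨n * (2 * L * Pn / lam), fun h hh i => ?_⟩
  set a : Fin n → ℝ := fun i => l2norm (fun x => η x * (V i (x + h) - V i x)) volume with ha
  have ha0 : ∀ i, 0 ≤ a i := fun i => l2norm_nonneg _ _
  have hD : ∀ i, MemLp (fun x => η x * (V i (x + h) - V i x)) 2 volume := fun i =>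
    memLp_test_mul hη ((memLp_comp_add (hF.memLp_flux i) h).sub (hF.memLp_flux i))
  have hDp : ∀ i, MemLp (fun x => η x * (p i (x + h) - p i x)) 2 volume := fun i =>
    memLp_test_mul hη ((memLp_comp_add (hF.memLp_grad i) h).sub (hF.memLp_grad i))
  -- With these radii the mollified potential still has the mollified gradient along each segment
  -- from x to x + h starting in the small ball.
  obtain ⟨φ, hφ0, -, hφs⟩ := exists_bump_seq (n := n) (s := R - r - ‖h‖) (by linarith)
  -- The mollified identity is bounded uniformly in the radius, since mollification does not
  -- increase the norms of the p_j, and the radius then tends to zero.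
  have upper : ∑ i, ∫ x, (η x * (V i (x + h) - V i x)) * (η x * (p i (x + h) - p i x))
      ≤ 2 * L * Pn * ‖h‖ * ∑ i, a i := by
    obtain ⟨M, -, hM⟩ := hη.exists_bound
    have hlim : Tendsto (fun m => ∑ i, ∫ x, (η x * (V i (x + h) - V i x)) *
        (η x * (mollify (φ m) (p i) (x + h) - mollify (φ m) (p i) x))) atTop
        (𝓝 (∑ i, ∫ x, (η x * (V i (x + h) - V i x)) * (η x * (p i (x + h) - p i x)))) := by
      refine tendsto_finsetSum _ fun i _ => (TendstoL2.const (hD i)).tendsto_integral_mul ?_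
      have t1 := tendstoL2_mollify (hF.memLp_grad i) hφ0
      have t2 := (t1.comp_add h).add (t1.const_mul (-1))
      refine (t2.bdd_mul (a := fun _ => η) (a₀ := η) (C := M)
        (fun _ => hη.1.continuous.aestronglyMeasurable)
        (fun _ => ae_of_all _ hM) (ae_of_all _ fun _ => tendsto_const_nhds)).congr
        (fun m => ae_of_all _ fun x => ?_) (ae_of_all _ fun x => ?_) <;> simp only <;> ring
    refine le_of_tendsto hlim (Eventually.of_forall fun m => ?_)
    rw [hF.difference_identity hη (φ m) (by linarith [hφs m])]
    have hcP : ∀ j, Continuous (mollify (φ m) (p j)) := fun j =>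
      (contDiff_mollify (φ m) ((hF.memLp_grad j).locallyIntegrable (by norm_num))).continuous
    have hmP : ∀ j, MemLp (mollify (φ m) (p j)) 2 volume := fun j =>
      memLp_mollify (φ m) (hF.memLp_grad j)
    have hG := eLpNorm_segmentAverage_le hmP hcP h
    have hG1 : ENNReal.ofReal ‖h‖ * ∑ j, eLpNorm (mollify (φ m) (p j)) 2 volume
        ≤ ENNReal.ofReal (‖h‖ * Pn) := by
      rw [ENNReal.ofReal_mul (norm_nonneg _), hPn, ENNReal.ofReal_sum_of_nonneg
        fun _ _ => l2norm_nonneg _ _]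
      gcongr with j
      rw [l2norm, ENNReal.ofReal_toReal (hF.memLp_grad j).2.ne]
      exact eLpNorm_mollify_le (φ m) (hF.memLp_grad j)
    have hGc : Continuous (segmentAverage (fun j => mollify (φ m) (p j)) h) := by
      refine intervalIntegral.continuous_parametric_intervalIntegral_of_continuous' ?_ _ _
      refine continuous_finsetSum _ fun j _ => ?_
      exact continuous_const.mul ((hcP j).comp (by fun_prop))
    have hGm : MemLp (segmentAverage (fun j => mollify (φ m) (p j)) h) 2 volume :=
      ⟨hGc.aestronglyMeasurable, (hG.trans hG1).trans_lt ENNReal.ofReal_lt_top⟩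
    have hGl : l2norm (segmentAverage (fun j => mollify (φ m) (p j)) h) volume ≤ ‖h‖ * Pn :=
      ENNReal.toReal_le_of_le_ofReal (by positivity) (hG.trans hG1)
    rw [← Finset.sum_neg_distrib, Finset.mul_sum]
    refine Finset.sum_le_sum fun i _ => ?_
    have hb : ∀ x, |2 * fderiv ℝ η x (basisVec i) *
        segmentAverage (fun j => mollify (φ m) (p j)) h x| ≤
        (2 * L) * |segmentAverage (fun j => mollify (φ m) (p j)) h x| := fun x => by
      rw [abs_mul, abs_mul]
      gcongr
      · simp
      · simpa using hL x (basisVec i)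
    have hI1 : MemLp (fun x => 2 * fderiv ℝ η x (basisVec i) *
        segmentAverage (fun j => mollify (φ m) (p j)) h x) 2 volume :=
      hGm.of_le_mul (((hη.memLp_fderiv (basisVec i)).1.const_mul 2).mul hGm.1) (ae_of_all _ hb)
    calc _ ≤ |∫ x, (η x * (V i (x + h) - V i x)) * (2 * fderiv ℝ η x (basisVec i) *
            segmentAverage (fun j => mollify (φ m) (p j)) h x)| := neg_le_abs _
      _ ≤ a i * l2norm (fun x => 2 * fderiv ℝ η x (basisVec i) *
            segmentAverage (fun j => mollify (φ m) (p j)) h x) volume :=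
          abs_integral_mul_le (hD i) hI1
      _ ≤ a i * ((2 * L) * (‖h‖ * Pn)) := by
          gcongr
          · exact ha0 i
          · exact (l2norm_le_of_le (by positivity) hGm hb).trans (by gcongr)
      _ = 2 * L * Pn * ‖h‖ * a i := by ring
  -- The cocoercive law at the points x + h and x, multiplied by η² and integrated.
  have lower : lam * ∑ i, a i ^ 2 ≤
      ∑ i, ∫ x, (η x * (V i (x + h) - V i x)) * (η x * (p i (x + h) - p i x)) := by
    obtain ⟨S, hS, hmono⟩ := hF.mono
    have e1 : ∀ i, a i ^ 2 = ∫ x, (η x * (V i (x + h) - V i x)) ^ 2 := fun i =>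
      (integral_sq_eq (hD i)).symm
    rw [Finset.sum_congr rfl fun i _ => e1 i, ← integral_finsetSum _ fun i _ => (hD i).integrable_sq,
      ← integral_finsetSum _ fun i _ => integrable_mul_of_memLp (hD i) (hDp i), ← integral_const_mul]
    refine integral_mono_ae ((integrable_finsetSum _ fun i _ => (hD i).integrable_sq).const_mul _)
      (integrable_finsetSum _ fun i _ => integrable_mul_of_memLp (hD i) (hDp i)) ?_
    have hS' : ∀ᵐ x : Euc n, x + h ∈ Metric.ball x₀ R → x + h ∈ S :=
      (measurePreserving_add_right volume h).quasiMeasurePreserving.ae hS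
    filter_upwards [hS, hS'] with x h1 h2
    by_cases hx : x ∈ Metric.ball x₀ r
    · have hx1 : x ∈ Metric.ball x₀ R :=
        Metric.ball_subset_ball (by linarith [norm_nonneg h]) hx
      have hx2 : x + h ∈ Metric.ball x₀ R := by
        rw [Metric.mem_ball] at hx ⊢
        have := dist_triangle (x + h) x x₀
        rw [dist_eq_norm (x + h) x, add_sub_cancel_left] at this
        linarith
      have := mul_le_mul_of_nonneg_left (hmono _ (h2 hx2) _ (h1 hx1)) (sq_nonneg (η x))
      simp_rw [mul_pow, ← Finset.mul_sum]
      have e : ∀ i, η x * (V i (x + h) - V i x) * (η x * (p i (x + h) - p i x)) =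
          η x ^ 2 * ((V i (x + h) - V i x) * (p i (x + h) - p i x)) := fun i => by ring
      simp_rw [e, ← Finset.mul_sum]
      linarith
    · simp [hη.eq_zero hx]
  -- One factor ∑ a_i is absorbed: lam(∑a)² ≤ n·lam·∑a² ≤ nK∑a, with K proportional to ‖h‖.
  -- Cancelling needs ∑a > 0; the case of a vanishing sum is trivial.
  have h1 : lam * ∑ i, a i ^ 2 ≤ 2 * L * Pn * ‖h‖ * ∑ i, a i := lower.trans upper
  have h2 : (∑ i, a i) ^ 2 ≤ n * ∑ i, a i ^ 2 := by
    simpa using sq_sum_le_card_mul_sum_sq (s := Finset.univ) (f := a)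
  have h3 : a i ≤ ∑ i, a i := Finset.single_le_sum (fun i _ => ha0 i) (Finset.mem_univ i)
  have h4 : 0 ≤ ∑ i, a i := Finset.sum_nonneg fun i _ => ha0 i
  refine h3.trans ?_
  rcases h4.eq_or_lt with h5 | h5
  · rw [← h5]
    positivity
  · have h6 : lam * (∑ i, a i) ^ 2 ≤ n * (2 * L * Pn * ‖h‖) * ∑ i, a i := by
      calc lam * (∑ i, a i) ^ 2 ≤ lam * (n * ∑ i, a i ^ 2) := by gcongr
        _ = n * (lam * ∑ i, a i ^ 2) := by ring
        _ ≤ n * (2 * L * Pn * ‖h‖ * ∑ i, a i) := by gcongr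
        _ = _ := by ring
    have h7 : lam * ∑ i, a i ≤ n * (2 * L * Pn * ‖h‖) := by
      refine le_of_mul_le_mul_right ?_ h5
      calc lam * (∑ i, a i) * ∑ i, a i = lam * (∑ i, a i) ^ 2 := by ring
        _ ≤ _ := h6
    rw [show n * (2 * L * Pn / lam) * ‖h‖ = n * (2 * L * Pn * ‖h‖) / lam by ring,
      le_div_iff₀ hlam]
    linarith

end CompressibleFlow

end

/-! ### Weak derivatives of the flux and smooth approximation. -/

noncomputable section

namespace CompressibleFlow

open scoped ENNReal

variable {n : ℕ}

theorem exists_cutoff (x₀ : Euc n) {r s : ℝ} (hr : 0 < r) (hs : r < s) :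
    ∃ η : Euc n → ℝ, IsTestFunction (Metric.ball x₀ s) η ∧ ∀ x ∈ Metric.ball x₀ r, η x = 1 := by
  let φ : ContDiffBump x₀ := ⟨r, (r + s) / 2, hr, by linarith⟩
  refine ⟨φ, ⟨φ.contDiff, φ.hasCompactSupport, ?_⟩, fun x hx =>
    φ.one_of_mem_closedBall (Metric.ball_subset_closedBall hx)⟩
  rw [φ.tsupport_eq]
  exact Metric.closedBall_subset_ball (by simp only [φ]; linarith)

theorem IsTestFunction.lipschitz {U : Set (Euc n)} {χ : Euc n → ℝ} (hχ : IsTestFunction U χ) :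
    ∃ L : ℝ, 0 ≤ L ∧ ∀ x y, |χ x - χ y| ≤ L * ‖x - y‖ := by
  obtain ⟨L, hL⟩ := (hχ.2.1.fderiv ℝ).exists_bound_of_continuous
    (hχ.1.continuous_fderiv (by norm_num))
  refine ⟨L, (norm_nonneg _).trans (hL 0), fun x y => ?_⟩
  exact Convex.norm_image_sub_le_of_norm_fderiv_le (𝕜 := ℝ) (s := Set.univ)
    (fun z _ => hχ.1.differentiable (by norm_num) z) (fun z _ => hL z) convex_univ
    (Set.mem_univ _) (Set.mem_univ _)

/-- Difference quotients converge weakly to the distributional derivative. -/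
theorem tendsto_integral_difference_quotient {f : Euc n → ℝ} (hf : MemLp f 2 volume)
    {x₀ : Euc n} {r : ℝ} {χ : Euc n → ℝ} (hχ : IsTestFunction (Metric.ball x₀ r) χ)
    (v : Euc n) {t : ℕ → ℝ} (ht : Tendsto t atTop (𝓝[≠] 0)) :
    Tendsto (fun j => ∫ x, (t j)⁻¹ * (f (x + t j • v) - f x) * χ x) atTop
      (𝓝 (-∫ x, f x * fderiv ℝ χ x v)) := by
  have ht0 : Tendsto t atTop (𝓝 0) := ht.mono_right nhdsWithin_le_nhds
  have hne : ∀ᶠ j in atTop, t j ≠ 0 := ht.eventually_mem self_mem_nhdsWithin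
  obtain ⟨L, hL0, hL⟩ := hχ.lipschitz
  have hχm : MemLp χ 2 volume := memLp_two_of_contDiff hχ.1.continuous hχ.2.1
  -- Discrete integration by parts: the difference quotient moves to the smooth function χ.
  have hshift : ∀ s : ℝ, ∫ x, s⁻¹ * (f (x + s • v) - f x) * χ x =
      ∫ x, f x * (s⁻¹ * (χ (x - s • v) - χ x)) := fun s => by
    have e1 : ∫ x, f (x + s • v) * χ x = ∫ x, f x * χ (x - s • v) := by
      rw [← integral_add_right_eq_self (fun x => f x * χ (x - s • v)) (s • v)]
      simp
    have e2 : ∫ x, s⁻¹ * (f (x + s • v) - f x) * χ x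
        = s⁻¹ * ((∫ x, f (x + s • v) * χ x) - ∫ x, f x * χ x) := by
      rw [← integral_sub (integrable_mul_of_memLp (memLp_comp_add hf _) hχm)
        (integrable_mul_of_memLp hf hχm), ← integral_const_mul]
      congr 1
      ext x
      ring
    have hχs : MemLp (fun x => χ (x - s • v)) 2 volume := by
      simpa [sub_eq_add_neg] using memLp_comp_add hχm (-(s • v))
    rw [e2, e1, ← integral_sub (integrable_mul_of_memLp hf hχs)
      (integrable_mul_of_memLp hf hχm), ← integral_const_mul]
    congr 1
    ext x
    ring
  simp_rw [hshift]
  -- Once the shift has length at most 1, all integrands live in the closed ball of radius r + 1,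
  -- where f is integrable; the Lipschitz bound for χ gives the majorant.
  have hK : ∀ᶠ j in atTop, ‖t j • v‖ ≤ 1 := by
    have : Tendsto (fun j => ‖t j • v‖) atTop (𝓝 0) := by
      simpa using (ht0.smul_const v).norm
    exact this.eventually_le_const one_pos
  rw [← integral_neg]
  refine tendsto_integral_filter_of_dominated_convergence
    ((Metric.closedBall x₀ (r + 1)).indicator fun x => ‖f x‖ * (L * ‖v‖)) ?_ ?_ ?_ ?_
  · refine Eventually.of_forall fun j => hf.1.mul (Continuous.aestronglyMeasurable ?_)
    exact continuous_const.mul ((hχ.1.continuous.comp (by fun_prop)).sub hχ.1.continuous)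
  · filter_upwards [hK, hne] with j hj hj0
    refine ae_of_all _ fun x => ?_
    by_cases hx : x ∈ Metric.closedBall x₀ (r + 1)
    · rw [Set.indicator_of_mem hx, norm_mul]
      gcongr
      have := hL (x - t j • v) x
      rw [norm_mul, norm_inv, inv_mul_le_iff₀ (norm_pos_iff.2 hj0)]
      refine this.trans_eq ?_
      rw [sub_sub_cancel_left, norm_neg, norm_smul]
      ring
    · have h1 : x ∉ Metric.ball x₀ r := fun h => hx
        (Metric.ball_subset_closedBall (Metric.ball_subset_ball (by linarith) h))
      have h2 : x - t j • v ∉ Metric.ball x₀ r := fun h => hx (by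
        rw [Metric.mem_ball, dist_eq_norm] at h
        rw [Metric.mem_closedBall, dist_eq_norm]
        calc ‖x - x₀‖ = ‖(x - t j • v - x₀) + t j • v‖ := by congr 1; abel
          _ ≤ ‖x - t j • v - x₀‖ + ‖t j • v‖ := norm_add_le _ _
          _ ≤ r + 1 := by linarith)
      rw [Set.indicator_of_notMem hx, hχ.eq_zero h1, hχ.eq_zero h2]
      simp
  · rw [integrable_indicator_iff Metric.isClosed_closedBall.measurableSet]
    exact (((hf.locallyIntegrable (by norm_num)).integrableOn_isCompact
      (isCompact_closedBall _ _)).norm).mul_const _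
  · refine ae_of_all _ fun x => ?_
    have h1 : HasDerivAt (fun s : ℝ => χ (x - s • v)) (-fderiv ℝ χ x v) 0 := by
      have h2 : HasDerivAt (fun s : ℝ => x - s • v) (-v) 0 := by
        simpa using ((hasDerivAt_id (0 : ℝ)).smul_const v).const_sub x
      have h3 : HasFDerivAt χ (fderiv ℝ χ x) (x - (0 : ℝ) • v) := by
        simpa using (hχ.1.differentiable (by norm_num) x).hasFDerivAt
      have h4 := h3.comp_hasDerivAt 0 h2
      rw [map_neg] at h4
      exact h4
    have h4 := (hasDerivAt_iff_tendsto_slope_zero.1 h1).comp ht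
    have h5 := h4.const_mul (f x)
    simpa [Function.comp_def] using h5

/-- The flux of a monotone flow has square integrable weak derivatives on smaller balls. -/
theorem IsMonotoneFlow.exists_weakPartial {x₀ : Euc n} {R lam : ℝ} {u : Euc n → ℝ}
    {V p : Fin n → Euc n → ℝ} (hF : IsMonotoneFlow x₀ R lam u V p) (hlam : 0 < lam) {r : ℝ}
    (hr : 0 < r) (hrR : r < R) (i k : Fin n) :
    ∃ N : Euc n → ℝ, MemLp N 2 volume ∧ HasWeakPartial (Metric.ball x₀ r) k (V i) N := by
  -- The cutoff equals 1 on the ball of radius r and lives in the ball of radius (r + R)/2. Shifts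
  -- of length at most (R - r)/4 then stay inside the ball of radius R.
  obtain ⟨η, hη, hη1⟩ := exists_cutoff x₀ hr (show r < (r + R) / 2 by linarith)
  obtain ⟨C, hC⟩ := hF.exists_difference_bound hlam hη
  let t : ℕ → ℝ := fun j => (R - r) / 4 / ((j : ℝ) + 1)
  have htpos : ∀ j, 0 < t j := fun j => div_pos (by linarith) (by positivity)
  have htle : ∀ j, t j ≤ (R - r) / 4 := fun j =>
    div_le_self (by linarith) (by linarith [(Nat.cast_nonneg j : (0 : ℝ) ≤ j)])
  have ht : Tendsto t atTop (𝓝[≠] 0) := by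
    refine tendsto_nhdsWithin_iff.2 ⟨?_, Eventually.of_forall fun j => (htpos j).ne'⟩
    have := (tendsto_const_div_atTop_nhds_zero_nat ((R - r) / 4)).comp (tendsto_add_atTop_nat 1)
    simpa [Function.comp_def, t] using this
  have hFm : ∀ j, MemLp (fun x => (t j)⁻¹ * (η x * (V i (x + t j • basisVec k) - V i x))) 2
      volume := fun j => (memLp_test_mul hη
        ((memLp_comp_add (hF.memLp_flux i) _).sub (hF.memLp_flux i))).const_mul _
  have hbd : ∀ j, ‖(hFm j).toLp‖ ≤ C := fun j => by
    rw [Lp.norm_toLp]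
    have h1 := hC (t j • basisVec k) (by
      rw [norm_smul, Real.norm_eq_abs, abs_of_pos (htpos j)]
      simp only [PiLp.norm_single, norm_one, mul_one]
      linarith [htle j]) i
    have h2 : l2norm (fun x => (t j)⁻¹ * (η x * (V i (x + t j • basisVec k) - V i x))) volume
        ≤ (t j)⁻¹ * l2norm (fun x => η x * (V i (x + t j • basisVec k) - V i x)) volume := by
      refine l2norm_le_of_le (inv_nonneg.2 (htpos j).le) (memLp_test_mul hη
        ((memLp_comp_add (hF.memLp_flux i) _).sub (hF.memLp_flux i))) fun x => ?_
      rw [abs_mul, abs_of_pos (inv_pos.2 (htpos j))]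
    refine h2.trans ?_
    rw [inv_mul_le_iff₀ (htpos j)]
    refine h1.trans_eq ?_
    rw [norm_smul, Real.norm_eq_abs, abs_of_pos (htpos j)]
    simp [mul_comm]
  -- The cut-off difference quotients are bounded in L². Their weak limit is the weak derivative,
  -- because η = 1 on the support of every test function of the smaller ball.
  obtain ⟨N, hN⟩ := exists_weak_limit hbd
  refine ⟨N, Lp.memLp N, fun χ hχ => ?_⟩
  have hχm : MemLp χ 2 volume := memLp_two_of_contDiff hχ.1.continuous hχ.2.1
  have h1 := hN hχm.toLp
  have h2 := (tendsto_integral_difference_quotient (hF.memLp_flux i) hχ (basisVec k) ht).mono_left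
    (Nat.hyperfilter_le_atTop)
  have e1 : ∀ j, inner ℝ (hFm j).toLp hχm.toLp =
      ∫ x, (t j)⁻¹ * (V i (x + t j • basisVec k) - V i x) * χ x := fun j => by
    rw [← integral_mul_eq_inner (hFm j) hχm]
    refine integral_congr_ae (ae_of_all _ fun x => ?_)
    by_cases hx : x ∈ Metric.ball x₀ r
    · simp [hη1 x hx]
    · simp [hχ.eq_zero hx]
  have e2 : inner ℝ N hχm.toLp = ∫ x, N x * χ x := by
    rw [integral_mul_eq_inner (Lp.memLp N) hχm, Lp.toLp_coeFn]
  simp_rw [e1, e2] at h1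
  have := tendsto_nhds_unique h1 h2
  linarith

/-- Smooth approximations, on a ball, of a divergence free field `V` and a curl free field `p`,
such that the derivatives of the approximations of `V` converge to `N`. -/
structure IsApproximation (x₀ : Euc n) (r : ℝ) (V p : Fin n → Euc n → ℝ)
    (N : Fin n → Fin n → Euc n → ℝ) (Vm pm : ℕ → Fin n → Euc n → ℝ) : Prop where
  contDiff_flux : ∀ m i, ContDiff ℝ ∞ (Vm m i)
  contDiff_grad : ∀ m i, ContDiff ℝ ∞ (pm m i)
  div_free : ∀ m, ∀ x ∈ Metric.ball x₀ r, ∑ i, fderiv ℝ (Vm m i) x (basisVec i) = 0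
  curl_free : ∀ m, ∀ x ∈ Metric.ball x₀ r, ∀ i j,
    fderiv ℝ (pm m j) x (basisVec i) = fderiv ℝ (pm m i) x (basisVec j)
  tendsto_flux : ∀ i, TendstoL2 (volume.restrict (Metric.ball x₀ r)) (fun m => Vm m i) (V i)
  tendsto_flux_ae : ∀ i, ∀ᵐ x ∂(volume.restrict (Metric.ball x₀ r)),
    Tendsto (fun m => Vm m i x) atTop (𝓝 (V i x))
  tendsto_grad : ∀ i, TendstoL2 (volume.restrict (Metric.ball x₀ r)) (fun m => pm m i) (p i)
  tendsto_partial : ∀ i k, TendstoL2 (volume.restrict (Metric.ball x₀ r))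
    (fun m x => fderiv ℝ (Vm m i) x (basisVec k)) (N i k)

theorem fderiv_fderiv_apply {f : Euc n → ℝ} (hf : ContDiff ℝ ∞ f) (x v w : Euc n) :
    fderiv ℝ (fun y => fderiv ℝ f y v) x w = fderiv ℝ (fderiv ℝ f) x w v := by
  have h1 : DifferentiableAt ℝ (fderiv ℝ f) x :=
    (hf.fderiv_right (m := 1) (by norm_cast)).differentiable (by norm_num) x
  rw [fderiv_clm_apply h1 (by fun_prop)]
  simp

theorem fderiv_fderiv_comm {f : Euc n → ℝ} (hf : ContDiff ℝ ∞ f) (x v w : Euc n) :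
    fderiv ℝ (fun y => fderiv ℝ f y v) x w = fderiv ℝ (fun y => fderiv ℝ f y w) x v := by
  rw [fderiv_fderiv_apply hf, fderiv_fderiv_apply hf]
  exact (hf.contDiffAt.isSymmSndFDerivAt (by simp; norm_cast)) w v

/-- All approximations are mollifications with radius below (R - r)/2, so that they respect the weak
equations on the ball of radius r. The mollified p is there the gradient of the mollified potential,
hence curl free; the derivatives of the mollified V are the mollified N, hence converge in L². -/
theorem IsMonotoneFlow.exists_approximation {x₀ : Euc n} {R lam : ℝ} {u : Euc n → ℝ}
    {V p : Fin n → Euc n → ℝ} (hF : IsMonotoneFlow x₀ R lam u V p) (hlam : 0 < lam) {r : ℝ}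
    (hr : 0 < r) (hrR : r < R) :
    ∃ N Vm pm, IsApproximation x₀ r V p N Vm pm := by
  choose N hN hN' using hF.exists_weakPartial (r := (r + R) / 2) hlam (by linarith) (by linarith)
  obtain ⟨φ, hφ0, hφ2, hφs⟩ := exists_bump_seq (n := n) (s := (R - r) / 2) (by linarith)
  have hlV : ∀ i, LocallyIntegrable (V i) := fun i => (hF.memLp_flux i).locallyIntegrable (by norm_num)
  have hlp : ∀ i, LocallyIntegrable (p i) := fun i => (hF.memLp_grad i).locallyIntegrable (by norm_num)
  have hin : ∀ m, ∀ x ∈ Metric.ball x₀ r, x ∈ Metric.ball x₀ ((r + R) / 2 - (φ m).rOut) :=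
    fun m x hx => Metric.ball_subset_ball (by linarith [hφs m]) hx
  have hin' : ∀ m, ∀ x ∈ Metric.ball x₀ r, x ∈ Metric.ball x₀ (R - (φ m).rOut) :=
    fun m x hx => Metric.ball_subset_ball (by linarith [hφs m]) hx
  refine ⟨N, fun m i => mollify (φ m) (V i), fun m i => mollify (φ m) (p i),
    fun m i => contDiff_mollify _ (hlV i), fun m i => contDiff_mollify _ (hlp i), ?_, ?_,
    fun i => (tendstoL2_mollify (hF.memLp_flux i) hφ0).restrict _,
    fun i => ae_restrict_of_ae (tendsto_mollify_ae (hlV i) hφ0 hφ2),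
    fun i => (tendstoL2_mollify (hF.memLp_grad i) hφ0).restrict _, fun i k => ?_⟩
  · intro m x hx
    have h1 := hF.weak_div _ (isTestFunction_bump (φ m) (hin' m x hx))
    simp_rw [fderiv_const_sub_apply
      (((φ m).contDiff_normed (n := 1)).differentiable (by norm_num)) x, mul_neg, integral_neg,
      Finset.sum_neg_distrib, neg_eq_zero] at h1
    simp_rw [fderiv_mollify_apply (φ m) (hlV _)]
    simpa only [mul_comm] using h1
  · intro m x hx i j
    have hU : ContDiff ℝ ∞ (mollify (φ m) u) := contDiff_mollify _ hF.locInt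
    have h1 : ∀ i, mollify (φ m) (p i) =ᶠ[𝓝 x]
        fun y => fderiv ℝ (mollify (φ m) u) y (basisVec i) := fun i => by
      filter_upwards [Metric.isOpen_ball.mem_nhds (hin' m x hx)] with y hy
      exact (hF.fderiv_mollify_potential (φ m) hy i).symm
    rw [(h1 j).fderiv_eq, (h1 i).fderiv_eq, fderiv_fderiv_comm hU]
  · refine ((tendstoL2_mollify (hN i k) hφ0).restrict _).congr (fun m => ?_) (ae_of_all _ fun _ => rfl)
    filter_upwards [ae_restrict_mem Metric.isOpen_ball.measurableSet] with x hx
    exact (fderiv_mollify_of_weakPartial (hlV i) (hN' i k) (φ m) (hin m x hx)).symm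

end CompressibleFlow

end

/-! ### The chain rule for cut-off functions of |V|². -/

noncomputable section

namespace CompressibleFlow

open scoped ENNReal

variable {n : ℕ}

/-- The squared length of the vector field with components `V i`. -/
def normSq (V : Fin n → Euc n → ℝ) (x : Euc n) : ℝ := ∑ j, V j x ^ 2

theorem normSq_nonneg (V : Fin n → Euc n → ℝ) (x : Euc n) : 0 ≤ normSq V x :=
  Finset.sum_nonneg fun _ _ => sq_nonneg _

theorem sq_le_normSq (V : Fin n → Euc n → ℝ) (x : Euc n) (k : Fin n) : V k x ^ 2 ≤ normSq V x :=
  Finset.single_le_sum (f := fun j => V j x ^ 2) (fun _ _ => sq_nonneg _) (Finset.mem_univ k)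

theorem abs_mul_le_normSq (V : Fin n → Euc n → ℝ) (x : Euc n) (j k : Fin n) :
    |V j x * V k x| ≤ normSq V x := by
  have h1 := sq_le_normSq V x j
  have h2 := sq_le_normSq V x k
  rw [abs_le]
  constructor <;> nlinarith [sq_nonneg (V j x + V k x), sq_nonneg (V j x - V k x)]

theorem abs_le_one_add_normSq (V : Fin n → Euc n → ℝ) (x : Euc n) (j : Fin n) :
    |V j x| ≤ 1 + normSq V x := by
  have h1 := sq_le_normSq V x j
  rw [abs_le]
  constructor <;> nlinarith [sq_nonneg (V j x + 1), sq_nonneg (V j x - 1)]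

/-- Half the gradient of `normSq V`, in terms of the derivatives `N` of `V`. -/
def halfGrad (V : Fin n → Euc n → ℝ) (N : Fin n → Fin n → Euc n → ℝ) (i : Fin n) (x : Euc n) : ℝ :=
  ∑ j, V j x * N j i x

/-- Bounded continuously differentiable functions of `t ≥ 0` with a bound on
`(1 + t) c'(t)`. -/
structure BddC1 (c c' : ℝ → ℝ) : Prop where
  hasDerivAt : ∀ t, HasDerivAt c (c' t) t
  continuous_deriv : Continuous c'
  bdd : ∃ C, ∀ t, 0 ≤ t → |c t| ≤ C ∧ |c' t| * (1 + t) ≤ C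

theorem BddC1.continuous {c c' : ℝ → ℝ} (h : BddC1 c c') : Continuous c :=
  continuous_iff_continuousAt.2 fun t => (h.hasDerivAt t).continuousAt

theorem BddC1.contDiff {c c' : ℝ → ℝ} (h : BddC1 c c') : ContDiff ℝ 1 c := by
  rw [contDiff_one_iff_deriv]
  refine ⟨fun t => (h.hasDerivAt t).differentiableAt, ?_⟩
  rw [show deriv c = c' from funext fun t => (h.hasDerivAt t).deriv]
  exact h.continuous_deriv

/-- The weight 1 + t matters only on the compact interval [0, T], since the derivative vanishes
beyond it. -/
theorem BddC1.of_deriv_eq_zero {c c' : ℝ → ℝ} (h : ∀ t, HasDerivAt c (c' t) t)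
    (hc : Continuous c') {T C : ℝ} (hT : ∀ t, T ≤ t → c' t = 0) (hC : ∀ t, 0 ≤ t → |c t| ≤ C) :
    BddC1 c c' := by
  refine ⟨h, hc, ?_⟩
  obtain ⟨M, hM⟩ := isCompact_Icc.exists_bound_of_continuousOn (s := Set.Icc 0 T)
    (f := fun t => c' t * (1 + t)) (by fun_prop)
  refine ⟨max C (max M 0), fun t ht => ⟨(hC t ht).trans (le_max_left _ _), ?_⟩⟩
  rcases le_or_gt T t with h1 | h1
  · rw [hT t h1]
    simp
  · have := hM t ⟨ht, h1.le⟩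
    rw [norm_mul, Real.norm_eq_abs, Real.norm_eq_abs, abs_of_nonneg (by linarith : 0 ≤ 1 + t)]
      at this
    exact this.trans ((le_max_left _ _).trans (le_max_right _ _))

theorem contDiff_normSq {W : Fin n → Euc n → ℝ} (hW : ∀ i, ContDiff ℝ ∞ (W i)) :
    ContDiff ℝ 1 (normSq W) :=
  ContDiff.sum fun j _ => ((hW j).of_le (by exact_mod_cast le_top)).pow 2

theorem fderiv_normSq {W : Fin n → Euc n → ℝ} (hW : ∀ i, ContDiff ℝ ∞ (W i)) (x v : Euc n) :
    fderiv ℝ (normSq W) x v = 2 * ∑ j, W j x * fderiv ℝ (W j) x v := by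
  have hd : ∀ j, DifferentiableAt ℝ (W j) x := fun j => (hW j).differentiable (by norm_num) x
  have h1 : HasFDerivAt (normSq W) (∑ j, (2 * W j x) • fderiv ℝ (W j) x) x := by
    refine HasFDerivAt.fun_sum fun j _ => ?_
    simpa using (hd j).hasFDerivAt.pow 2
  rw [h1.fderiv]
  simp [Finset.mul_sum, mul_assoc]

theorem contDiff_comp_normSq {c c' : ℝ → ℝ} (hc : BddC1 c c') {W : Fin n → Euc n → ℝ}
    (hW : ∀ i, ContDiff ℝ ∞ (W i)) : ContDiff ℝ 1 fun x => c (normSq W x) :=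
  hc.contDiff.comp (contDiff_normSq hW)

theorem fderiv_comp_normSq {c c' : ℝ → ℝ} (hc : BddC1 c c') {W : Fin n → Euc n → ℝ}
    (hW : ∀ i, ContDiff ℝ ∞ (W i)) (x v : Euc n) :
    fderiv ℝ (fun x => c (normSq W x)) x v
      = c' (normSq W x) * (2 * ∑ j, W j x * fderiv ℝ (W j) x v) := by
  have h1 := (hc.hasDerivAt (normSq W x)).comp_hasFDerivAt x
    ((contDiff_normSq hW).differentiable (by norm_num) x).hasFDerivAt
  have h2 : HasFDerivAt (fun x => c (normSq W x)) _ x := h1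
  rw [h2.fderiv, smul_apply, fderiv_normSq hW, smul_eq_mul]

/-- The gradient of `θ c(|V|²)`. -/
def cutScalarGrad (θ : Euc n → ℝ) (c c' : ℝ → ℝ) (V : Fin n → Euc n → ℝ)
    (N : Fin n → Fin n → Euc n → ℝ) (i : Fin n) (x : Euc n) : ℝ :=
  fderiv ℝ θ x (basisVec i) * c (normSq V x)
    + θ x * (c' (normSq V x) * (2 * halfGrad V N i x))

/-- The gradient of `θ c(|V|²) V k`. -/
def cutGrad (θ : Euc n → ℝ) (c c' : ℝ → ℝ) (V : Fin n → Euc n → ℝ)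
    (N : Fin n → Fin n → Euc n → ℝ) (k i : Fin n) (x : Euc n) : ℝ :=
  cutScalarGrad θ c c' V N i x * V k x + θ x * c (normSq V x) * N k i x

theorem fderiv_cutScalar {θ : Euc n → ℝ} (hθ : ContDiff ℝ ∞ θ) {c c' : ℝ → ℝ} (hc : BddC1 c c')
    {W : Fin n → Euc n → ℝ} (hW : ∀ i, ContDiff ℝ ∞ (W i)) (x : Euc n) (i : Fin n) :
    fderiv ℝ (fun x => θ x * c (normSq W x)) x (basisVec i) =
      cutScalarGrad θ c c' W (fun j i x => fderiv ℝ (W j) x (basisVec i)) i x := by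
  rw [fderiv_fun_mul (hθ.differentiable (by norm_num) x)
    ((contDiff_comp_normSq hc hW).differentiable (by norm_num) x), add_apply,
    smul_apply, smul_apply, fderiv_comp_normSq hc hW]
  simp only [cutScalarGrad, halfGrad, smul_eq_mul]
  ring

theorem fderiv_cut {θ : Euc n → ℝ} (hθ : ContDiff ℝ ∞ θ) {c c' : ℝ → ℝ} (hc : BddC1 c c')
    {W : Fin n → Euc n → ℝ} (hW : ∀ i, ContDiff ℝ ∞ (W i)) (x : Euc n) (k i : Fin n) :
    fderiv ℝ (fun x => θ x * c (normSq W x) * W k x) x (basisVec i) =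
      cutGrad θ c c' W (fun j i x => fderiv ℝ (W j) x (basisVec i)) k i x := by
  have h1 : ContDiff ℝ 1 fun x => θ x * c (normSq W x) :=
    (hθ.of_le (by exact_mod_cast le_top)).mul (contDiff_comp_normSq hc hW)
  rw [fderiv_fun_mul (h1.differentiable (by norm_num) x)
    ((hW k).differentiable (by norm_num) x), add_apply,
    smul_apply, smul_apply, fderiv_cutScalar hθ hc hW]
  simp only [cutGrad, smul_eq_mul]
  ring

theorem contDiff_cutScalar {θ : Euc n → ℝ} (hθ : ContDiff ℝ ∞ θ) {c c' : ℝ → ℝ}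
    (hc : BddC1 c c') {W : Fin n → Euc n → ℝ} (hW : ∀ i, ContDiff ℝ ∞ (W i)) :
    ContDiff ℝ 1 (fun x => θ x * c (normSq W x)) :=
  (hθ.of_le (by exact_mod_cast le_top)).mul (contDiff_comp_normSq hc hW)

theorem contDiff_cut {θ : Euc n → ℝ} (hθ : ContDiff ℝ ∞ θ) {c c' : ℝ → ℝ}
    (hc : BddC1 c c') {W : Fin n → Euc n → ℝ} (hW : ∀ i, ContDiff ℝ ∞ (W i)) (k : Fin n) :
    ContDiff ℝ 1 (fun x => θ x * c (normSq W x) * W k x) :=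
  (contDiff_cutScalar hθ hc hW).mul ((hW k).of_le (by exact_mod_cast le_top))

namespace IsApproximation

variable {x₀ : Euc n} {r : ℝ} {V p : Fin n → Euc n → ℝ} {N : Fin n → Fin n → Euc n → ℝ}
  {Vm pm : ℕ → Fin n → Euc n → ℝ}

theorem tendsto_normSq_ae (h : IsApproximation x₀ r V p N Vm pm) :
    ∀ᵐ x ∂(volume.restrict (Metric.ball x₀ r)),
      (∀ i, Tendsto (fun m => Vm m i x) atTop (𝓝 (V i x))) ∧
      Tendsto (fun m => normSq (Vm m) x) atTop (𝓝 (normSq V x)) := by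
  filter_upwards [ae_all_iff.2 h.tendsto_flux_ae] with x hx
  exact ⟨hx, tendsto_finsetSum _ fun j _ => (hx j).pow 2⟩

theorem continuous_normSq (h : IsApproximation x₀ r V p N Vm pm) (m : ℕ) :
    Continuous (normSq (Vm m)) := (contDiff_normSq (h.contDiff_flux m)).continuous

theorem tendsto_cutScalarGrad (h : IsApproximation x₀ r V p N Vm pm) {c c' : ℝ → ℝ}
    (hc : BddC1 c c') {θ : Euc n → ℝ} (hθ : IsTestFunction (Metric.ball x₀ r) θ) (i : Fin n) :
    TendstoL2 (volume.restrict (Metric.ball x₀ r)) (fun m => cutScalarGrad θ c c' (Vm m)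
      (fun j i x => fderiv ℝ (Vm m j) x (basisVec i)) i) (cutScalarGrad θ c c' V N i) := by
  obtain ⟨C, hC⟩ := hc.bdd
  obtain ⟨L, hL0, hL⟩ := hθ.exists_bound
  have t1 : TendstoL2 (volume.restrict (Metric.ball x₀ r))
      (fun m x => c (normSq (Vm m) x) * fderiv ℝ θ x (basisVec i))
      (fun x => c (normSq V x) * fderiv ℝ θ x (basisVec i)) := by
    refine (TendstoL2.const ((hθ.memLp_fderiv _).restrict _)).bdd_mul (C := C)
      (fun m => (hc.continuous.comp (h.continuous_normSq m)).aestronglyMeasurable)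
      (fun m => ae_of_all _ fun x => (hC _ (normSq_nonneg _ x)).1) ?_
    filter_upwards [h.tendsto_normSq_ae] with x hx
    exact (hc.continuous.tendsto _).comp hx.2
  have t2 : ∀ j, TendstoL2 (volume.restrict (Metric.ball x₀ r))
      (fun m x => (θ x * (c' (normSq (Vm m) x) * Vm m j x)) * fderiv ℝ (Vm m j) x (basisVec i))
      (fun x => (θ x * (c' (normSq V x) * V j x)) * N j i x) := fun j => by
    refine (h.tendsto_partial j i).bdd_mul (C := L * C) (fun m => ?_)
      (fun m => ae_of_all _ fun x => ?_) ?_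
    · exact (hθ.1.continuous.mul ((hc.continuous_deriv.comp (h.continuous_normSq m)).mul
        (h.contDiff_flux m j).continuous)).aestronglyMeasurable
    · rw [abs_mul, abs_mul]
      refine mul_le_mul (hL x) ?_ (by positivity) hL0
      exact (mul_le_mul_of_nonneg_left (abs_le_one_add_normSq _ x j) (abs_nonneg _)).trans
        (hC _ (normSq_nonneg _ x)).2
    · filter_upwards [h.tendsto_normSq_ae] with x hx
      exact (((hc.continuous_deriv.tendsto _).comp hx.2).mul (hx.1 j)).const_mul _
  refine (t1.add ((TendstoL2.sum fun j (_ : j ∈ Finset.univ) => t2 j).const_mul 2)).congr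
    (fun m => ae_of_all _ fun x => ?_) (ae_of_all _ fun x => ?_) <;>
  · simp only [cutScalarGrad, halfGrad, Finset.mul_sum]
    congr 1
    · ring
    · exact Finset.sum_congr rfl fun j _ => by ring

/-- The critical terms are 2θc'(|V|²)V_jV_k∂_iV_j. As |V_jV_k| ≤ |V|², the bound on (1 + t)c'(t)
makes their coefficients bounded, and `TendstoL2.bdd_mul` applies although V itself may be
unbounded. -/
theorem tendsto_cutGrad (h : IsApproximation x₀ r V p N Vm pm) {c c' : ℝ → ℝ}
    (hc : BddC1 c c') {θ : Euc n → ℝ} (hθ : IsTestFunction (Metric.ball x₀ r) θ) (k i : Fin n) :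
    TendstoL2 (volume.restrict (Metric.ball x₀ r)) (fun m => cutGrad θ c c' (Vm m)
      (fun j i x => fderiv ℝ (Vm m j) x (basisVec i)) k i) (cutGrad θ c c' V N k i) := by
  obtain ⟨C, hC⟩ := hc.bdd
  obtain ⟨L, hL0, hL⟩ := hθ.exists_bound
  obtain ⟨L', hL0', hL'⟩ := hθ.exists_bound_fderiv
  have hC0 : 0 ≤ C := (abs_nonneg _).trans (hC 0 le_rfl).1
  have t1 : TendstoL2 (volume.restrict (Metric.ball x₀ r))
      (fun m x => (c (normSq (Vm m) x) * fderiv ℝ θ x (basisVec i)) * Vm m k x)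
      (fun x => (c (normSq V x) * fderiv ℝ θ x (basisVec i)) * V k x) := by
    refine (h.tendsto_flux k).bdd_mul (C := C * L')
      (fun m => ((hc.continuous.comp (h.continuous_normSq m)).mul
        ((hθ.1.continuous_fderiv (by norm_num)).clm_apply continuous_const)).aestronglyMeasurable)
      (fun m => ae_of_all _ fun x => ?_) ?_
    · rw [abs_mul]
      exact mul_le_mul (hC _ (normSq_nonneg _ x)).1 (by simpa using hL' x (basisVec i))
        (abs_nonneg _) hC0
    · filter_upwards [h.tendsto_normSq_ae] with x hx
      exact ((hc.continuous.tendsto _).comp hx.2).mul_const _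
  have t2 : ∀ j, TendstoL2 (volume.restrict (Metric.ball x₀ r))
      (fun m x => (θ x * (c' (normSq (Vm m) x) * (Vm m j x * Vm m k x)))
        * fderiv ℝ (Vm m j) x (basisVec i))
      (fun x => (θ x * (c' (normSq V x) * (V j x * V k x))) * N j i x) := fun j => by
    refine (h.tendsto_partial j i).bdd_mul (C := L * C) (fun m => ?_)
      (fun m => ae_of_all _ fun x => ?_) ?_
    · exact (hθ.1.continuous.mul ((hc.continuous_deriv.comp (h.continuous_normSq m)).mul
        ((h.contDiff_flux m j).continuous.mul
          (h.contDiff_flux m k).continuous))).aestronglyMeasurable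
    · rw [abs_mul, abs_mul]
      refine mul_le_mul (hL x) ?_ (by positivity) hL0
      refine le_trans (mul_le_mul_of_nonneg_left ?_ (abs_nonneg _)) (hC _ (normSq_nonneg _ x)).2
      exact (abs_mul_le_normSq _ x j k).trans (by linarith)
    · filter_upwards [h.tendsto_normSq_ae] with x hx
      exact (((hc.continuous_deriv.tendsto _).comp hx.2).mul ((hx.1 j).mul (hx.1 k))).const_mul _
  have t3 : TendstoL2 (volume.restrict (Metric.ball x₀ r))
      (fun m x => (θ x * c (normSq (Vm m) x)) * fderiv ℝ (Vm m k) x (basisVec i))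
      (fun x => (θ x * c (normSq V x)) * N k i x) := by
    refine (h.tendsto_partial k i).bdd_mul (C := L * C)
      (fun m => (hθ.1.continuous.mul
        (hc.continuous.comp (h.continuous_normSq m))).aestronglyMeasurable)
      (fun m => ae_of_all _ fun x => ?_) ?_
    · rw [abs_mul]
      exact mul_le_mul (hL x) (hC _ (normSq_nonneg _ x)).1 (abs_nonneg _) hL0
    · filter_upwards [h.tendsto_normSq_ae] with x hx
      exact ((hc.continuous.tendsto _).comp hx.2).const_mul _
  refine ((t1.add ((TendstoL2.sum fun j (_ : j ∈ Finset.univ) => t2 j).const_mul 2)).add t3).congr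
    (fun m => ae_of_all _ fun x => ?_) (ae_of_all _ fun x => ?_) <;>
  · simp only [cutGrad, cutScalarGrad, halfGrad, Finset.mul_sum, Finset.sum_mul, add_mul]
    congr 2
    · ring
    · exact Finset.sum_congr rfl fun j _ => by ring

end IsApproximation

end CompressibleFlow

end

/-! ### Integral identities and the pointwise curl relation. -/

noncomputable section

namespace CompressibleFlow

open scoped ENNReal

variable {n : ℕ}

theorem integral_mul_fderiv_of_hasCompactSupport {f ζ : Euc n → ℝ} (hf : ContDiff ℝ 1 f)
    (hζ : ContDiff ℝ 1 ζ) (hc : HasCompactSupport ζ) (v : Euc n) :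
    ∫ x, f x * fderiv ℝ ζ x v = -∫ x, fderiv ℝ f x v * ζ x := by
  have hf' : Continuous fun x => fderiv ℝ f x v :=
    (hf.continuous_fderiv (by norm_num)).clm_apply continuous_const
  have hζ' : Continuous fun x => fderiv ℝ ζ x v :=
    (hζ.continuous_fderiv (by norm_num)).clm_apply continuous_const
  refine integral_mul_fderiv_eq_neg_fderiv_mul_of_integrable ?_ ?_ ?_
    (fun x _ => hf.differentiable (by norm_num) x) fun x _ => hζ.differentiable (by norm_num) x
  · exact (hf'.mul hζ.continuous).integrable_of_hasCompactSupport hc.mul_left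
  · exact (hf.continuous.mul hζ').integrable_of_hasCompactSupport (hc.fderiv_apply ℝ v).mul_left
  · exact (hf.continuous.mul hζ.continuous).integrable_of_hasCompactSupport hc.mul_left

theorem integral_fderiv_of_hasCompactSupport {ζ : Euc n → ℝ}
    (hζ : ContDiff ℝ 1 ζ) (hc : HasCompactSupport ζ) (v : Euc n) :
    ∫ x, fderiv ℝ ζ x v = 0 := by
  simpa using integral_mul_fderiv_of_hasCompactSupport (f := fun _ => 1) contDiff_const hζ hc v

theorem contDiff_fderiv_apply {f : Euc n → ℝ} (hf : ContDiff ℝ ∞ f) (v : Euc n) :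
    ContDiff ℝ ∞ fun x => fderiv ℝ f x v :=
  (hf.fderiv_right (m := ∞) (by norm_cast)).clm_apply contDiff_const

/-- Derivatives of a divergence free field are divergence free, tested with `C¹` functions. -/
theorem sum_integral_fderiv_mul_fderiv_eq_zero {W : Fin n → Euc n → ℝ}
    (hW : ∀ i, ContDiff ℝ ∞ (W i)) {U : Set (Euc n)} (hU : IsOpen U)
    (hdiv : ∀ x ∈ U, ∑ i, fderiv ℝ (W i) x (basisVec i) = 0) {ζ : Euc n → ℝ}
    (hζ : ContDiff ℝ 1 ζ) (hc : HasCompactSupport ζ) (hs : tsupport ζ ⊆ U) (k : Fin n) :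
    ∑ i, ∫ x, fderiv ℝ (W i) x (basisVec k) * fderiv ℝ ζ x (basisVec i) = 0 := by
  have h1 : ∀ i, ContDiff ℝ ∞ fun x => fderiv ℝ (W i) x (basisVec k) :=
    fun i => contDiff_fderiv_apply (hW i) _
  rw [Finset.sum_congr rfl fun i _ => integral_mul_fderiv_of_hasCompactSupport
    ((h1 i).of_le (by exact_mod_cast le_top)) hζ hc (basisVec i), Finset.sum_neg_distrib,
    ← integral_finsetSum, neg_eq_zero]
  · refine integral_eq_zero_of_ae (ae_of_all _ fun x => ?_)
    by_cases hx : x ∈ U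
    · simp only [Pi.zero_apply]
      rw [← Finset.sum_mul]
      have h2 : ∑ i, fderiv ℝ (fun x => fderiv ℝ (W i) x (basisVec k)) x (basisVec i) = 0 := by
        rw [Finset.sum_congr rfl fun i _ => fderiv_fderiv_comm (hW i) x (basisVec k) (basisVec i)]
        -- The divergence vanishes on a neighbourhood of x, so it may be differentiated in the
        -- direction k; second derivatives are then exchanged.
        have h3 : (fun y => ∑ i, fderiv ℝ (W i) y (basisVec i)) =ᶠ[𝓝 x] fun _ => 0 := by
          filter_upwards [hU.mem_nhds hx] with y hy using hdiv y hy
        have h4 := h3.fderiv_eq (𝕜 := ℝ)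
        rw [fderiv_fun_sum fun i _ => (contDiff_fderiv_apply (hW i) _).differentiable
          (by norm_num) x] at h4
        have h5 := congrArg (fun L => L (basisVec k)) h4
        simpa using h5
      rw [h2, zero_mul]
    · have h2 : ζ x = 0 := image_eq_zero_of_notMem_tsupport fun h => hx (hs h)
      simp [h2]
  · intro i _
    exact (((contDiff_fderiv_apply (h1 i) _).continuous).mul
      hζ.continuous).integrable_of_hasCompactSupport hc.mul_left

theorem setIntegral_mul_fderiv {U : Set (Euc n)} {ζ : Euc n → ℝ} (hs : tsupport ζ ⊆ U)
    (f : Euc n → ℝ) (v : Euc n) :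
    ∫ x in U, f x * fderiv ℝ ζ x v = ∫ x, f x * fderiv ℝ ζ x v := by
  refine setIntegral_eq_integral_of_forall_compl_eq_zero fun x hx => ?_
  have : x ∉ tsupport (fderiv ℝ ζ) := fun h' => hx (hs (tsupport_fderiv_subset ℝ h'))
  rw [image_eq_zero_of_notMem_tsupport this]
  simp

namespace IsApproximation

variable {x₀ : Euc n} {r : ℝ} {V p : Fin n → Euc n → ℝ} {N : Fin n → Fin n → Euc n → ℝ}
  {Vm pm : ℕ → Fin n → Euc n → ℝ}

/-- The differentiated divergence equation, tested with `θ c(|V|²) V`. -/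
theorem sum_integral_partial_mul_cutGrad (h : IsApproximation x₀ r V p N Vm pm) {c c' : ℝ → ℝ}
    (hc : BddC1 c c') {θ : Euc n → ℝ} (hθ : IsTestFunction (Metric.ball x₀ r) θ) :
    ∑ k, ∑ i, ∫ x in Metric.ball x₀ r, N i k x * cutGrad θ c c' V N k i x = 0 := by
  have hlim : Tendsto (fun m => ∑ k, ∑ i, ∫ x in Metric.ball x₀ r,
      fderiv ℝ (Vm m i) x (basisVec k) * cutGrad θ c c' (Vm m)
        (fun j i x => fderiv ℝ (Vm m j) x (basisVec i)) k i x) atTop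
      (𝓝 (∑ k, ∑ i, ∫ x in Metric.ball x₀ r, N i k x * cutGrad θ c c' V N k i x)) :=
    tendsto_finsetSum _ fun k _ => tendsto_finsetSum _ fun i _ =>
      (h.tendsto_partial i k).tendsto_integral_mul (h.tendsto_cutGrad hc hθ k i)
  refine tendsto_nhds_unique hlim (tendsto_const_nhds.congr fun m => ?_)
  refine (Finset.sum_eq_zero fun k _ => ?_).symm
  have hs : tsupport (fun x => θ x * c (normSq (Vm m) x) * Vm m k x) ⊆ Metric.ball x₀ r :=
    (tsupport_mul_subset_left).trans ((tsupport_mul_subset_left).trans hθ.2.2)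
  have hcs : HasCompactSupport (fun x => θ x * c (normSq (Vm m) x) * Vm m k x) :=
    (hθ.2.1.mul_right).mul_right
  have := sum_integral_fderiv_mul_fderiv_eq_zero (h.contDiff_flux m) Metric.isOpen_ball
    (h.div_free m) (contDiff_cut hθ.1 hc (h.contDiff_flux m) k) hcs hs k
  rw [← this]
  refine Finset.sum_congr rfl fun i _ => ?_
  rw [← setIntegral_mul_fderiv hs]
  simp_rw [fderiv_cut hθ.1 hc (h.contDiff_flux m)]

/-- The field p has no derivatives of its own. For smooth approximations both sides are integrated
by parts and agree by symmetry of the derivatives of p; the limit keeps all derivatives on the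
scalar θc(|V|²). -/
theorem integral_curl (h : IsApproximation x₀ r V p N Vm pm) {c c' : ℝ → ℝ}
    (hc : BddC1 c c') {θ : Euc n → ℝ} (hθ : IsTestFunction (Metric.ball x₀ r) θ) (i j : Fin n) :
    ∫ x in Metric.ball x₀ r, p j x * cutScalarGrad θ c c' V N i x =
      ∫ x in Metric.ball x₀ r, p i x * cutScalarGrad θ c c' V N j x := by
  have hlim : ∀ i j, Tendsto (fun m => ∫ x in Metric.ball x₀ r, pm m j x * cutScalarGrad θ c c'
      (Vm m) (fun j i x => fderiv ℝ (Vm m j) x (basisVec i)) i x) atTop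
      (𝓝 (∫ x in Metric.ball x₀ r, p j x * cutScalarGrad θ c c' V N i x)) := fun i j =>
    (h.tendsto_grad j).tendsto_integral_mul (h.tendsto_cutScalarGrad hc hθ i)
  refine tendsto_nhds_unique (hlim i j) ((hlim j i).congr fun m => ?_)
  have hs : tsupport (fun x => θ x * c (normSq (Vm m) x)) ⊆ Metric.ball x₀ r :=
    (tsupport_mul_subset_left).trans hθ.2.2
  have hcs : HasCompactSupport (fun x => θ x * c (normSq (Vm m) x)) := hθ.2.1.mul_right
  have hd := contDiff_cutScalar hθ.1 hc (h.contDiff_flux m)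
  have e : ∀ i j, ∫ x in Metric.ball x₀ r, pm m j x * cutScalarGrad θ c c' (Vm m)
      (fun j i x => fderiv ℝ (Vm m j) x (basisVec i)) i x =
      -∫ x, fderiv ℝ (pm m j) x (basisVec i) * (θ x * c (normSq (Vm m) x)) := fun i j => by
    rw [← integral_mul_fderiv_of_hasCompactSupport
      ((h.contDiff_grad m j).of_le (by exact_mod_cast le_top)) hd hcs,
      ← setIntegral_mul_fderiv hs]
    simp_rw [fderiv_cutScalar hθ.1 hc (h.contDiff_flux m)]
  rw [e, e]
  congr 1
  refine integral_congr_ae (ae_of_all _ fun x => ?_)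
  by_cases hx : x ∈ Metric.ball x₀ r
  · simp only [h.curl_free m x hx i j]
  · simp [hθ.eq_zero hx]

/-- For the smooth approximations this is the integral of a derivative of a compactly supported
function, and it passes to the limit. -/
theorem integral_cutGrad (h : IsApproximation x₀ r V p N Vm pm) {c c' : ℝ → ℝ}
    (hc : BddC1 c c') {θ : Euc n → ℝ} (hθ : IsTestFunction (Metric.ball x₀ r) θ) (k i : Fin n) :
    ∫ x in Metric.ball x₀ r, cutGrad θ c c' V N k i x = 0 := by
  have h1 : MemLp (fun _ => (1 : ℝ)) 2 (volume.restrict (Metric.ball x₀ r)) := by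
    have : IsFiniteMeasure (volume.restrict (Metric.ball x₀ r)) :=
      ⟨by simpa using measure_ball_lt_top⟩
    exact memLp_const 1
  have hlim := (TendstoL2.const h1).tendsto_integral_mul (h.tendsto_cutGrad hc hθ k i)
  simp only [one_mul] at hlim
  refine tendsto_nhds_unique hlim (tendsto_const_nhds.congr fun m => ?_)
  have hs : tsupport (fun x => θ x * c (normSq (Vm m) x) * Vm m k x) ⊆ Metric.ball x₀ r :=
    (tsupport_mul_subset_left).trans ((tsupport_mul_subset_left).trans hθ.2.2)
  have hcs : HasCompactSupport (fun x => θ x * c (normSq (Vm m) x) * Vm m k x) :=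
    (hθ.2.1.mul_right).mul_right
  have e1 := integral_fderiv_of_hasCompactSupport
    (contDiff_cut hθ.1 hc (h.contDiff_flux m) k) hcs (basisVec i)
  have e2 := setIntegral_mul_fderiv hs (fun _ => 1) (basisVec i)
  simp only [one_mul] at e2
  rw [← e1, ← e2]
  simp_rw [fderiv_cut hθ.1 hc (h.contDiff_flux m)]

theorem aestronglyMeasurable_normSq (h : IsApproximation x₀ r V p N Vm pm) :
    AEStronglyMeasurable (normSq V) (volume.restrict (Metric.ball x₀ r)) :=
  Finset.aestronglyMeasurable_fun_sum _ fun j _ => (h.tendsto_flux j).memLp_lim.1.pow 2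

/-- The pointwise curl relation, where the field `p` agrees with `b(|V|²) V`. -/
theorem curl_relation (h : IsApproximation x₀ r V p N Vm pm) {b b' σ σ' : ℝ → ℝ}
    (hb : BddC1 b b') (hσ : BddC1 σ σ') (hτ : BddC1 (fun t => σ t * b t)
      (fun t => σ' t * b t + σ t * b' t))
    (hp : ∀ᵐ x ∂(volume.restrict (Metric.ball x₀ r)), ∀ j,
      (σ (normSq V x) ≠ 0 ∨ σ' (normSq V x) ≠ 0) → p j x = b (normSq V x) * V j x) (i j : Fin n) :
    ∀ᵐ x ∂(volume.restrict (Metric.ball x₀ r)), σ (normSq V x) *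
      (b (normSq V x) * (N j i x - N i j x) + 2 * b' (normSq V x) *
        (halfGrad V N i x * V j x - halfGrad V N j x * V i x)) = 0 := by
  set μ := volume.restrict (Metric.ball x₀ r) with hμ
  have hfin : IsFiniteMeasure μ := ⟨by simpa [hμ] using measure_ball_lt_top⟩
  set F : Euc n → ℝ := fun x => σ (normSq V x) *
      (b (normSq V x) * (N j i x - N i j x) + 2 * b' (normSq V x) *
        (halfGrad V N i x * V j x - halfGrad V N j x * V i x)) with hFdef
  obtain ⟨Cb, hCb⟩ := hb.bdd
  obtain ⟨Cσ, hCσ⟩ := hσ.bdd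
  have hCσ0 : 0 ≤ Cσ := (abs_nonneg _).trans (hCσ 0 le_rfl).1
  have hg := h.aestronglyMeasurable_normSq
  have mN : ∀ i j, MemLp (N i j) 2 μ := fun i j => (h.tendsto_partial i j).memLp_lim
  have mV : ∀ j, AEStronglyMeasurable (V j) μ := fun j => (h.tendsto_flux j).memLp_lim.1
  have m1 : ∀ i j, MemLp (fun x => (σ (normSq V x) * b (normSq V x)) * N i j x) 2 μ :=
    fun i j => by
      have ha : AEStronglyMeasurable (fun x => σ (normSq V x) * b (normSq V x)) μ :=
        (hσ.continuous.comp_aestronglyMeasurable hg).mul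
          (hb.continuous.comp_aestronglyMeasurable hg)
      refine (mN i j).of_le_mul (c := Cσ * Cb) (ha.mul (mN i j).1) (ae_of_all _ fun x => ?_)
      rw [norm_mul]
      refine mul_le_mul_of_nonneg_right ?_ (norm_nonneg _)
      rw [norm_mul]
      exact mul_le_mul (hCσ _ (normSq_nonneg _ x)).1 (hCb _ (normSq_nonneg _ x)).1
        (norm_nonneg _) hCσ0
  have m2 : ∀ i j k l, MemLp (fun x => (σ (normSq V x) * (b' (normSq V x) * (V l x * V j x)))
      * N k i x) 2 μ := fun i j k l => by
    have ha : AEStronglyMeasurable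
        (fun x => σ (normSq V x) * (b' (normSq V x) * (V l x * V j x))) μ :=
      (hσ.continuous.comp_aestronglyMeasurable hg).mul
        ((hb.continuous_deriv.comp_aestronglyMeasurable hg).mul ((mV l).mul (mV j)))
    refine (mN k i).of_le_mul (c := Cσ * Cb) (ha.mul (mN k i).1) (ae_of_all _ fun x => ?_)
    rw [norm_mul]
    refine mul_le_mul_of_nonneg_right ?_ (norm_nonneg _)
    rw [norm_mul, norm_mul]
    refine mul_le_mul (hCσ _ (normSq_nonneg _ x)).1 ?_ (by positivity) hCσ0
    refine le_trans (mul_le_mul_of_nonneg_left ?_ (norm_nonneg _)) (hCb _ (normSq_nonneg _ x)).2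
    exact (abs_mul_le_normSq V x l j).trans (by linarith)
  have hFm : MemLp F 2 μ := by
    have := ((m1 j i).sub (m1 i j)).add
      (((memLp_finsetSum Finset.univ fun l _ => m2 i j l l).sub
        (memLp_finsetSum Finset.univ fun l _ => m2 j i l l)).const_mul 2)
    refine (memLp_congr_ae (ae_of_all _ fun x => ?_)).1 this
    simp only [Pi.add_apply, Pi.sub_apply, hFdef, halfGrad, Finset.sum_mul]
    rw [← Finset.sum_sub_distrib, ← Finset.sum_sub_distrib, mul_add, Finset.mul_sum,
      Finset.mul_sum, Finset.mul_sum]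
    congr 1
    · ring
    · exact Finset.sum_congr rfl fun l _ => by ring
  rw [hμ, ae_restrict_iff' Metric.isOpen_ball.measurableSet]
  -- By the fundamental lemma of the calculus of variations it is enough to integrate F against test
  -- functions φ.
  refine Metric.isOpen_ball.ae_eq_zero_of_integral_contDiff_smul_eq_zero
    (IntegrableOn.locallyIntegrableOn (hFm.integrable (by norm_num))) fun φ h1 h2 h3 => ?_
  have hφ : IsTestFunction (Metric.ball x₀ r) φ := ⟨h1, h2, h3⟩
  rw [← setIntegral_eq_integral_of_forall_compl_eq_zero (s := Metric.ball x₀ r)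
    fun x hx => by simp [hφ.eq_zero hx]]
  have e1 := h.integral_curl hσ hφ i j
  have e2 := h.integral_cutGrad hτ hφ j i
  have e3 := h.integral_cutGrad hτ hφ i j
  have c1 : ∀ i j, Integrable (fun x => p j x * cutScalarGrad φ σ σ' V N i x) μ := fun i j =>
    integrable_mul_of_memLp (h.tendsto_grad j).memLp_lim (h.tendsto_cutScalarGrad hσ hφ i).memLp_lim
  have c2 : ∀ i j, Integrable (cutGrad φ (fun t => σ t * b t)
      (fun t => σ' t * b t + σ t * b' t) V N j i) μ := fun i j =>
    (h.tendsto_cutGrad hτ hφ j i).memLp_lim.integrable (by norm_num)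
  -- Product rule: ∂_i(φσbV_j) = ∂_i(φσ)·bV_j + φσ·∂_i(bV_j). Wherever σ or σ' is nonzero, bV_j may
  -- be replaced by p_j. Antisymmetrizing in i and j, the left side integrates to zero by
  -- `integral_cutGrad`, the p terms cancel by `integral_curl`, and ∫φF remains.
  have e4 : ∫ x, φ x • F x ∂μ = (∫ x, cutGrad φ (fun t => σ t * b t)
      (fun t => σ' t * b t + σ t * b' t) V N j i x ∂μ) - (∫ x, cutGrad φ (fun t => σ t * b t)
      (fun t => σ' t * b t + σ t * b' t) V N i j x ∂μ) -
      ((∫ x, p j x * cutScalarGrad φ σ σ' V N i x ∂μ) -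
        ∫ x, p i x * cutScalarGrad φ σ σ' V N j x ∂μ) := by
    have d1 : Integrable (fun x => cutGrad φ (fun t => σ t * b t)
        (fun t => σ' t * b t + σ t * b' t) V N j i x - cutGrad φ (fun t => σ t * b t)
        (fun t => σ' t * b t + σ t * b' t) V N i j x) μ := (c2 i j).sub (c2 j i)
    have d2 : Integrable (fun x => p j x * cutScalarGrad φ σ σ' V N i x -
        p i x * cutScalarGrad φ σ σ' V N j x) μ := (c1 i j).sub (c1 j i)
    rw [← integral_sub (c2 i j) (c2 j i), ← integral_sub (c1 i j) (c1 j i), ← integral_sub d1 d2]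
    refine integral_congr_ae ?_
    filter_upwards [hp] with x hx
    have k1 : ∀ j, σ (normSq V x) * p j x = σ (normSq V x) * (b (normSq V x) * V j x) := fun j => by
      by_cases h0 : σ (normSq V x) = 0
      · simp [h0]
      · rw [hx j (Or.inl h0)]
    have k2 : ∀ j, σ' (normSq V x) * p j x = σ' (normSq V x) * (b (normSq V x) * V j x) :=
      fun j => by
        by_cases h0 : σ' (normSq V x) = 0
        · simp [h0]
        · rw [hx j (Or.inr h0)]
    simp only [smul_eq_mul, hFdef, cutGrad, cutScalarGrad]
    linear_combination (fderiv ℝ φ x (basisVec i)) * k1 j - (fderiv ℝ φ x (basisVec j)) * k1 i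
      + φ x * (2 * halfGrad V N i x) * k2 j - φ x * (2 * halfGrad V N j x) * k2 i
  rw [e4, hμ, e1, e2, e3]
  simp

end IsApproximation

end CompressibleFlow

end

/-! ### The density and its dual. -/

noncomputable section

namespace CompressibleFlow

section Density

variable {ρ : ℝ → ℝ} {Qcrit : EReal}

theorem subsonicRange_mem_of_le {s M : ℝ} (hM : M ∈ subsonicRange Qcrit) (h0 : 0 ≤ s)
    (hs : s ≤ M) : s ∈ subsonicRange Qcrit :=
  ⟨h0, (EReal.coe_le_coe_iff.2 hs).trans_lt hM.2⟩

theorem uniqueDiffOn_subsonicRange (h : 0 < Qcrit) : UniqueDiffOn ℝ (subsonicRange Qcrit) := by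
  refine uniqueDiffOn_convex ?_ ?_
  · refine Set.OrdConnected.convex ⟨fun x hx y hy z hz => ?_⟩
    exact subsonicRange_mem_of_le hy (hx.1.trans hz.1) hz.2
  · obtain ⟨q, h0, hq⟩ := EReal.lt_iff_exists_real_btwn.1 h
    have h0' : 0 < q := by exact_mod_cast h0
    refine ⟨q / 2, mem_interior_iff_mem_nhds.2 ?_⟩
    filter_upwards [Icc_mem_nhds (half_pos h0') (half_lt_self h0')] with s hs
    exact ⟨hs.1, (EReal.coe_le_coe_iff.2 hs.2).trans_lt hq⟩

theorem subsonicRange_mem_nhds {s M : ℝ} (hM : M ∈ subsonicRange Qcrit) (h0 : 0 < s)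
    (hs : s < M) : subsonicRange Qcrit ∈ 𝓝 s := by
  filter_upwards [Icc_mem_nhds h0 hs] with t ht
  exact subsonicRange_mem_of_le hM ht.1 ht.2

theorem IsSubsonicDensity.continuousOn_derivWithin (hρ : IsSubsonicDensity ρ Qcrit) {M : ℝ}
    (hM : M ∈ subsonicRange Qcrit) :
    ContinuousOn (derivWithin ρ (subsonicRange Qcrit)) (Set.Icc 0 M) := by
  obtain ⟨α, hα, -, h⟩ := hρ.holder_deriv
  obtain ⟨C, hC⟩ := h M hM
  exact hC.continuousOn hα

/-- This is the subsonic condition after the product rule and multiplication by ρ > 0. It makes the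
change of variable from Q to Qρ² invertible. -/
theorem IsSubsonicDensity.derivWithin_mul_sq (hρ : IsSubsonicDensity ρ Qcrit) (hQ : 0 < Qcrit)
    {s : ℝ} (hs : s ∈ subsonicRange Qcrit) :
    0 < ρ s ^ 2 + s * (2 * ρ s * derivWithin ρ (subsonicRange Qcrit) s) := by
  have h1 := (hρ.differentiableOn s hs).hasDerivWithinAt
  have h2 : HasDerivWithinAt (fun t => t * ρ t ^ 2)
      (1 * ρ s ^ 2 + s * (2 * ρ s * derivWithin ρ (subsonicRange Qcrit) s))
      (subsonicRange Qcrit) s := by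
    refine HasDerivWithinAt.congr_deriv
      ((hasDerivWithinAt_id s (subsonicRange Qcrit)).mul (h1.pow 2)) ?_
    simp
  have h3 := hρ.subsonic s hs
  rw [h2.derivWithin (uniqueDiffOn_subsonicRange hQ s hs), one_mul] at h3
  exact (div_pos_iff_of_pos_right (hρ.pos s hs)).1 h3

theorem IsSubsonicDensity.hasDerivAt (hρ : IsSubsonicDensity ρ Qcrit) {s M : ℝ}
    (hM : M ∈ subsonicRange Qcrit) (h0 : 0 < s) (hs : s < M) :
    HasDerivAt ρ (derivWithin ρ (subsonicRange Qcrit) s) s :=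
  (hρ.differentiableOn s (subsonicRange_mem_of_le hM h0.le hs.le)).hasDerivWithinAt.hasDerivAt
    (subsonicRange_mem_nhds hM h0 hs)

theorem IsSubsonicDensity.continuousOn (hρ : IsSubsonicDensity ρ Qcrit) :
    ContinuousOn ρ (subsonicRange Qcrit) := hρ.differentiableOn.continuousOn

theorem IsSubsonicDensity.antitoneOn (hρ : IsSubsonicDensity ρ Qcrit)
    (hρ' : ∀ s ∈ subsonicRange Qcrit, derivWithin ρ (subsonicRange Qcrit) s ≤ 0) :
    AntitoneOn ρ (subsonicRange Qcrit) := by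
  intro s hs t ht hst
  have hsub : Set.Icc 0 t ⊆ subsonicRange Qcrit := fun x hx => subsonicRange_mem_of_le ht hx.1 hx.2
  refine antitoneOn_of_deriv_nonpos (convex_Icc 0 t) (hρ.continuousOn.mono hsub) ?_ ?_
    ⟨hs.1, hst⟩ ⟨ht.1, le_rfl⟩ hst
  · rw [interior_Icc]
    exact fun x hx => (hρ.hasDerivAt ht hx.1 hx.2).differentiableAt.differentiableWithinAt
  · rw [interior_Icc]
    intro x hx
    rw [(hρ.hasDerivAt ht hx.1 hx.2).deriv]
    exact hρ' x (hsub ⟨hx.1.le, hx.2.le⟩)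

/-- Consequently Q can be recovered from |V|² = Qρ(Q)², and sublevel sets of |V|² are sublevel sets
of Q. -/
theorem IsSubsonicDensity.strictMonoOn (hρ : IsSubsonicDensity ρ Qcrit) (hQ : 0 < Qcrit) :
    StrictMonoOn (fun t => t * ρ t ^ 2) (subsonicRange Qcrit) := by
  intro s hs t ht hst
  have hsub : Set.Icc 0 t ⊆ subsonicRange Qcrit := fun x hx => subsonicRange_mem_of_le ht hx.1 hx.2
  refine strictMonoOn_of_deriv_pos (convex_Icc 0 t)
    (continuousOn_id.mul ((hρ.continuousOn.mono hsub).pow 2)) ?_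
    ⟨hs.1, hst.le⟩ ⟨ht.1, le_rfl⟩ hst
  rw [interior_Icc]
  intro x hx
  have h1 := hρ.hasDerivAt ht hx.1 hx.2
  have h2 : HasDerivAt (fun t => t * ρ t ^ 2)
      (1 * ρ x ^ 2 + x * (2 * ρ x * derivWithin ρ (subsonicRange Qcrit) x)) x := by
    refine HasDerivAt.congr_deriv ((hasDerivAt_id x).mul (h1.pow 2)) ?_
    simp
  have h3 := hρ.derivWithin_mul_sq hQ (hsub ⟨hx.1.le, hx.2.le⟩)
  rw [← one_mul (ρ x ^ 2), ← h2.deriv] at h3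
  exact h3

/-- The inverse of a primitive of a continuous function that is bounded below by a positive
constant. -/
theorem exists_inverse_primitive {γ : ℝ → ℝ} (hγ : Continuous γ) {a : ℝ} (ha : 0 < a)
    (hγa : ∀ t, a ≤ γ t) : ∃ q : ℝ → ℝ, Continuous q ∧ Monotone q ∧
      (∀ s, q (∫ t in (0 : ℝ)..s, γ t) = s) ∧ ∀ t, HasDerivAt q (γ (q t))⁻¹ t := by
  set G : ℝ → ℝ := fun s => ∫ t in (0 : ℝ)..s, γ t with hG
  have hd : ∀ s, HasDerivAt G (γ s) s := fun s =>
    intervalIntegral.integral_hasDerivAt_right (hγ.intervalIntegrable _ _)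
      hγ.stronglyMeasurable.stronglyMeasurableAtFilter hγ.continuousAt
  have hpos : ∀ s, 0 < γ s := fun s => ha.trans_le (hγa s)
  have hmono : StrictMono G := strictMono_of_deriv_pos fun s => by
    rw [(hd s).deriv]
    exact hpos s
  have hcont : Continuous G := continuous_iff_continuousAt.2 fun s => (hd s).continuousAt
  -- The primitive grows at least as fast as a·s, which gives its limits at both ends and hence
  -- surjectivity.
  have hlow : Monotone fun s => G s - a * s := by
    refine monotone_of_deriv_nonneg (fun s => ((hd s).sub
      ((hasDerivAt_id s).const_mul a)).differentiableAt) fun s => ?_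
    have h1 : HasDerivAt (fun s => G s - a * s) (γ s - a * 1) s :=
      (hd s).sub ((hasDerivAt_id s).const_mul a)
    rw [h1.deriv]
    linarith [hγa s]
  have h0 : G 0 = 0 := by simp [hG]
  have htop : Tendsto G atTop atTop := by
    refine tendsto_atTop_mono' _ ?_ (tendsto_id.const_mul_atTop ha)
    filter_upwards [eventually_ge_atTop 0] with s hs
    have := hlow hs
    simp only [h0] at this
    simp only [id]
    linarith
  have hbot : Tendsto G atBot atBot := by
    refine tendsto_atBot_mono' _ ?_ (tendsto_id.const_mul_atBot ha)
    filter_upwards [eventually_le_atBot 0] with s hs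
    have := hlow hs
    simp only [h0] at this
    simp only [id]
    linarith
  have hsurj : Function.Surjective G := hcont.surjective htop hbot
  let e := hmono.orderIsoOfSurjective G hsurj
  refine ⟨e.symm, e.symm.continuous, e.symm.monotone, fun s => e.symm_apply_apply s, fun t => ?_⟩
  exact HasDerivAt.of_local_left_inverse e.symm.continuous.continuousAt (hd _) (hpos _).ne'
    (Eventually.of_forall fun y => e.apply_symm_apply y)

/-- The dual density `b`, with `b (Q ρ(Q)²) = 1 / ρ(Q)` for `Q ≤ M`, extended to a bounded
nondecreasing `C¹` function. -/
theorem IsSubsonicDensity.exists_dual (hρ : IsSubsonicDensity ρ Qcrit) (hQ : 0 < Qcrit)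
    {κ₀ : ℝ} (hκ₀ : 0 < κ₀)
    (hρ' : ∀ s ∈ subsonicRange Qcrit, derivWithin ρ (subsonicRange Qcrit) s ≤ 0)
    (hκ : ∀ s ∈ subsonicRange Qcrit, κ₀ ≤ ρ s ∧ ρ s ≤ ρ 0) {M : ℝ}
    (hM : M ∈ subsonicRange Qcrit) :
    ∃ b b' : ℝ → ℝ, (∀ t, HasDerivAt b (b' t) t) ∧ Continuous b' ∧ (∀ t, 0 ≤ b' t) ∧
      (∃ T, ∀ t, T ≤ t → b' t = 0) ∧ (∀ t, 0 ≤ t → (ρ 0)⁻¹ ≤ b t ∧ b t ≤ 2 * κ₀⁻¹) ∧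
      ∀ Q, 0 ≤ Q → Q ≤ M → b (Q * ρ Q ^ 2) = (ρ Q)⁻¹ := by
  have hM0 : 0 ≤ M := hM.1
  have hsub : Set.Icc 0 M ⊆ subsonicRange Qcrit := fun x hx => subsonicRange_mem_of_le hM hx.1 hx.2
  -- Clamping the argument to [0, M] freezes ρ and ρ' outside this interval, so every coefficient is
  -- continuous on the whole line.
  let cl : ℝ → ℝ := fun s => max 0 (min s M)
  have hcl : ∀ s, cl s ∈ Set.Icc 0 M := fun s => ⟨le_max_left _ _, max_le hM0 (min_le_right _ _)⟩
  have hclc : Continuous cl := by fun_prop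
  have hcl_eq : ∀ s ∈ Set.Icc 0 M, cl s = s := fun s hs => by
    simp [cl, hs.1, hs.2]
  set D : ℝ → ℝ := derivWithin ρ (subsonicRange Qcrit) with hD
  have hDc : Continuous fun s => D (cl s) :=
    (hρ.continuousOn_derivWithin hM).comp_continuous hclc hcl
  have hRc : Continuous fun s => ρ (cl s) :=
    (hρ.continuousOn.mono hsub).comp_continuous hclc hcl
  have hRpos : ∀ s, 0 < ρ (cl s) := fun s => hρ.pos _ (hsub (hcl s))
  let γ : ℝ → ℝ := fun s => ρ (cl s) ^ 2 + cl s * (2 * ρ (cl s) * D (cl s))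
  have hγc : Continuous γ :=
    (hRc.pow 2).add (hclc.mul ((continuous_const.mul hRc).mul hDc))
  -- Compactness gives a positive minimum of γ. It may depend on M, but it is used only to invert
  -- the change of variable and does not enter the bounds for b.
  obtain ⟨s₁, -, hs₁'⟩ := isCompact_Icc.exists_isMinOn (Set.nonempty_Icc.2 hM0)
    (hγc.continuousOn (s := Set.Icc 0 M))
  have hγ₁ : 0 < γ s₁ := hρ.derivWithin_mul_sq hQ (hsub (hcl s₁))
  have hγa : ∀ t, γ s₁ ≤ γ t := fun t => by
    have h1 := hs₁' (hcl t)
    have h2 : γ (cl t) = γ t := by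
      simp only [γ, hcl_eq _ (hcl t)]
    exact h1.trans_eq h2
  obtain ⟨q, hqc, hqm, hqG, hqd⟩ := exists_inverse_primitive hγc hγ₁ hγa
  let W : ℝ := -D M / ρ M ^ 2
  have hW0 : 0 ≤ W := div_nonneg (neg_nonneg.2 (hρ' M hM)) (sq_nonneg _)
  -- Beyond M the derivative w of 1/ρ is tapered to zero over a length l with l·W ≤ κ₀⁻¹. The
  -- extension thus adds at most κ₀⁻¹ to the value 1/ρ(M) ≤ κ₀⁻¹, which explains the bound 2κ₀⁻¹.
  let l : ℝ := κ₀⁻¹ / (W + 1)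
  have hl : 0 < l := by positivity
  -- On [0, M] this is (1/ρ)' = -ρ'/ρ², nonnegative because ρ' ≤ 0; the last factor is the taper.
  let w : ℝ → ℝ := fun t => -D (cl t) / ρ (cl t) ^ 2 * max 0 (min 1 (1 - (t - M) / l))
  have hwc : Continuous w := by
    refine Continuous.mul (hDc.neg.div (hRc.pow 2) fun t => (pow_pos (hRpos t) 2).ne') ?_
    fun_prop
  have hw0 : ∀ t, 0 ≤ w t := fun t => mul_nonneg
    (div_nonneg (neg_nonneg.2 (hρ' _ (hsub (hcl t)))) (sq_nonneg _)) (le_max_left _ _)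
  have hw1 : ∀ t, M + l ≤ t → w t = 0 := fun t ht => by
    have h1 : 1 - (t - M) / l ≤ 0 := by
      rw [sub_nonpos, le_div_iff₀ hl]
      linarith
    simp only [w]
    rw [max_eq_left ((min_le_right _ _).trans h1), mul_zero]
  have hw2 : ∀ t, M ≤ t → w t ≤ W := fun t ht => by
    have h1 : cl t = M := by simp [cl, ht, hM0]
    simp only [w, h1]
    exact mul_le_of_le_one_right hW0 (max_le zero_le_one (min_le_left _ _))
  let B : ℝ → ℝ := fun s => (ρ 0)⁻¹ + ∫ t in (0 : ℝ)..s, w t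
  have hBd : ∀ s, HasDerivAt B (w s) s := fun s =>
    (intervalIntegral.integral_hasDerivAt_right (hwc.intervalIntegrable _ _)
      hwc.stronglyMeasurable.stronglyMeasurableAtFilter hwc.continuousAt).const_add _
  have hBm : Monotone B := monotone_of_deriv_nonneg (fun s => (hBd s).differentiableAt) fun s => by
    rw [(hBd s).deriv]
    exact hw0 s
  have hB0 : B 0 = (ρ 0)⁻¹ := by simp [B]
  have hBeq : ∀ s ∈ Set.Icc 0 M, B s = (ρ s)⁻¹ := fun s hs => by
    have hs' : Set.Icc 0 s ⊆ Set.Icc 0 M := Set.Icc_subset_Icc_right hs.2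
    have h1 : ∫ t in (0 : ℝ)..s, w t = (ρ s)⁻¹ - (ρ 0)⁻¹ := by
      refine intervalIntegral.integral_eq_sub_of_hasDerivAt_of_le (f := fun t => (ρ t)⁻¹) hs.1 ?_ ?_
        (hwc.intervalIntegrable _ _)
      · exact ((hρ.continuousOn.mono hsub).mono hs').inv₀ fun t ht =>
          (hρ.pos t (hsub (hs' ht))).ne'
      · intro t ht
        have h2 : t ∈ Set.Icc 0 M := hs' ⟨ht.1.le, ht.2.le⟩
        have h3 := (hρ.hasDerivAt hM ht.1 (ht.2.trans_le hs.2)).inv (hρ.pos t (hsub h2)).ne'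
        have h4 : 1 ≤ 1 - (t - M) / l := by
          have : (t - M) / l ≤ 0 := div_nonpos_of_nonpos_of_nonneg (by linarith [h2.2]) hl.le
          linarith
        have h5 : w t = -D t / ρ t ^ 2 := by
          simp only [w, hcl_eq t h2]
          rw [min_eq_left h4]
          simp
        rw [h5]
        exact h3
    simp only [B, h1]
    ring
  have hBM : B M ≤ κ₀⁻¹ := by
    rw [hBeq M ⟨hM0, le_rfl⟩]
    exact inv_anti₀ hκ₀ (hκ M hM).1
  have hBsub : ∀ x y, B y - B x = ∫ t in x..y, w t := fun x y => by
    have := intervalIntegral.integral_interval_sub_left (hwc.intervalIntegrable (μ := volume) 0 y)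
      (hwc.intervalIntegrable 0 x)
    simp only [B]
    linarith
  have hBup : ∀ s, B s ≤ 2 * κ₀⁻¹ := fun s => by
    have h1 : B s ≤ B (M + l) := by
      rcases le_total s (M + l) with h | h
      · exact hBm h
      · have h2 : B s - B (M + l) = ∫ t in (M + l)..s, w t := hBsub _ _
        have h3 : ∫ t in (M + l)..s, w t = 0 := by
          rw [intervalIntegral.integral_congr (g := fun _ => 0)]
          · simp
          · intro t ht
            rw [Set.uIcc_of_le h] at ht
            exact hw1 t ht.1
        linarith
    have h2 : B (M + l) - B M = ∫ t in M..(M + l), w t := hBsub _ _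
    have h3 : ∫ t in M..(M + l), w t ≤ ∫ _ in M..(M + l), W :=
      intervalIntegral.integral_mono_on (by linarith) (hwc.intervalIntegrable _ _)
        (by simp) fun t ht => hw2 t ht.1
    have h4 : l * W ≤ κ₀⁻¹ := by
      simp only [l]
      rw [div_mul_eq_mul_div, div_le_iff₀ (by positivity)]
      have : 0 < κ₀⁻¹ := by positivity
      nlinarith
    simp only [intervalIntegral.integral_const, add_sub_cancel_left, smul_eq_mul] at h3
    linarith
  have hq0 : q 0 = 0 := by simpa using hqG 0
  refine ⟨fun t => B (q t), fun t => w (q t) * (γ (q t))⁻¹, fun t => ?_, ?_, fun t => ?_, ?_,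
    fun t ht => ⟨?_, hBup _⟩, fun Q h0 h1 => ?_⟩
  · exact (hBd (q t)).comp t (hqd t)
  · exact (hwc.comp hqc).mul ((hγc.comp hqc).inv₀ fun t => (hγ₁.trans_le (hγa _)).ne')
  · exact mul_nonneg (hw0 _) (inv_nonneg.2 (hγ₁.trans_le (hγa _)).le)
  · refine ⟨∫ t in (0 : ℝ)..(M + l), γ t, fun t ht => ?_⟩
    have := hqm ht
    rw [hqG] at this
    simp only [hw1 _ this, zero_mul]
  · have := hBm (hqm ht)
    rwa [hq0, hB0] at this
  -- On [0, M] the function γ is the derivative of tρ(t)², so q inverts Q ↦ Qρ(Q)² there.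
  · have h2 : ∫ t in (0 : ℝ)..Q, γ t = Q * ρ Q ^ 2 := by
      have hs' : Set.Icc 0 Q ⊆ Set.Icc 0 M := Set.Icc_subset_Icc_right h1
      rw [intervalIntegral.integral_eq_sub_of_hasDerivAt_of_le (f := fun t => t * ρ t ^ 2) h0 ?_ ?_
        (hγc.intervalIntegrable _ _)]
      · simp
      · exact continuousOn_id.mul (((hρ.continuousOn.mono hsub).mono hs').pow 2)
      · intro t ht
        have h2 : t ∈ Set.Icc 0 M := hs' ⟨ht.1.le, ht.2.le⟩
        have h3 := hρ.hasDerivAt hM ht.1 (ht.2.trans_le h1)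
        have h4 : HasDerivAt (fun t => t * ρ t ^ 2) (1 * ρ t ^ 2 + t * (2 * ρ t * D t)) t := by
          refine HasDerivAt.congr_deriv ((hasDerivAt_id t).mul (h3.pow 2)) ?_
          simp [hD]
        simpa only [γ, hcl_eq t h2, one_mul] using h4
    rw [← h2]
    simp only [hqG]
    exact hBeq Q ⟨h0, h1⟩

end Density

end CompressibleFlow

end

/-! ### Pointwise algebra of the curl relation, and smooth steps. -/

noncomputable section

namespace CompressibleFlow

section Algebra

variable {n : ℕ} {N : Fin n → Fin n → ℝ} {v : Fin n → ℝ} {b b' : ℝ}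

/-- Multiply the curl relation by N_ik and sum. The trace of N², which has no sign, becomes the
Frobenius norm; the correction terms are x·Nv and |x|² with x = Nᵀv. -/
theorem trace_sq_identity
    (h : ∀ i j, b * (N j i - N i j) + 2 * b' *
      ((∑ l, v l * N l i) * v j - (∑ l, v l * N l j) * v i) = 0) :
    b * ∑ k, ∑ i, N i k * N k i + 2 * b' * ∑ i, (∑ l, v l * N l i) * ∑ k, N i k * v k =
      b * ∑ k, ∑ i, N i k ^ 2 + 2 * b' * ∑ i, (∑ l, v l * N l i) ^ 2 := by
  set x : Fin n → ℝ := fun i => ∑ l, v l * N l i with hx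
  have e1 : ∀ k i, b * (N i k * N k i) = b * N i k ^ 2 - 2 * b' * (x i * (N i k * v k))
      + 2 * b' * (x k * (v i * N i k)) := fun k i => by
    have h1 : b * (N k i - N i k) + 2 * b' * (x i * v k - x k * v i) = 0 := h i k
    linear_combination N i k * h1
  have e2 : ∑ k, ∑ i, x i * (N i k * v k) = ∑ i, x i * ∑ k, N i k * v k := by
    rw [Finset.sum_comm]
    simp_rw [Finset.mul_sum]
  have e3 : ∑ k, ∑ i, x k * (v i * N i k) = ∑ i, x i ^ 2 := by
    simp_rw [← Finset.mul_sum, sq]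
    rfl
  have e4 : b * ∑ k, ∑ i, N i k * N k i = ∑ k, ∑ i, b * (N i k * N k i) := by
    simp_rw [Finset.mul_sum]
  rw [e4]
  simp_rw [e1, Finset.sum_add_distrib, Finset.sum_sub_distrib, ← Finset.mul_sum]
  simp_rw [← Finset.mul_sum] at e2 e3
  rw [e2, e3]
  ring

/-- Contracting the curl relation with v gives bNv = bx + 2b'(|v|²x - (x·v)v). Pairing with x leaves
b|x|² + 2b'(|x|²|v|² - (x·v)²), nonnegative by Cauchy–Schwarz. -/
theorem sum_mul_sum_nonneg_of_curl (hb : 0 < b) (hb' : 0 ≤ b')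
    (h : ∀ i j, b * (N j i - N i j) + 2 * b' *
      ((∑ l, v l * N l i) * v j - (∑ l, v l * N l j) * v i) = 0) :
    0 ≤ ∑ i, (∑ l, v l * N l i) * ∑ k, N i k * v k := by
  set x : Fin n → ℝ := fun i => ∑ l, v l * N l i with hx
  have e1 : ∀ i, b * ∑ k, N i k * v k
      = b * x i + 2 * b' * (x i * ∑ k, v k ^ 2 - v i * ∑ k, x k * v k) := fun i => by
    have h2 : ∀ k, b * (N i k * v k) = b * (v k * N k i) + 2 * b' * (x i * v k ^ 2)
        - 2 * b' * (v i * (x k * v k)) := fun k => by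
      have h1 : b * (N k i - N i k) + 2 * b' * (x i * v k - x k * v i) = 0 := h i k
      linear_combination -v k * h1
    rw [Finset.mul_sum]
    simp_rw [h2, Finset.sum_sub_distrib, Finset.sum_add_distrib, ← Finset.mul_sum]
    ring
  have e2 : b * ∑ i, x i * ∑ k, N i k * v k =
      b * ∑ i, x i ^ 2 + 2 * b' * ((∑ i, x i ^ 2) * ∑ k, v k ^ 2 - (∑ k, x k * v k) ^ 2) := by
    rw [Finset.mul_sum]
    have h2 : ∀ i, b * (x i * ∑ k, N i k * v k) = b * x i ^ 2 +
        2 * b' * (x i ^ 2 * ∑ k, v k ^ 2) - 2 * b' * ((x i * v i) * ∑ k, x k * v k) := fun i => by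
      linear_combination x i * e1 i
    simp_rw [h2, Finset.sum_sub_distrib, Finset.sum_add_distrib, ← Finset.mul_sum,
      ← Finset.sum_mul]
    ring
  have h3 : (∑ k, x k * v k) ^ 2 ≤ (∑ i, x i ^ 2) * ∑ k, v k ^ 2 :=
    Finset.sum_mul_sq_le_sq_mul_sq _ _ _
  have h4 : 0 ≤ b * ∑ i, x i * ∑ k, N i k * v k := by
    rw [e2]
    have : 0 ≤ ∑ i, x i ^ 2 := Finset.sum_nonneg fun _ _ => sq_nonneg _
    have h5 := mul_nonneg hb' (sub_nonneg.2 h3)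
    nlinarith [mul_nonneg hb.le this]
  exact nonneg_of_mul_nonneg_right h4 hb

theorem sq_sum_mul_sum_le (d : Fin n → ℝ) :
    (∑ i, d i * ∑ k, N i k * v k) ^ 2 ≤
      (∑ k, ∑ i, N i k ^ 2) * ((∑ i, d i ^ 2) * ∑ k, v k ^ 2) := by
  have h1 : (∑ i, d i * ∑ k, N i k * v k) ^ 2 ≤
      (∑ i, d i ^ 2) * ∑ i, (∑ k, N i k * v k) ^ 2 := Finset.sum_mul_sq_le_sq_mul_sq _ _ _
  have h2 : ∑ i, (∑ k, N i k * v k) ^ 2 ≤ (∑ k, ∑ i, N i k ^ 2) * ∑ k, v k ^ 2 := by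
    rw [Finset.sum_comm, Finset.sum_mul]
    exact Finset.sum_le_sum fun i _ => Finset.sum_mul_sq_le_sq_mul_sq _ _ _
  calc _ ≤ _ := h1
    _ ≤ (∑ i, d i ^ 2) * ((∑ k, ∑ i, N i k ^ 2) * ∑ k, v k ^ 2) := by
        gcongr
    _ = _ := by ring

theorem abs_two_mul_le_of_sq_le {e s A B : ℝ} (hA : 0 ≤ A) (hB : 0 ≤ B) (hs : s ^ 2 ≤ A * B) :
    |2 * e * s| ≤ e ^ 2 * A / 2 + 2 * B := by
  refine abs_le_of_sq_le_sq ?_ (by positivity)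
  have h1 : (2 * e * s) ^ 2 ≤ 4 * e ^ 2 * (A * B) := by
    have := mul_le_mul_of_nonneg_left hs (by positivity : 0 ≤ 4 * e ^ 2)
    linarith [this, (by ring : (2 * e * s) ^ 2 = 4 * e ^ 2 * s ^ 2)]
  nlinarith [sq_nonneg (e ^ 2 * A / 2 - 2 * B)]

theorem trace_sq_ge : -∑ k, ∑ i, N i k ^ 2 ≤ ∑ k, ∑ i, N i k * N k i := by
  have h1 : ∑ k, ∑ i, N k i ^ 2 = ∑ k, ∑ i, N i k ^ 2 := Finset.sum_comm
  have h2 : 0 ≤ ∑ k, ∑ i, (N i k + N k i) ^ 2 :=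
    Finset.sum_nonneg fun _ _ => Finset.sum_nonneg fun _ _ => sq_nonneg _
  have h3 : ∑ k, ∑ i, (N i k + N k i) ^ 2 = ∑ k, ∑ i, N i k ^ 2
      + 2 * ∑ k, ∑ i, N i k * N k i + ∑ k, ∑ i, N k i ^ 2 := by
    simp_rw [Finset.mul_sum, ← Finset.sum_add_distrib]
    exact Finset.sum_congr rfl fun k _ => Finset.sum_congr rfl fun i _ => by ring
  linarith

/-- Coercivity of the integrand of the differentiated equation. -/
theorem energy_integrand_ge (hb : 0 < b) (hb' : 0 ≤ b') {f f' e : ℝ} (hf : 0 ≤ f) (hf' : 0 ≤ f')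
    (h : ∀ i j, b * (N j i - N i j) + 2 * b' *
      ((∑ l, v l * N l i) * v j - (∑ l, v l * N l j) * v i) = 0) (d : Fin n → ℝ) :
    f * b * (e ^ 2 * (∑ k, ∑ i, N i k ^ 2) / 2 - 2 * ((∑ i, d i ^ 2) * ∑ k, v k ^ 2)) ≤
      e ^ 2 * (f * b * ∑ k, ∑ i, N i k * N k i) + e ^ 2 * (2 * (f' * b + f * b') *
        ∑ i, (∑ l, v l * N l i) * ∑ k, N i k * v k)
        + 2 * e * (f * b) * ∑ i, d i * ∑ k, N i k * v k := by
  have h1 := trace_sq_identity h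
  have h2 := sum_mul_sum_nonneg_of_curl hb hb' h
  have h3 := abs_two_mul_le_of_sq_le (e := e)
    (Finset.sum_nonneg fun k _ => Finset.sum_nonneg fun i _ => sq_nonneg (N i k))
    (mul_nonneg (Finset.sum_nonneg fun i _ => sq_nonneg (d i))
      (Finset.sum_nonneg fun k _ => sq_nonneg (v k))) (sq_sum_mul_sum_le d)
  have h4 : 0 ≤ ∑ i, (∑ l, v l * N l i) ^ 2 := Finset.sum_nonneg fun _ _ => sq_nonneg _
  set T := ∑ k, ∑ i, N i k * N k i
  set P := ∑ i, (∑ l, v l * N l i) * ∑ k, N i k * v k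
  set A := ∑ k, ∑ i, N i k ^ 2
  set B := (∑ i, d i ^ 2) * ∑ k, v k ^ 2
  set s := ∑ i, d i * ∑ k, N i k * v k
  set X := ∑ i, (∑ l, v l * N l i) ^ 2
  -- After the trace identity, the terms with b' and f' are the nonnegative ones with X and P. They
  -- are dropped, and only the cross term s needs Young's inequality.
  have h5 : e ^ 2 * (f * b * T) + e ^ 2 * (2 * (f' * b + f * b') * P) + 2 * e * (f * b) * s
      = e ^ 2 * f * (b * A + 2 * b' * X) + 2 * (e ^ 2 * f' * b) * P + f * b * (2 * e * s) := by
    rw [← h1]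
    ring
  rw [h5]
  have h6 : f * b * (-(e ^ 2 * A / 2 + 2 * B)) ≤ f * b * (2 * e * s) :=
    mul_le_mul_of_nonneg_left (neg_le_of_abs_le h3) (by positivity)
  have h7 : 0 ≤ 2 * (e ^ 2 * f' * b) * P := by positivity
  have h8 : 0 ≤ e ^ 2 * f * (2 * b' * X) := by positivity
  nlinarith

/-- A crude lower bound for the integrand of the differentiated equation. -/
theorem energy_integrand_ge_crude {c c' e : ℝ} (hc : 0 ≤ c) (hc' : 0 ≤ c')
    (hP : 0 ≤ ∑ i, (∑ l, v l * N l i) * ∑ k, N i k * v k) (d : Fin n → ℝ) :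
    -(c * (e ^ 2 * (∑ k, ∑ i, N i k ^ 2) * 2 + 2 * ((∑ i, d i ^ 2) * ∑ k, v k ^ 2))) ≤
      e ^ 2 * (c * ∑ k, ∑ i, N i k * N k i) + e ^ 2 * (2 * c' *
        ∑ i, (∑ l, v l * N l i) * ∑ k, N i k * v k)
        + 2 * e * c * ∑ i, d i * ∑ k, N i k * v k := by
  have h1 := trace_sq_ge (N := N)
  have hA : 0 ≤ ∑ k, ∑ i, N i k ^ 2 :=
    Finset.sum_nonneg fun k _ => Finset.sum_nonneg fun i _ => sq_nonneg (N i k)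
  have h3 := abs_two_mul_le_of_sq_le (e := e) hA
    (mul_nonneg (Finset.sum_nonneg fun i _ => sq_nonneg (d i))
      (Finset.sum_nonneg fun k _ => sq_nonneg (v k))) (sq_sum_mul_sum_le d)
  set T := ∑ k, ∑ i, N i k * N k i
  set P := ∑ i, (∑ l, v l * N l i) * ∑ k, N i k * v k
  set A := ∑ k, ∑ i, N i k ^ 2
  set B := (∑ i, d i ^ 2) * ∑ k, v k ^ 2
  set s := ∑ i, d i * ∑ k, N i k * v k
  -- The curl relation for c is not available here: the trace is bounded below by -A, and the term
  -- with c' is kept out of the bound by the sign of P alone.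
  have h4 : c * (-(e ^ 2 * A / 2 + 2 * B)) ≤ c * (2 * e * s) :=
    mul_le_mul_of_nonneg_left (neg_le_of_abs_le h3) hc
  have h5 : e ^ 2 * c * (-A) ≤ e ^ 2 * c * T := mul_le_mul_of_nonneg_left h1 (by positivity)
  have h6 : 0 ≤ e ^ 2 * (2 * c' * P) := by positivity
  have h7 : 0 ≤ c * (e ^ 2 * A) := by positivity
  nlinarith

end Algebra

section SmoothTransition

theorem deriv_smoothTransition_of_nonpos {t : ℝ} (ht : t ≤ 0) :
    deriv Real.smoothTransition t = 0 := by
  refine IsLocalMin.deriv_eq_zero (Eventually.of_forall fun s => ?_)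
  rw [Real.smoothTransition.zero_of_nonpos ht]
  exact Real.smoothTransition.nonneg s

theorem deriv_smoothTransition_of_one_le {t : ℝ} (ht : 1 ≤ t) :
    deriv Real.smoothTransition t = 0 := by
  refine IsLocalMax.deriv_eq_zero (Eventually.of_forall fun s => ?_)
  rw [Real.smoothTransition.one_of_one_le ht]
  exact Real.smoothTransition.le_one s

theorem continuous_deriv_smoothTransition : Continuous (deriv Real.smoothTransition) :=
  (Real.smoothTransition.contDiff (n := 1)).continuous_deriv le_rfl

theorem hasDerivAt_smoothTransition (t : ℝ) :
    HasDerivAt Real.smoothTransition (deriv Real.smoothTransition t) t :=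
  ((Real.smoothTransition.contDiff (n := 1)).differentiable (by norm_num) t).hasDerivAt

theorem abs_smoothTransition_le_one (t : ℝ) : |Real.smoothTransition t| ≤ 1 :=
  abs_le.2 ⟨by linarith [Real.smoothTransition.nonneg t], Real.smoothTransition.le_one t⟩

theorem deriv_smoothTransition_nonneg (t : ℝ) : 0 ≤ deriv Real.smoothTransition t :=
  Real.smoothTransition.monotone.deriv_nonneg

theorem exists_bound_deriv_smoothTransition :
    ∃ L : ℝ, 0 < L ∧ ∀ t, deriv Real.smoothTransition t ≤ L := by
  obtain ⟨L, hL⟩ := isCompact_Icc.exists_bound_of_continuousOn (s := Set.Icc (0 : ℝ) 1)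
    continuous_deriv_smoothTransition.continuousOn
  refine ⟨max L 1, by positivity, fun t => ?_⟩
  by_cases ht : t ∈ Set.Icc (0 : ℝ) 1
  · exact (le_abs_self _).trans ((hL t ht).trans (le_max_left _ _))
  · rw [Set.mem_Icc, not_and_or, not_le, not_le] at ht
    have : deriv Real.smoothTransition t = 0 := ht.elim
      (fun h => deriv_smoothTransition_of_nonpos h.le) fun h =>
        deriv_smoothTransition_of_one_le h.le
    rw [this]
    positivity

/-- This supplies the weight σ for `IsApproximation.curl_relation`: positive below m and zero, with
its derivative, from m on. -/
theorem bddC1_smoothTransition_sub (m : ℝ) :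
    BddC1 (fun t => Real.smoothTransition (m - t))
      (fun t => -deriv Real.smoothTransition (m - t)) := by
  refine BddC1.of_deriv_eq_zero (T := m) (C := 1) (fun t => ?_) ?_ (fun t ht => ?_)
    fun t _ => abs_smoothTransition_le_one _
  · have := (hasDerivAt_smoothTransition (m - t)).comp t ((hasDerivAt_id t).const_sub m)
    simpa [Function.comp_def] using this
  · exact (continuous_deriv_smoothTransition.comp (by fun_prop)).neg
  · rw [deriv_smoothTransition_of_nonpos (by linarith), neg_zero]

/-- The smooth increasing step from `0` at `k` to `1` at `k'`. -/
def smoothStep (k k' t : ℝ) : ℝ := Real.smoothTransition ((t - k) / (k' - k))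

/-- The derivative of `smoothStep`. -/
def smoothStepDeriv (k k' t : ℝ) : ℝ :=
  deriv Real.smoothTransition ((t - k) / (k' - k)) * (k' - k)⁻¹

theorem bddC1_smoothStep {k k' : ℝ} (h : k < k') :
    BddC1 (smoothStep k k') (smoothStepDeriv k k') := by
  have hp : 0 < k' - k := sub_pos.2 h
  refine BddC1.of_deriv_eq_zero (T := k') (C := 1) (fun t => ?_) ?_ (fun t ht => ?_)
    fun t _ => abs_smoothTransition_le_one _
  · have h1 : HasDerivAt (fun t => (t - k) / (k' - k)) (k' - k)⁻¹ t := by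
      simpa using ((hasDerivAt_id t).sub_const k).div_const (k' - k)
    exact (hasDerivAt_smoothTransition ((t - k) / (k' - k))).comp t h1
  · exact (continuous_deriv_smoothTransition.comp (by fun_prop)).mul continuous_const
  · rw [smoothStepDeriv, deriv_smoothTransition_of_one_le, zero_mul]
    rw [le_div_iff₀ hp]
    linarith

theorem smoothStep_nonneg (k k' t : ℝ) : 0 ≤ smoothStep k k' t := Real.smoothTransition.nonneg _

theorem smoothStep_le_one (k k' t : ℝ) : smoothStep k k' t ≤ 1 := Real.smoothTransition.le_one _

theorem smoothStep_eq_zero {k k' t : ℝ} (h : k < k') (ht : t ≤ k) : smoothStep k k' t = 0 :=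
  Real.smoothTransition.zero_of_nonpos (div_nonpos_of_nonpos_of_nonneg (by linarith) (by linarith))

theorem smoothStep_eq_one {k k' t : ℝ} (h : k < k') (ht : k' ≤ t) : smoothStep k k' t = 1 := by
  refine Real.smoothTransition.one_of_one_le ?_
  rw [le_div_iff₀ (by linarith)]
  linarith

theorem smoothStepDeriv_nonneg {k k' : ℝ} (h : k < k') (t : ℝ) : 0 ≤ smoothStepDeriv k k' t :=
  mul_nonneg (deriv_smoothTransition_nonneg _) (inv_nonneg.2 (by linarith))

theorem smoothStepDeriv_eq_zero_of_le {k k' t : ℝ} (h : k < k') (ht : t ≤ k) :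
    smoothStepDeriv k k' t = 0 := by
  rw [smoothStepDeriv, deriv_smoothTransition_of_nonpos, zero_mul]
  exact div_nonpos_of_nonpos_of_nonneg (by linarith) (by linarith)

theorem smoothStepDeriv_eq_zero_of_ge {k k' t : ℝ} (h : k < k') (ht : k' ≤ t) :
    smoothStepDeriv k k' t = 0 := by
  rw [smoothStepDeriv, deriv_smoothTransition_of_one_le, zero_mul]
  rw [le_div_iff₀ (by linarith)]
  linarith

theorem BddC1.mul {c c' d d' : ℝ → ℝ} (hc : BddC1 c c') (hd : BddC1 d d') :
    BddC1 (fun t => c t * d t) (fun t => c' t * d t + c t * d' t) := by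
  obtain ⟨C, hC⟩ := hc.bdd
  obtain ⟨D, hD⟩ := hd.bdd
  have hC0 : 0 ≤ C := (abs_nonneg _).trans (hC 0 le_rfl).1
  have hD0 : 0 ≤ D := (abs_nonneg _).trans (hD 0 le_rfl).1
  refine ⟨fun t => (hc.hasDerivAt t).mul (hd.hasDerivAt t), ?_, 2 * (C * D), fun t ht => ⟨?_, ?_⟩⟩
  · exact (hc.continuous_deriv.mul hd.continuous).add (hc.continuous.mul hd.continuous_deriv)
  · rw [abs_mul]
    have := mul_le_mul (hC t ht).1 (hD t ht).1 (abs_nonneg _) hC0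
    nlinarith [mul_nonneg hC0 hD0]
  · have h1 : |c' t| * (1 + t) * |d t| ≤ C * D :=
      mul_le_mul (hC t ht).2 (hD t ht).1 (abs_nonneg _) hC0
    have h2 : |c t| * (|d' t| * (1 + t)) ≤ C * D :=
      mul_le_mul (hC t ht).1 (hD t ht).2 (by positivity) hC0
    have h3 := abs_add_le (c' t * d t) (c t * d' t)
    rw [abs_mul, abs_mul] at h3
    have := mul_le_mul_of_nonneg_right h3 (by linarith : 0 ≤ 1 + t)
    linarith

end SmoothTransition

end CompressibleFlow

end

/-! ### The Caccioppoli inequality, uniform in the ellipticity. -/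

noncomputable section

namespace CompressibleFlow

variable {n : ℕ}

/-- The squared length of the gradient of `η`. -/
def gradSq (η : Euc n → ℝ) (x : Euc n) : ℝ := ∑ i, fderiv ℝ η x (basisVec i) ^ 2

/-- The squared Frobenius norm of the matrix field `N`. -/
def partSq (N : Fin n → Fin n → Euc n → ℝ) (x : Euc n) : ℝ := ∑ k, ∑ i, N i k x ^ 2

theorem gradSq_nonneg (η : Euc n → ℝ) (x : Euc n) : 0 ≤ gradSq η x :=
  Finset.sum_nonneg fun _ _ => sq_nonneg _

theorem partSq_nonneg (N : Fin n → Fin n → Euc n → ℝ) (x : Euc n) : 0 ≤ partSq N x :=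
  Finset.sum_nonneg fun _ _ => Finset.sum_nonneg fun _ _ => sq_nonneg _

/-- A sequence of extended dual densities, exhausting the range of `normSq V`. -/
structure IsDualFamily (U : Set (Euc n)) (V p : Fin n → Euc n → ℝ) (lam Lam : ℝ)
    (b b' : ℕ → ℝ → ℝ) (m : ℕ → ℝ) : Prop where
  bddC1 : ∀ l, BddC1 (b l) (b' l)
  deriv_nonneg : ∀ l t, 0 ≤ b' l t
  bounds : ∀ l t, 0 ≤ t → lam ≤ b l t ∧ b l t ≤ Lam
  grad_eq : ∀ l, ∀ᵐ x ∂(volume.restrict U), normSq V x ≤ m l →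
    ∀ j, p j x = b l (normSq V x) * V j x
  eventually_lt : ∀ᵐ x ∂(volume.restrict U), ∀ᶠ l in atTop, normSq V x < m l

theorem integrable_bdd_mul {α : Type*} [MeasurableSpace α] {μ : Measure α} {a F : α → ℝ} {C : ℝ}
    (hF : Integrable F μ) (ha : AEStronglyMeasurable a μ) (hC : ∀ x, |a x| ≤ C) :
    Integrable (fun x => a x * F x) μ :=
  hF.bdd_mul ha (ae_of_all _ hC)

theorem IsTestFunction.sq {U : Set (Euc n)} {η : Euc n → ℝ} (h : IsTestFunction U η) :
    IsTestFunction U fun x => η x ^ 2 := by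
  simp_rw [pow_two]
  exact ⟨h.1.mul h.1, h.2.1.mul_right, (tsupport_mul_subset_left).trans h.2.2⟩

theorem IsTestFunction.continuous_fderiv {U : Set (Euc n)} {η : Euc n → ℝ}
    (h : IsTestFunction U η) (v : Euc n) : Continuous fun x => fderiv ℝ η x v :=
  (h.1.continuous_fderiv (by norm_num)).clm_apply continuous_const

theorem IsTestFunction.continuous_gradSq {U : Set (Euc n)} {η : Euc n → ℝ}
    (h : IsTestFunction U η) : Continuous (gradSq η) :=
  continuous_finsetSum _ fun _ _ => (h.continuous_fderiv _).pow 2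

theorem IsTestFunction.exists_bound_gradSq {U : Set (Euc n)} {η : Euc n → ℝ}
    (h : IsTestFunction U η) : ∃ D, ∀ x, gradSq η x ≤ D := by
  obtain ⟨L, hL0, hL⟩ := h.exists_bound_fderiv
  refine ⟨∑ _i : Fin n, L ^ 2, fun x => Finset.sum_le_sum fun i _ => ?_⟩
  rw [← sq_abs]
  gcongr
  simpa using hL x (basisVec i)

namespace IsApproximation

variable {x₀ : Euc n} {r : ℝ} {V p : Fin n → Euc n → ℝ} {N : Fin n → Fin n → Euc n → ℝ}
  {Vm pm : ℕ → Fin n → Euc n → ℝ}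

theorem integrable_normSq (h : IsApproximation x₀ r V p N Vm pm) :
    Integrable (normSq V) (volume.restrict (Metric.ball x₀ r)) :=
  integrable_finsetSum _ fun j _ => (h.tendsto_flux j).memLp_lim.integrable_sq

theorem integrable_partSq (h : IsApproximation x₀ r V p N Vm pm) :
    Integrable (partSq N) (volume.restrict (Metric.ball x₀ r)) :=
  integrable_finsetSum _ fun k _ => integrable_finsetSum _ fun i _ =>
    (h.tendsto_partial i k).memLp_lim.integrable_sq

/-- The weight σ(t) = `Real.smoothTransition (m l - t)` confines the relation to levels where p =
b_l(|V|²)V holds, and it is positive, hence can be divided out, where |V|² < m l. -/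
theorem curl_relation_of_lt (h : IsApproximation x₀ r V p N Vm pm) {lam Lam : ℝ}
    {b b' : ℕ → ℝ → ℝ} {m : ℕ → ℝ} (hD : IsDualFamily (Metric.ball x₀ r) V p lam Lam b b' m) :
    ∀ᵐ x ∂(volume.restrict (Metric.ball x₀ r)), ∀ l, normSq V x < m l → ∀ i j,
      b l (normSq V x) * (N j i x - N i j x) + 2 * b' l (normSq V x) *
        ((∑ k, V k x * N k i x) * V j x - (∑ k, V k x * N k j x) * V i x) = 0 := by
  rw [ae_all_iff]
  intro l
  have h1 : ∀ i j, _ := fun i j => h.curl_relation (hD.bddC1 l) (bddC1_smoothTransition_sub (m l))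
    ((bddC1_smoothTransition_sub (m l)).mul (hD.bddC1 l)) (by
      filter_upwards [hD.grad_eq l] with x hx j hor
      refine hx (not_lt.1 fun hlt => ?_) j
      rcases hor with h1 | h1
      · exact h1 (Real.smoothTransition.zero_of_nonpos (by linarith))
      · exact h1 (by rw [deriv_smoothTransition_of_nonpos (by linarith), neg_zero])) i j
  filter_upwards [ae_all_iff.2 fun i => ae_all_iff.2 fun j => h1 i j] with x hx hlt i j
  have h2 := Real.smoothTransition.pos_of_pos (sub_pos.2 hlt)
  exact (mul_eq_zero.1 (hx i j)).resolve_left h2.ne'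

/-- The Caccioppoli inequality for the flux, with a weight `f(|V|²)`. -/
theorem caccioppoli (h : IsApproximation x₀ r V p N Vm pm) {lam Lam : ℝ}
    {b b' : ℕ → ℝ → ℝ} {m : ℕ → ℝ} (hD : IsDualFamily (Metric.ball x₀ r) V p lam Lam b b' m)
    (hlam : 0 < lam) {f f' : ℝ → ℝ} (hf : BddC1 f f') (hf0 : ∀ t, 0 ≤ f t)
    (hf0' : ∀ t, 0 ≤ f' t) {η : Euc n → ℝ} (hη : IsTestFunction (Metric.ball x₀ r) η) :
    ∫ x in Metric.ball x₀ r, η x ^ 2 * f (normSq V x) * partSq N x ≤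
      4 * Lam / lam * ∫ x in Metric.ball x₀ r, f (normSq V x) * gradSq η x * normSq V x := by
  set μ := volume.restrict (Metric.ball x₀ r) with hμ
  have hLam : 0 ≤ Lam := hlam.le.trans ((hD.bounds 0 0 le_rfl).1.trans (hD.bounds 0 0 le_rfl).2)
  obtain ⟨Cf, hCf⟩ := hf.bdd
  have hCf0 : 0 ≤ Cf := (abs_nonneg _).trans (hCf 0 le_rfl).1
  have hfC : ∀ x, f (normSq V x) ≤ Cf := fun x =>
    (le_abs_self _).trans (hCf _ (normSq_nonneg V x)).1
  obtain ⟨E, hE0, hE⟩ := hη.exists_bound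
  have hE2 : ∀ x, η x ^ 2 ≤ E ^ 2 := fun x => by
    rw [← sq_abs]
    exact pow_le_pow_left₀ (abs_nonneg _) (hE x) 2
  obtain ⟨D, hDb⟩ := hη.exists_bound_gradSq
  have hD0 : 0 ≤ D := (gradSq_nonneg η 0).trans (hDb 0)
  have hgm : AEStronglyMeasurable (normSq V) μ := h.aestronglyMeasurable_normSq
  have hfm : AEStronglyMeasurable (fun x => f (normSq V x)) μ :=
    hf.continuous.comp_aestronglyMeasurable hgm
  have hηm : AEStronglyMeasurable η μ := hη.1.continuous.aestronglyMeasurable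
  have hGm : AEStronglyMeasurable (gradSq η) μ := hη.continuous_gradSq.aestronglyMeasurable
  have iA : Integrable (fun x => η x ^ 2 * f (normSq V x) * partSq N x) μ :=
    integrable_bdd_mul (C := E ^ 2 * Cf) h.integrable_partSq ((hηm.pow 2).mul hfm) fun x => by
      rw [abs_of_nonneg (mul_nonneg (sq_nonneg _) (hf0 _))]
      exact mul_le_mul (hE2 x) (hfC x) (hf0 _) (by positivity)
  have iB : Integrable (fun x => f (normSq V x) * gradSq η x * normSq V x) μ :=
    integrable_bdd_mul (C := Cf * D) h.integrable_normSq (hfm.mul hGm) fun x => by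
      rw [abs_of_nonneg (mul_nonneg (hf0 _) (gradSq_nonneg _ _))]
      exact mul_le_mul (hfC x) (hDb x) (gradSq_nonneg _ _) hCf0
  -- H is the coercive lower bound for the tested integrand below the level m l. J, next, is the
  -- crude bound above it. Both are free of l and of b'.
  set H : Euc n → ℝ := fun x => lam / 2 * (η x ^ 2 * f (normSq V x) * partSq N x)
    - 2 * Lam * (f (normSq V x) * gradSq η x * normSq V x) with hH
  have iH : Integrable H μ := (iA.const_mul _).sub (iB.const_mul _)
  set J : Euc n → ℝ := fun x => 2 * (Cf * Lam) * E ^ 2 * partSq N x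
    + 2 * (Cf * Lam) * D * normSq V x with hJ
  have iJ : Integrable J μ := (h.integrable_partSq.const_mul _).add (h.integrable_normSq.const_mul _)
  have hJ0 : ∀ x, 0 ≤ J x := fun x => by
    have h1 := partSq_nonneg N x
    have h2 := normSq_nonneg V x
    positivity
  let χ : ℕ → Euc n → ℝ := fun l x => (Set.Iio (m l)).indicator (fun _ => 1) (normSq V x)
  have hχm : ∀ l, AEStronglyMeasurable (χ l) μ := fun l =>
    ((measurable_const.indicator measurableSet_Iio).comp_aemeasurable
      hgm.aemeasurable).aestronglyMeasurable
  have hχ1 : ∀ l x, normSq V x < m l → χ l x = 1 := fun l x hx =>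
    Set.indicator_of_mem (s := Set.Iio (m l)) hx _
  have hχ0 : ∀ l x, ¬ normSq V x < m l → χ l x = 0 := fun l x hx =>
    Set.indicator_of_notMem (s := Set.Iio (m l)) hx _
  have hχb : ∀ l x, |χ l x| ≤ 1 ∧ |1 - χ l x| ≤ 1 := fun l x => by
    by_cases hx : normSq V x < m l
    · simp [hχ1 l x hx]
    · simp [hχ0 l x hx]
  have iK : ∀ l, Integrable (fun x => χ l x * H x - (1 - χ l x) * J x) μ := fun l =>
    (integrable_bdd_mul iH (hχm l) fun x => (hχb l x).1).sub
      (integrable_bdd_mul iJ (aestronglyMeasurable_const.sub (hχm l)) fun x => (hχb l x).2)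
  have hcurl := h.curl_relation_of_lt hD
  -- The tested equation has integral zero, and its integrand is at least H below the level m l and
  -- at least -J above it.
  have hK : ∀ l, ∫ x, (χ l x * H x - (1 - χ l x) * J x) ∂μ ≤ 0 := fun l => by
    have hc := hf.mul (hD.bddC1 l)
    have hid := h.sum_integral_partial_mul_cutGrad hc hη.sq
    have hinteg : ∀ k i, Integrable (fun x => N i k x * cutGrad (fun x => η x ^ 2)
        (fun t => f t * b l t) (fun t => f' t * b l t + f t * b' l t) V N k i x) μ := fun k i =>
      integrable_mul_of_memLp (h.tendsto_partial i k).memLp_lim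
        (h.tendsto_cutGrad hc hη.sq k i).memLp_lim
    rw [← hμ, Finset.sum_congr rfl fun k _ => (integral_finsetSum _ fun i _ => hinteg k i).symm,
      ← integral_finsetSum _ fun k _ => integrable_finsetSum _ fun i _ => hinteg k i] at hid
    rw [← hid]
    refine integral_mono_ae (iK l) (integrable_finsetSum _ fun k _ =>
      integrable_finsetSum _ fun i _ => hinteg k i) ?_
    filter_upwards [hcurl, hD.eventually_lt] with x hx hev
    set g := normSq V x with hg
    have hg0 : 0 ≤ g := normSq_nonneg V x
    have hb1 := hD.bounds l g hg0
    have e1 : ∑ k, ∑ i, N i k x * cutGrad (fun x => η x ^ 2)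
        (fun t => f t * b l t) (fun t => f' t * b l t + f t * b' l t) V N k i x =
        η x ^ 2 * (f g * b l g * ∑ k, ∑ i, N i k x * N k i x) + η x ^ 2 *
          (2 * (f' g * b l g + f g * b' l g) *
            ∑ i, (∑ l, V l x * N l i x) * ∑ k, N i k x * V k x)
        + 2 * η x * (f g * b l g) * ∑ i, fderiv ℝ η x (basisVec i) * ∑ k, N i k x * V k x := by
      have e2 : ∀ k i, N i k x * cutGrad (fun x => η x ^ 2)
          (fun t => f t * b l t) (fun t => f' t * b l t + f t * b' l t) V N k i x =
          η x ^ 2 * (f g * b l g * (N i k x * N k i x)) + η x ^ 2 *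
          (2 * (f' g * b l g + f g * b' l g) * ((∑ l, V l x * N l i x) * (N i k x * V k x)))
          + 2 * η x * (f g * b l g) * (fderiv ℝ η x (basisVec i) * (N i k x * V k x)) := fun k i => by
        have e3 : fderiv ℝ (fun x => η x ^ 2) x (basisVec i)
            = 2 * η x * fderiv ℝ η x (basisVec i) := by
          rw [fderiv_fun_pow 2 (hη.1.differentiable (by norm_num) x)]
          simp
        simp only [cutGrad, cutScalarGrad, halfGrad, e3, ← hg]
        ring
      simp_rw [e2, Finset.sum_add_distrib, ← Finset.mul_sum]
      congr 2
      · congr 2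
        rw [Finset.sum_comm]
        simp_rw [← Finset.mul_sum]
      · rw [Finset.sum_comm]
        simp_rw [← Finset.mul_sum]
    rw [e1]
    by_cases hlt : g < m l
    · have h1 := energy_integrand_ge (e := η x) (hlam.trans_le hb1.1) (hD.deriv_nonneg l g)
        (hf0 g) (hf0' g) (hx l hlt) (fun i => fderiv ℝ η x (basisVec i))
      rw [hχ1 l x hlt]
      refine le_trans ?_ h1
      have h2 : 0 ≤ η x ^ 2 * f g * partSq N x := by
        have := partSq_nonneg N x
        have := hf0 g
        positivity
      have h3 : 0 ≤ f g * gradSq η x * g :=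
        mul_nonneg (mul_nonneg (hf0 g) (gradSq_nonneg η x)) hg0
      have h4 := mul_le_mul_of_nonneg_right hb1.1 h2
      have h5 := mul_le_mul_of_nonneg_right hb1.2 h3
      change 1 * (lam / 2 * (η x ^ 2 * f g * partSq N x) - 2 * Lam * (f g * gradSq η x * g))
        - (1 - 1) * J x ≤ f g * b l g * (η x ^ 2 * partSq N x / 2 - 2 * (gradSq η x * g))
      linarith
    -- Above m l the dual b_l is not exact, but some later level exceeds |V(x)|². The relation for
    -- that l' gives x·NV ≥ 0, a statement free of l, which disposes of the possibly huge b_l' term.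
    · obtain ⟨l', hl'⟩ := hev.exists
      have hb2 := hD.bounds l' g hg0
      have hP := sum_mul_sum_nonneg_of_curl (hlam.trans_le hb2.1) (hD.deriv_nonneg l' g) (hx l' hl')
      have hc0 : 0 ≤ f g * b l g := mul_nonneg (hf0 g) (hlam.le.trans hb1.1)
      have hc0' : 0 ≤ f' g * b l g + f g * b' l g :=
        add_nonneg (mul_nonneg (hf0' g) (hlam.le.trans hb1.1))
          (mul_nonneg (hf0 g) (hD.deriv_nonneg l g))
      have h1 := energy_integrand_ge_crude (e := η x) hc0 hc0' hP
        (fun i => fderiv ℝ η x (basisVec i))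
      rw [hχ0 l x hlt]
      refine le_trans ?_ h1
      have h2 : f g * b l g ≤ Cf * Lam :=
        mul_le_mul (hfC x) hb1.2 (hlam.le.trans hb1.1) hCf0
      have h3 : η x ^ 2 * partSq N x * 2 + 2 * (gradSq η x * g) ≤
          E ^ 2 * partSq N x * 2 + 2 * (D * g) := by
        have := mul_le_mul_of_nonneg_right (hE2 x) (partSq_nonneg N x)
        have := mul_le_mul_of_nonneg_right (hDb x) hg0
        linarith
      have h4 : 0 ≤ η x ^ 2 * partSq N x * 2 + 2 * (gradSq η x * g) := by
        have := partSq_nonneg N x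
        have := gradSq_nonneg η x
        positivity
      have h5 := mul_le_mul h2 h3 h4 (by positivity)
      change 0 * H x - (1 - 0) * (2 * (Cf * Lam) * E ^ 2 * partSq N x
        + 2 * (Cf * Lam) * D * g) ≤
        -(f g * b l g * (η x ^ 2 * partSq N x * 2 + 2 * (gradSq η x * g)))
      linarith
  -- Almost every point lies below m l for large l, so the crude part disappears in the limit, with
  -- majorant |H| + J.
  have hlim : Tendsto (fun l => ∫ x, (χ l x * H x - (1 - χ l x) * J x) ∂μ) atTop
      (𝓝 (∫ x, H x ∂μ)) := by
    refine tendsto_integral_of_dominated_convergence (fun x => |H x| + J x)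
      (fun l => (iK l).1) (iH.abs.add iJ) (fun l => ae_of_all _ fun x => ?_) ?_
    · have h1 := abs_sub (χ l x * H x) ((1 - χ l x) * J x)
      rw [abs_mul, abs_mul, abs_of_nonneg (hJ0 x)] at h1
      have h2 := mul_le_mul_of_nonneg_right (hχb l x).1 (abs_nonneg (H x))
      have h3 := mul_le_mul_of_nonneg_right (hχb l x).2 (hJ0 x)
      rw [Real.norm_eq_abs]
      linarith
    · filter_upwards [hD.eventually_lt] with x hx
      refine tendsto_const_nhds.congr' ?_
      filter_upwards [hx] with l hl
      rw [hχ1 l x hl]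
      ring
  have hle : ∫ x, H x ∂μ ≤ 0 := le_of_tendsto hlim (Eventually.of_forall hK)
  rw [hH, integral_sub (iA.const_mul _) (iB.const_mul _), integral_const_mul,
    integral_const_mul] at hle
  rw [div_mul_eq_mul_div, le_div_iff₀ hlam]
  linarith

end IsApproximation

end CompressibleFlow

end

/-! ### The Sobolev inequality and cutoffs. -/

noncomputable section

namespace CompressibleFlow

open scoped ENNReal NNReal

variable {n : ℕ}

theorem enorm_clm_sq_le (L : Euc n →L[ℝ] ℝ) : ‖L‖ₑ ^ 2 ≤ ∑ i, ‖L (basisVec i)‖ₑ ^ 2 := by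
  have h1 : ‖L‖ ^ 2 ≤ ∑ i, L (basisVec i) ^ 2 := by
    have h0 : 0 ≤ ∑ i, L (basisVec i) ^ 2 := Finset.sum_nonneg fun _ _ => sq_nonneg _
    have h2 : ‖L‖ ≤ √(∑ i, L (basisVec i) ^ 2) := by
      refine L.opNorm_le_bound (Real.sqrt_nonneg _) fun x => ?_
      rw [clm_apply_eq_sum L x, EuclideanSpace.norm_eq, ← Real.sqrt_mul h0, Real.norm_eq_abs,
        ← Real.sqrt_sq_eq_abs]
      refine Real.sqrt_le_sqrt ?_
      have := Finset.sum_mul_sq_le_sq_mul_sq Finset.univ (fun j => x j) (fun j => L (basisVec j))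
      simp only [Real.norm_eq_abs, sq_abs]
      linarith
    calc ‖L‖ ^ 2 ≤ √(∑ i, L (basisVec i) ^ 2) ^ 2 := by gcongr
      _ = _ := Real.sq_sqrt h0
  have h2 : ∀ a : ℝ, ‖a‖ₑ ^ 2 = ENNReal.ofReal (a ^ 2) := fun a => by
    rw [Real.enorm_eq_ofReal_abs, ← ENNReal.ofReal_pow (abs_nonneg _), sq_abs]
  simp_rw [h2]
  rw [← ENNReal.ofReal_sum_of_nonneg fun _ _ => sq_nonneg _, ← ofReal_norm,
    ← ENNReal.ofReal_pow (norm_nonneg _)]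
  exact ENNReal.ofReal_le_ofReal h1

theorem integral_sq_eq_toReal {α : Type*} [MeasurableSpace α] {μ : Measure α} {f : α → ℝ}
    (hf : AEStronglyMeasurable f μ) :
    ∫ x, f x ^ 2 ∂μ = (eLpNorm f 2 μ ^ 2).toReal := by
  rw [sq_eLpNorm_two, integral_eq_lintegral_of_nonneg_ae (ae_of_all _ fun _ => sq_nonneg _)
    (hf.pow 2)]
  congr 2 with x
  rw [Real.enorm_eq_ofReal_abs, ← ENNReal.ofReal_pow (abs_nonneg _), sq_abs]

/-- The Sobolev inequality in `L²` form on sets of small measure. -/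
theorem exists_sobolev_const (hn : 2 < n) : ∃ C : ℝ, 0 < C ∧ ∀ w : Euc n → ℝ, ContDiff ℝ 1 w →
    HasCompactSupport w → ∀ A : Set (Euc n), volume A ≠ ⊤ →
      ∫ x in A, w x ^ 2 ≤ C * volume.real A ^ (2 / n : ℝ) *
        ∑ i, ∫ x, fderiv ℝ w x (basisVec i) ^ 2 := by
  set S := eLpNormLESNormFDerivOfEqInnerConst (volume : Measure (Euc n)) 2 with hS
  refine ⟨S ^ 2 + 1, by positivity, fun w hw hws A hA => ?_⟩
  have hn0 : (0 : ℝ) < n := by positivity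
  have hn2 : (2 : ℝ) < n := by exact_mod_cast hn
  have hfin : Module.finrank ℝ (Euc n) = n := finrank_euclideanSpace_fin
  have hpos : (0 : ℝ) < 1 / 2 - 1 / n := by
    rw [sub_pos]
    exact one_div_lt_one_div_of_lt (by norm_num) hn2
  -- The Sobolev exponent conjugate to 2. Hölder on A between 2 and q contributes |A|^(1/n), which
  -- becomes |A|^(2/n) on squaring.
  set q : ℝ≥0 := ⟨(1 / 2 - 1 / n : ℝ)⁻¹, by positivity⟩ with hq
  have hq' : (q : ℝ) = (1 / 2 - 1 / n : ℝ)⁻¹ := rfl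
  have h2q : (2 : ℝ≥0) ≤ q := by
    rw [← NNReal.coe_le_coe, hq', le_inv_comm₀ (by norm_num) hpos]
    have : 0 < 1 / (n : ℝ) := by positivity
    push_cast
    linarith
  have h1 := eLpNorm_le_eLpNorm_fderiv_of_eq_inner (volume : Measure (Euc n)) hw hws (p := 2)
    (p' := q) (by norm_num) (by omega) (by
      rw [hfin, hq', inv_inv]
      push_cast
      ring)
  have h2 := eLpNorm_le_eLpNorm_mul_rpow_measure_univ (μ := volume.restrict A) (f := w)
    (p := 2) (q := q) (by exact_mod_cast h2q) hw.continuous.aestronglyMeasurable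
  have hexp : 1 / (2 : ℝ≥0∞).toReal - 1 / (q : ℝ≥0∞).toReal = 1 / n := by
    rw [ENNReal.coe_toReal, hq']
    simp
  rw [hexp, Measure.restrict_apply_univ] at h2
  have h3 : eLpNorm w 2 (volume.restrict A) ≤
      S * eLpNorm (fderiv ℝ w) 2 volume * volume A ^ (1 / n : ℝ) := by
    refine h2.trans ?_
    gcongr
    exact (eLpNorm_restrict_le _ _ _ _).trans (by simpa using h1)
  have h4 : eLpNorm (fderiv ℝ w) 2 volume ^ 2 ≤
      ∑ i, eLpNorm (fun x => fderiv ℝ w x (basisVec i)) 2 volume ^ 2 := by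
    have hc : ∀ i, Continuous fun x => fderiv ℝ w x (basisVec i) := fun i =>
      (hw.continuous_fderiv (by norm_num)).clm_apply continuous_const
    simp_rw [sq_eLpNorm_two]
    rw [← lintegral_finsetSum _ fun i _ => (hc i).enorm.measurable.pow_const 2]
    exact lintegral_mono fun x => enorm_clm_sq_le _
  have hcs : ∀ i, MemLp (fun x => fderiv ℝ w x (basisVec i)) 2 volume := fun i =>
    ((hw.continuous_fderiv (by norm_num)).clm_apply continuous_const).memLp_of_hasCompactSupport
      (hws.fderiv_apply ℝ _)
  have h5 : eLpNorm w 2 (volume.restrict A) ^ 2 ≤ S ^ 2 * volume A ^ (2 / n : ℝ) *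
      ∑ i, eLpNorm (fun x => fderiv ℝ w x (basisVec i)) 2 volume ^ 2 := by
    refine (pow_le_pow_left₀ zero_le h3 2).trans ?_
    have e1 : (volume A ^ (1 / n : ℝ)) ^ 2 = volume A ^ (2 / n : ℝ) := by
      rw [← ENNReal.rpow_natCast, ← ENNReal.rpow_mul]
      congr 1
      push_cast
      ring
    rw [mul_pow, mul_pow, e1, mul_right_comm]
    gcongr
  rw [integral_sq_eq_toReal hw.continuous.aestronglyMeasurable]
  simp_rw [fun i => integral_sq_eq_toReal (hcs i).1]
  have hne : ∀ i, eLpNorm (fun x => fderiv ℝ w x (basisVec i)) 2 volume ^ 2 ≠ ⊤ := fun i =>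
    ENNReal.pow_ne_top (hcs i).2.ne
  rw [← ENNReal.toReal_sum fun i _ => hne i]
  have h6 := ENNReal.toReal_mono (ENNReal.mul_ne_top (ENNReal.mul_ne_top
    (ENNReal.pow_ne_top ENNReal.coe_ne_top) (ENNReal.rpow_ne_top_of_nonneg (by positivity) hA))
    (ENNReal.sum_ne_top.2 fun i _ => hne i)) h5
  rw [ENNReal.toReal_mul, ENNReal.toReal_mul, ← ENNReal.toReal_rpow] at h6
  refine h6.trans ?_
  have e2 : ((S : ℝ≥0∞) ^ 2).toReal = (S : ℝ) ^ 2 := by simp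
  rw [e2]
  have : (S : ℝ) ^ 2 ≤ S ^ 2 + 1 := by linarith
  have h7 : 0 ≤ (volume A).toReal ^ (2 / n : ℝ) := by positivity
  change (S : ℝ) ^ 2 * (volume A).toReal ^ (2 / n : ℝ) * _ ≤
    (S ^ 2 + 1) * (volume A).toReal ^ (2 / n : ℝ) * _
  gcongr

/-- Cutoff functions between concentric balls with a gradient bound. -/
theorem exists_cutoff_bound : ∃ C : ℝ, 0 < C ∧ ∀ (n : ℕ) (x₀ : Euc n) (r s : ℝ), 0 < r → r < s →
    ∃ η : Euc n → ℝ, IsTestFunction (Metric.ball x₀ s) η ∧ (∀ x ∈ Metric.ball x₀ r, η x = 1) ∧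
      (∀ x, 0 ≤ η x ∧ η x ≤ 1) ∧ ∀ x, gradSq η x ≤ C / (s - r) ^ 2 := by
  obtain ⟨L, hL0, hL⟩ := exists_bound_deriv_smoothTransition
  refine ⟨16 * L ^ 2, by positivity, fun n x₀ r s hr hrs => ?_⟩
  set m := (r + s) / 2 with hm
  have hrm : r < m := by linarith
  have hms : m < s := by linarith
  set d := m ^ 2 - r ^ 2 with hd
  have hd0 : 0 < d := by nlinarith
  -- A function of the squared distance is smooth also at the centre; it is at least 1 on the ball
  -- of radius r and at most 0 beyond the midpoint radius m.
  let G : Euc n → ℝ := fun x => (m ^ 2 - ‖x - x₀‖ ^ 2) / d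
  have hG : ContDiff ℝ ∞ G :=
    (contDiff_const.sub ((contDiff_id.sub contDiff_const).norm_sq ℝ)).div_const d
  have hGz : ∀ x, m ≤ ‖x - x₀‖ → G x ≤ 0 := fun x hx =>
    div_nonpos_of_nonpos_of_nonneg (by nlinarith [norm_nonneg (x - x₀)]) hd0.le
  have hsupp : tsupport (fun x => Real.smoothTransition (G x)) ⊆ Metric.closedBall x₀ m := by
    refine closure_minimal (fun x hx => ?_) Metric.isClosed_closedBall
    by_contra hx'
    rw [Metric.mem_closedBall, not_le, dist_eq_norm] at hx'
    exact hx (Real.smoothTransition.zero_of_nonpos (hGz x hx'.le))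
  refine ⟨fun x => Real.smoothTransition (G x), ⟨Real.smoothTransition.contDiff.comp hG,
    HasCompactSupport.of_support_subset_isCompact (isCompact_closedBall x₀ m)
      (subset_closure.trans hsupp), hsupp.trans (Metric.closedBall_subset_ball hms)⟩,
    fun x hx => ?_, fun x => ⟨Real.smoothTransition.nonneg _, Real.smoothTransition.le_one _⟩,
    fun x => ?_⟩
  · refine Real.smoothTransition.one_of_one_le ?_
    rw [le_div_iff₀ hd0]
    rw [Metric.mem_ball, dist_eq_norm] at hx
    nlinarith [norm_nonneg (x - x₀)]
  have hGd : ∀ v, fderiv ℝ G x v = -(2 * inner ℝ (x - x₀) v) / d := fun v => by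
    have h1 : HasFDerivAt (fun y => ‖y - x₀‖ ^ 2) _ x :=
      ((hasFDerivAt_id x).sub_const x₀).norm_sq
    have h2 : HasFDerivAt G _ x := ((h1.const_sub (m ^ 2)).mul_const d⁻¹)
    rw [h2.fderiv]
    simp only [inner_sub_left, smul_apply, neg_apply, ContinuousLinearMap.comp_apply,
      ContinuousLinearMap.id_apply, coe_innerSL_apply, id, smul_eq_mul, nsmul_eq_mul]
    push_cast
    ring
  have hcd : ∀ v, fderiv ℝ (fun x => Real.smoothTransition (G x)) x v =
      deriv Real.smoothTransition (G x) * (-(2 * inner ℝ (x - x₀) v) / d) := fun v => by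
    have h2 : HasFDerivAt (fun x => Real.smoothTransition (G x)) _ x :=
      (hasDerivAt_smoothTransition (G x)).comp_hasFDerivAt x
        (hG.differentiable (by norm_num) x).hasFDerivAt
    rw [h2.fderiv, smul_apply, smul_eq_mul, hGd]
  have hsum : gradSq (fun x => Real.smoothTransition (G x)) x =
      deriv Real.smoothTransition (G x) ^ 2 * (4 / d ^ 2 * ‖x - x₀‖ ^ 2) := by
    have e1 : ∀ i : Fin n, inner ℝ (x - x₀) (basisVec i) = (x - x₀) i := fun i => by
      rw [EuclideanSpace.inner_single_right]
      simp
    rw [gradSq]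
    simp_rw [hcd, e1]
    rw [EuclideanSpace.norm_sq_eq]
    simp_rw [Real.norm_eq_abs, sq_abs, Finset.mul_sum]
    refine Finset.sum_congr rfl fun i _ => ?_
    generalize (x - x₀) i = t
    field_simp
    ring
  rw [hsum]
  rcases le_total m ‖x - x₀‖ with hx | hx
  · rw [deriv_smoothTransition_of_nonpos (hGz x hx)]
    have : 0 ≤ 16 * L ^ 2 / (s - r) ^ 2 := by positivity
    simpa using this
  · have h1 : deriv Real.smoothTransition (G x) ^ 2 ≤ L ^ 2 :=
      pow_le_pow_left₀ (deriv_smoothTransition_nonneg _) (hL _) 2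
    -- Since d = (m - r)(m + r) and ‖x - x₀‖ ≤ m, the gradient of G has length at most 2/(m - r) =
    -- 4/(s - r).
    have h2 : 4 / d ^ 2 * ‖x - x₀‖ ^ 2 ≤ 16 / (s - r) ^ 2 := by
      rw [div_mul_eq_mul_div, div_le_div_iff₀ (by positivity) (pow_pos (sub_pos.2 hrs) 2)]
      have h3 : ‖x - x₀‖ * (s - r) ≤ 2 * d := by
        have : (s - r) = 2 * (m - r) := by rw [hm]; ring
        rw [this, hd]
        nlinarith [mul_le_mul_of_nonneg_right hx (sub_nonneg.2 hrm.le),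
          mul_pos hr (sub_pos.2 hrm)]
      have := pow_le_pow_left₀ (mul_nonneg (norm_nonneg _) (sub_pos.2 hrs).le) h3 2
      nlinarith
    calc _ ≤ L ^ 2 * (16 / (s - r) ^ 2) := mul_le_mul h1 h2 (by positivity) (by positivity)
      _ = _ := by ring

/-- The Sobolev inequality for the truncated flux. -/
theorem IsApproximation.sobolev_cut {x₀ : Euc n} {r : ℝ} {V p : Fin n → Euc n → ℝ}
    {N : Fin n → Fin n → Euc n → ℝ} {Vm pm : ℕ → Fin n → Euc n → ℝ}
    (h : IsApproximation x₀ r V p N Vm pm) {C : ℝ}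
    (hC : ∀ w : Euc n → ℝ, ContDiff ℝ 1 w →
      HasCompactSupport w → ∀ A : Set (Euc n), volume A ≠ ⊤ →
      ∫ x in A, w x ^ 2 ≤ C * volume.real A ^ (2 / n : ℝ) *
        ∑ i, ∫ x, fderiv ℝ w x (basisVec i) ^ 2)
    {c c' : ℝ → ℝ} (hc : BddC1 c c') {θ : Euc n → ℝ} (hθ : IsTestFunction (Metric.ball x₀ r) θ)
    {A : Set (Euc n)} (hA : A ⊆ Metric.ball x₀ r) (k : Fin n) :
    ∫ x in A, (θ x * c (normSq V x) * V k x) ^ 2 ≤ C * volume.real A ^ (2 / n : ℝ) *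
      ∑ i, ∫ x in Metric.ball x₀ r, cutGrad θ c c' V N k i x ^ 2 := by
  obtain ⟨D, hD⟩ := hc.bdd
  obtain ⟨L, hL0, hL⟩ := hθ.exists_bound
  have t1 : TendstoL2 (volume.restrict (Metric.ball x₀ r))
      (fun m x => (θ x * c (normSq (Vm m) x)) * Vm m k x)
      (fun x => (θ x * c (normSq V x)) * V k x) := by
    refine (h.tendsto_flux k).bdd_mul (C := L * D)
      (fun m => (hθ.1.continuous.mul
        (hc.continuous.comp (h.continuous_normSq m))).aestronglyMeasurable)
      (fun m => ae_of_all _ fun x => ?_) ?_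
    · rw [abs_mul]
      exact mul_le_mul (hL x) (hD _ (normSq_nonneg _ x)).1 (abs_nonneg _) hL0
    · filter_upwards [h.tendsto_normSq_ae] with x hx
      exact ((hc.continuous.tendsto _).comp hx.2).const_mul _
  have t2 := (t1.restrict A).tendsto_integral_sq
  rw [Measure.restrict_restrict_of_subset hA] at t2
  have t3 := (tendsto_finsetSum Finset.univ fun i _ =>
    (h.tendsto_cutGrad hc hθ k i).tendsto_integral_sq).const_mul (C * volume.real A ^ (2 / n : ℝ))
  -- The inequality is applied to the smooth approximations; both sides converge.
  refine le_of_tendsto_of_tendsto' t2 t3 fun m => ?_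
  have hcs : HasCompactSupport fun x => θ x * c (normSq (Vm m) x) * Vm m k x :=
    (hθ.2.1.mul_right).mul_right
  refine (hC _ (contDiff_cut hθ.1 hc (h.contDiff_flux m) k) hcs A
    ((measure_mono hA).trans_lt measure_ball_lt_top).ne).trans_eq ?_
  congr 1
  refine Finset.sum_congr rfl fun i _ => ?_
  simp_rw [fderiv_cut hθ.1 hc (h.contDiff_flux m)]
  refine (setIntegral_eq_integral_of_forall_compl_eq_zero fun x hx => ?_).symm
  simp [cutGrad, cutScalarGrad, hθ.eq_zero hx, hθ.fderiv_eq_zero hx]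

end CompressibleFlow

end

/-! ### De Giorgi iteration. -/

noncomputable section

namespace CompressibleFlow

variable {n : ℕ}

theorem halfGrad_sq_le (V : Fin n → Euc n → ℝ) (N : Fin n → Fin n → Euc n → ℝ) (x : Euc n) :
    ∑ i, halfGrad V N i x ^ 2 ≤ normSq V x * partSq N x := by
  rw [partSq, Finset.mul_sum]
  exact Finset.sum_le_sum fun i _ => Finset.sum_mul_sq_le_sq_mul_sq _ _ _

/-- The gradient splits into three parts, where the derivative falls on θ, on c(|V|²) or on V_k; the
middle one uses |x|² ≤ |V|²|N|² for x = ½∇|V|². -/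
theorem sum_cutGrad_sq_le (θ : Euc n → ℝ) (c c' : ℝ → ℝ) (V : Fin n → Euc n → ℝ)
    (N : Fin n → Fin n → Euc n → ℝ) (x : Euc n) :
    ∑ k, ∑ i, cutGrad θ c c' V N k i x ^ 2 ≤
      3 * (c (normSq V x) ^ 2 * gradSq θ x * normSq V x + θ x ^ 2 *
        (c (normSq V x) ^ 2 + 4 * (c' (normSq V x) * normSq V x) ^ 2) * partSq N x) := by
  set g := normSq V x with hg
  have h1 : ∀ k i, cutGrad θ c c' V N k i x ^ 2 ≤
      3 * c g ^ 2 * (fderiv ℝ θ x (basisVec i) ^ 2 * V k x ^ 2)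
      + 12 * θ x ^ 2 * c' g ^ 2 * (halfGrad V N i x ^ 2 * V k x ^ 2)
      + 3 * θ x ^ 2 * c g ^ 2 * N k i x ^ 2 := fun k i => by
    have e : cutGrad θ c c' V N k i x = c g * fderiv ℝ θ x (basisVec i) * V k x
        + θ x * c' g * (2 * halfGrad V N i x) * V k x + θ x * c g * N k i x := by
      rw [cutGrad, cutScalarGrad, ← hg]
      ring
    rw [e]
    generalize hA : c g * fderiv ℝ θ x (basisVec i) * V k x = A
    generalize hB : θ x * c' g * (2 * halfGrad V N i x) * V k x = B
    generalize hC : θ x * c g * N k i x = C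
    have e1 : 3 * c g ^ 2 * (fderiv ℝ θ x (basisVec i) ^ 2 * V k x ^ 2) = 3 * A ^ 2 := by
      rw [← hA]; ring
    have e2 : 12 * θ x ^ 2 * c' g ^ 2 * (halfGrad V N i x ^ 2 * V k x ^ 2) = 3 * B ^ 2 := by
      rw [← hB]; ring
    have e3 : 3 * θ x ^ 2 * c g ^ 2 * N k i x ^ 2 = 3 * C ^ 2 := by
      rw [← hC]; ring
    rw [e1, e2, e3]
    nlinarith [sq_nonneg (A - B), sq_nonneg (B - C), sq_nonneg (A - C)]
  refine (Finset.sum_le_sum fun k _ => Finset.sum_le_sum fun i _ => h1 k i).trans ?_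
  have e4 : ∑ k, ∑ i, (3 * c g ^ 2 * (fderiv ℝ θ x (basisVec i) ^ 2 * V k x ^ 2)
      + 12 * θ x ^ 2 * c' g ^ 2 * (halfGrad V N i x ^ 2 * V k x ^ 2)
      + 3 * θ x ^ 2 * c g ^ 2 * N k i x ^ 2) = 3 * c g ^ 2 * (gradSq θ x * g)
      + 12 * θ x ^ 2 * c' g ^ 2 * ((∑ i, halfGrad V N i x ^ 2) * g)
      + 3 * θ x ^ 2 * c g ^ 2 * partSq N x := by
    simp_rw [Finset.sum_add_distrib, ← Finset.mul_sum, ← Finset.sum_mul]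
    rw [hg, normSq, gradSq, partSq, Finset.sum_comm (f := fun k i => N i k x ^ 2)]
    simp_rw [← Finset.mul_sum]
  rw [e4]
  have h2 := halfGrad_sq_le V N x
  have hg0 : 0 ≤ g := normSq_nonneg V x
  have h3 : 12 * θ x ^ 2 * c' g ^ 2 * ((∑ i, halfGrad V N i x ^ 2) * g) ≤
      12 * θ x ^ 2 * c' g ^ 2 * ((g * partSq N x) * g) := by gcongr
  linarith

/-- The part of `∫ |V|²` over a ball coming from the set where `|V|² > k`. -/
def levelEnergy (V : Fin n → Euc n → ℝ) (x₀ : Euc n) (s k : ℝ) : ℝ :=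
  ∫ x in Metric.ball x₀ s, (Set.Ioi k).indicator id (normSq V x)

theorem indicator_Ioi_nonneg {k t : ℝ} (ht : 0 ≤ t) : 0 ≤ (Set.Ioi k).indicator id t :=
  Set.indicator_apply_nonneg fun _ => ht

theorem indicator_Ioi_le {k t : ℝ} (ht : 0 ≤ t) : (Set.Ioi k).indicator id t ≤ t :=
  Set.indicator_apply_le' (fun _ => le_rfl) fun _ => ht

theorem levelEnergy_nonneg (V : Fin n → Euc n → ℝ) (x₀ : Euc n) (s k : ℝ) :
    0 ≤ levelEnergy V x₀ s k :=
  integral_nonneg fun x => indicator_Ioi_nonneg (normSq_nonneg V x)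

namespace IsApproximation

variable {x₀ : Euc n} {r : ℝ} {V p : Fin n → Euc n → ℝ} {N : Fin n → Fin n → Euc n → ℝ}
  {Vm pm : ℕ → Fin n → Euc n → ℝ}

theorem integrable_indicator_Ioi (h : IsApproximation x₀ r V p N Vm pm) (k : ℝ) :
    Integrable (fun x => (Set.Ioi k).indicator id (normSq V x))
      (volume.restrict (Metric.ball x₀ r)) := by
  refine h.integrable_normSq.mono' ((measurable_id.indicator
    measurableSet_Ioi).comp_aemeasurable
      h.aestronglyMeasurable_normSq.aemeasurable).aestronglyMeasurable (ae_of_all _ fun x => ?_)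
  rw [Real.norm_eq_abs, abs_of_nonneg (indicator_Ioi_nonneg (normSq_nonneg V x))]
  exact indicator_Ioi_le (normSq_nonneg V x)

theorem levelEnergy_mono (h : IsApproximation x₀ r V p N Vm pm) {s s' k k' : ℝ} (hs : s' ≤ s)
    (hsr : s ≤ r) (hk : k ≤ k') : levelEnergy V x₀ s' k' ≤ levelEnergy V x₀ s k := by
  have h1 : ∀ l, IntegrableOn (fun x => (Set.Ioi l).indicator id (normSq V x))
      (Metric.ball x₀ s) := fun l =>
    IntegrableOn.mono_set (h.integrable_indicator_Ioi l) (Metric.ball_subset_ball hsr)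
  refine (setIntegral_mono_set (h1 k') (ae_of_all _ fun x =>
    indicator_Ioi_nonneg (normSq_nonneg V x)) (Metric.ball_subset_ball hs).eventuallyLE).trans ?_
  refine integral_mono (h1 k') (h1 k) fun x => ?_
  refine Set.indicator_apply_le' (fun hx => ?_) fun _ => indicator_Ioi_nonneg (normSq_nonneg V x)
  exact (Set.indicator_of_mem (Set.Ioi_subset_Ioi hk hx) id).ge

/-- Chebyshev's inequality. It turns the power of the measure in the Sobolev inequality into a power
of the level energy, the source of superlinearity. -/
theorem measure_level_le (h : IsApproximation x₀ r V p N Vm pm) {s k : ℝ} (hsr : s ≤ r)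
    (hk : 0 < k) : volume.real (Metric.ball x₀ s ∩ {x | k < normSq V x}) ≤
      levelEnergy V x₀ s k / k := by
  rw [le_div_iff₀ hk, mul_comm]
  have h1 : IntegrableOn (fun x => (Set.Ioi k).indicator id (normSq V x)) (Metric.ball x₀ s) :=
    IntegrableOn.mono_set (h.integrable_indicator_Ioi k) (Metric.ball_subset_ball hsr)
  refine le_trans ?_ (mul_meas_ge_le_integral_of_nonneg (ae_of_all _ fun x =>
    indicator_Ioi_nonneg (normSq_nonneg V x)) h1 k)
  refine mul_le_mul_of_nonneg_left ?_ hk.le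
  rw [measureReal_restrict_apply' measurableSet_ball]
  refine measureReal_mono (fun x hx => ⟨?_, hx.1⟩)
    ((measure_mono Set.inter_subset_right).trans_lt measure_ball_lt_top).ne
  have h2 : k < normSq V x := hx.2
  have h3 : (Set.Ioi k).indicator id (normSq V x) = normSq V x :=
    Set.indicator_of_mem (s := Set.Ioi k) h2 _
  exact h2.le.trans_eq h3.symm

end IsApproximation

/-- The step of the De Giorgi iteration. -/
theorem exists_levelEnergy_const (hn : 2 < n) {lam Lam : ℝ} (hlam : 0 < lam) (hLam : 0 ≤ Lam) :
    ∃ C : ℝ, 0 < C ∧ ∀ (x₀ : Euc n) (r : ℝ) (V p : Fin n → Euc n → ℝ)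
      (N : Fin n → Fin n → Euc n → ℝ) (Vm pm : ℕ → Fin n → Euc n → ℝ) (b b' : ℕ → ℝ → ℝ)
      (m : ℕ → ℝ), IsApproximation x₀ r V p N Vm pm →
      IsDualFamily (Metric.ball x₀ r) V p lam Lam b b' m → ∀ s' s k k' : ℝ, 0 < s' → s' < s →
        s ≤ r → 0 < k → k < k' → levelEnergy V x₀ s' k' ≤
          C * (k' / (k' - k)) ^ 2 / (s - s') ^ 2 * (levelEnergy V x₀ s k / k) ^ (2 / n : ℝ) *
            levelEnergy V x₀ s k := by
  obtain ⟨Cs, hCs0, hCs⟩ := exists_sobolev_const hn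
  obtain ⟨L, hL0, hL⟩ := exists_bound_deriv_smoothTransition
  obtain ⟨Cη, hCη0, hCη⟩ := exists_cutoff_bound
  refine ⟨Cs * (3 * (1 + (1 + 16 * L ^ 2) * (4 * Lam / lam)) * Cη), by positivity, ?_⟩
  intro x₀ r V p N Vm pm b b' m h hD s' s k k' hs' hss hsr hk hkk
  -- Two steps share the gap: f rises on [k, k₁] and c on [k₁, k']. Thus f = 1 wherever c or c' is
  -- nonzero, and the Caccioppoli inequality weighted by f controls the gradient of ηc(|V|²)V.
  set k₁ := (k + k') / 2 with hk1
  have hkk1 : k < k₁ := by linarith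
  have hk1k : k₁ < k' := by linarith
  set μ := volume.restrict (Metric.ball x₀ r) with hμ
  obtain ⟨η, hη, hη1, hη01, hηg⟩ := hCη n x₀ s' s hs' hss
  have hη' : IsTestFunction (Metric.ball x₀ r) η :=
    ⟨hη.1, hη.2.1, hη.2.2.trans (Metric.ball_subset_ball hsr)⟩
  set f := smoothStep k k₁ with hf
  set c := smoothStep k₁ k' with hc
  set c' := smoothStepDeriv k₁ k' with hc'
  have hfB : BddC1 f (smoothStepDeriv k k₁) := bddC1_smoothStep hkk1
  have hcB : BddC1 c c' := bddC1_smoothStep hk1k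
  set T := k' / (k' - k) with hT
  have hT1 : 1 ≤ T := by
    rw [hT, le_div_iff₀ (by linarith)]
    linarith
  set A := Metric.ball x₀ s ∩ {x | k < normSq V x} with hA
  have hAs : A ⊆ Metric.ball x₀ r :=
    Set.inter_subset_left.trans (Metric.ball_subset_ball hsr)
  have hgm : AEStronglyMeasurable (normSq V) μ := h.aestronglyMeasurable_normSq
  have hcac := h.caccioppoli hD hlam hfB (smoothStep_nonneg k k₁)
    (smoothStepDeriv_nonneg hkk1) hη'
  have hI := h.integrable_indicator_Ioi k
  have hIs : ∀ l, IntegrableOn (fun x => (Set.Ioi l).indicator id (normSq V x))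
      (Metric.ball x₀ s) := fun l =>
    IntegrableOn.mono_set (h.integrable_indicator_Ioi l) (Metric.ball_subset_ball hsr)
  have hffm : AEStronglyMeasurable (fun x => f (normSq V x)) μ :=
    hfB.continuous.comp_aestronglyMeasurable hgm
  have hf1 : ∀ t, f t ≤ 1 := smoothStep_le_one k k₁
  have hf0 : ∀ t, 0 ≤ f t := smoothStep_nonneg k k₁
  obtain ⟨D, hDb⟩ := hη'.exists_bound_gradSq
  have iG : Integrable (fun x => f (normSq V x) * gradSq η x * normSq V x) μ :=
    integrable_bdd_mul (C := D) h.integrable_normSq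
      (hffm.mul hη'.continuous_gradSq.aestronglyMeasurable) fun x => by
        rw [abs_of_nonneg (mul_nonneg (hf0 _) (gradSq_nonneg _ _))]
        exact (mul_le_of_le_one_left (gradSq_nonneg _ _) (hf1 _)).trans (hDb x)
  have iP : Integrable (fun x => η x ^ 2 * f (normSq V x) * partSq N x) μ :=
    integrable_bdd_mul (C := 1) h.integrable_partSq
      ((hη'.1.continuous.aestronglyMeasurable.pow 2).mul hffm) fun x => by
        rw [abs_of_nonneg (mul_nonneg (sq_nonneg _) (hf0 _))]
        exact mul_le_one₀ (pow_le_one₀ (hη01 x).1 (hη01 x).2) (hf0 _) (hf1 _)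
  -- the gradient term is controlled by the energy above the level `k`
  have hG : ∫ x, f (normSq V x) * gradSq η x * normSq V x ∂μ ≤
      Cη / (s - s') ^ 2 * levelEnergy V x₀ s k := by
    have e1 : ∫ x, f (normSq V x) * gradSq η x * normSq V x ∂μ =
        ∫ x in Metric.ball x₀ s, f (normSq V x) * gradSq η x * normSq V x := by
      refine setIntegral_eq_of_subset_of_forall_sdiff_eq_zero measurableSet_ball
        (Metric.ball_subset_ball hsr) fun x hx => ?_
      have : gradSq η x = 0 := by
        rw [gradSq, hη.fderiv_eq_zero hx.2]
        simp
      rw [this, mul_zero, zero_mul]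
    rw [e1, levelEnergy, ← integral_const_mul]
    refine integral_mono (IntegrableOn.mono_set iG (Metric.ball_subset_ball hsr))
      ((hIs k).const_mul _) fun x => ?_
    have hg0 := normSq_nonneg V x
    by_cases hx : k < normSq V x
    · have h3 : (Set.Ioi k).indicator id (normSq V x) = normSq V x :=
        Set.indicator_of_mem (s := Set.Ioi k) hx _
      simp only [h3]
      refine mul_le_mul_of_nonneg_right ?_ hg0
      exact (mul_le_of_le_one_left (gradSq_nonneg _ _) (hf1 _)).trans (hηg x)
    · have h3 : (Set.Ioi k).indicator id (normSq V x) = 0 :=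
        Set.indicator_of_notMem (s := Set.Ioi k) hx _
      simp only [h3]
      rw [hf, smoothStep_eq_zero hkk1 (not_lt.1 hx)]
      simp
  have hcf : ∀ t, c t ^ 2 ≤ f t := fun t => by
    rcases le_total t k₁ with ht | ht
    · rw [hc, smoothStep_eq_zero hk1k ht]
      simpa using hf0 t
    · rw [hf, smoothStep_eq_one hkk1 ht]
      exact pow_le_one₀ (smoothStep_nonneg _ _ _) (smoothStep_le_one _ _ _)
  -- On the rising part t ≤ k', and c' is at most L/(k' - k₁) = 2L/(k' - k), so that c't ≤ 2LT.
  have hcf' : ∀ t, 0 ≤ t → (c' t * t) ^ 2 ≤ 4 * L ^ 2 * T ^ 2 * f t := fun t ht0 => by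
    rcases le_total t k₁ with ht | ht
    · rw [hc', smoothStepDeriv_eq_zero_of_le hk1k ht]
      have := hf0 t
      simp only [zero_mul, ne_eq, OfNat.ofNat_ne_zero, not_false_eq_true, zero_pow]
      positivity
    · rw [hf, smoothStep_eq_one hkk1 ht, mul_one]
      rcases le_total k' t with ht' | ht'
      · rw [hc', smoothStepDeriv_eq_zero_of_ge hk1k ht']
        simp only [zero_mul, ne_eq, OfNat.ofNat_ne_zero, not_false_eq_true, zero_pow]
        positivity
      · have e1 : (k' - k₁)⁻¹ * k' = 2 * T := by
          have e2 : k' - k₁ = (k' - k) / 2 := by rw [hk1]; ring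
          rw [e2, hT, inv_div]
          ring
        have e3 : c' t * t ≤ L * (2 * T) := by
          rw [← e1, hc', smoothStepDeriv, mul_assoc]
          have : 0 < (k' - k₁)⁻¹ := inv_pos.2 (by linarith)
          exact mul_le_mul (hL _) (by gcongr) (by positivity) hL0.le
        have e4 : 0 ≤ c' t * t := mul_nonneg (smoothStepDeriv_nonneg hk1k t) ht0
        calc (c' t * t) ^ 2 ≤ (L * (2 * T)) ^ 2 := pow_le_pow_left₀ e4 e3 2
          _ = _ := by ring
  have icut : ∀ j i, Integrable (fun x => cutGrad η c c' V N j i x ^ 2) μ := fun j i =>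
    (h.tendsto_cutGrad hcB hη' j i).memLp_lim.integrable_sq
  have hgrad : ∑ j, ∑ i, ∫ x, cutGrad η c c' V N j i x ^ 2 ∂μ ≤
      3 * (1 + (1 + 16 * L ^ 2) * (4 * Lam / lam)) * Cη * T ^ 2 / (s - s') ^ 2 *
        levelEnergy V x₀ s k := by
    have hT2 : 1 ≤ T ^ 2 := one_le_pow₀ hT1
    have e1 : ∑ j, ∑ i, ∫ x, cutGrad η c c' V N j i x ^ 2 ∂μ ≤
        ∫ x, (3 * (f (normSq V x) * gradSq η x * normSq V x) + 3 * ((1 + 16 * L ^ 2) * T ^ 2) *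
          (η x ^ 2 * f (normSq V x) * partSq N x)) ∂μ := by
      rw [Finset.sum_congr rfl fun j _ => (integral_finsetSum _ fun i _ => icut j i).symm,
        ← integral_finsetSum _ fun j _ => integrable_finsetSum _ fun i _ => icut j i]
      refine integral_mono (integrable_finsetSum _ fun j _ =>
        integrable_finsetSum _ fun i _ => icut j i)
        ((iG.const_mul _).add (iP.const_mul _)) fun x => (sum_cutGrad_sq_le _ _ _ _ _ _).trans ?_
      have hg0 := normSq_nonneg V x
      have hp0 := partSq_nonneg N x
      have hη0 := gradSq_nonneg η x
      have u1 : c (normSq V x) ^ 2 * gradSq η x * normSq V x ≤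
          f (normSq V x) * gradSq η x * normSq V x := by
        have := hcf (normSq V x)
        gcongr
      have u2 : c (normSq V x) ^ 2 + 4 * (c' (normSq V x) * normSq V x) ^ 2 ≤
          (1 + 16 * L ^ 2) * T ^ 2 * f (normSq V x) := by
        have v1 := hcf (normSq V x)
        have v2 := hcf' _ hg0
        have v3 := mul_le_mul_of_nonneg_right hT2 (hf0 (normSq V x))
        linarith
      have u3 : η x ^ 2 * (c (normSq V x) ^ 2 + 4 * (c' (normSq V x) * normSq V x) ^ 2) *
          partSq N x ≤ η x ^ 2 * ((1 + 16 * L ^ 2) * T ^ 2 * f (normSq V x)) * partSq N x := by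
        gcongr
      linarith
    refine e1.trans ?_
    rw [integral_add (iG.const_mul _) (iP.const_mul _), integral_const_mul, integral_const_mul]
    set IG := ∫ x, f (normSq V x) * gradSq η x * normSq V x ∂μ with hIG
    set Y := levelEnergy V x₀ s k with hY
    have hY0 : 0 ≤ Y := levelEnergy_nonneg _ _ _ _
    set Z := Cη / (s - s') ^ 2 * Y with hZ
    have hZ0 : 0 ≤ Z := by positivity
    have hq : 0 ≤ 4 * Lam / lam := by positivity
    have u1 : ∫ x, η x ^ 2 * f (normSq V x) * partSq N x ∂μ ≤ 4 * Lam / lam * Z :=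
      hcac.trans (mul_le_mul_of_nonneg_left hG hq)
    have u2 : 3 * ((1 + 16 * L ^ 2) * T ^ 2) * ∫ x, η x ^ 2 * f (normSq V x) * partSq N x ∂μ ≤
        3 * ((1 + 16 * L ^ 2) * T ^ 2) * (4 * Lam / lam * Z) := by gcongr
    have u3 : IG ≤ T ^ 2 * Z := hG.trans (le_mul_of_one_le_left hZ0 hT2)
    calc _ ≤ 3 * (T ^ 2 * Z) + 3 * ((1 + 16 * L ^ 2) * T ^ 2) * (4 * Lam / lam * Z) := by
          linarith
      _ = _ := by rw [hZ]; ring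
  have hsob : ∑ j, ∫ x in A, (η x * c (normSq V x) * V j x) ^ 2 ≤
      Cs * volume.real A ^ (2 / n : ℝ) * ∑ j, ∑ i, ∫ x, cutGrad η c c' V N j i x ^ 2 ∂μ := by
    rw [Finset.mul_sum]
    exact Finset.sum_le_sum fun j _ => h.sobolev_cut hCs hcB hη' hAs j
  have iV : ∀ j, Integrable (fun x => (η x * c (normSq V x) * V j x) ^ 2) μ := fun j => by
    have : (fun x => (η x * c (normSq V x) * V j x) ^ 2) =
        fun x => (η x * c (normSq V x)) ^ 2 * V j x ^ 2 := by
      ext x; ring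
    rw [this]
    refine integrable_bdd_mul (C := 1) (h.tendsto_flux j).memLp_lim.integrable_sq
      ((hη'.1.continuous.aestronglyMeasurable.mul
        (hcB.continuous.comp_aestronglyMeasurable hgm)).pow 2) fun x => ?_
    rw [abs_of_nonneg (sq_nonneg _)]
    refine pow_le_one₀ (mul_nonneg (hη01 x).1 (smoothStep_nonneg _ _ _))
      (mul_le_one₀ (hη01 x).2 (smoothStep_nonneg _ _ _) (smoothStep_le_one _ _ _))
  -- On the smaller ball above the level k' both cutoffs equal 1, and the cut-off field vanishes
  -- outside A.
  have hlow : levelEnergy V x₀ s' k' ≤ ∑ j, ∫ x in A, (η x * c (normSq V x) * V j x) ^ 2 := by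
    have e1 : ∀ j, ∫ x in A, (η x * c (normSq V x) * V j x) ^ 2 =
        ∫ x, (η x * c (normSq V x) * V j x) ^ 2 ∂μ := fun j => by
      refine (setIntegral_eq_of_subset_of_forall_sdiff_eq_zero measurableSet_ball hAs
        fun x hx => ?_).symm
      by_cases hxs : x ∈ Metric.ball x₀ s
      · have : ¬ k < normSq V x := fun hlt => hx.2 ⟨hxs, hlt⟩
        rw [hc, smoothStep_eq_zero hk1k (by linarith)]
        simp
      · rw [hη.eq_zero hxs]
        simp
    simp_rw [e1]
    rw [← integral_finsetSum _ fun j _ => iV j, levelEnergy]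
    have iS := integrable_finsetSum Finset.univ fun j (_ : j ∈ Finset.univ) => iV j
    refine le_trans ?_ (setIntegral_mono_set iS (ae_of_all _ fun x =>
      Finset.sum_nonneg fun _ _ => sq_nonneg _)
      (Metric.ball_subset_ball (hss.le.trans hsr)).eventuallyLE)
    refine setIntegral_mono_on (IntegrableOn.mono_set (hIs k') (Metric.ball_subset_ball hss.le))
      (IntegrableOn.mono_set iS (Metric.ball_subset_ball (hss.le.trans hsr)))
      measurableSet_ball fun x hx => ?_
    by_cases hlt : k' < normSq V x
    · have h3 : (Set.Ioi k').indicator id (normSq V x) = normSq V x :=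
        Set.indicator_of_mem (s := Set.Ioi k') hlt _
      rw [h3, hη1 x hx, hc, smoothStep_eq_one hk1k hlt.le, normSq]
      simp
    · have h3 : (Set.Ioi k').indicator id (normSq V x) = 0 :=
        Set.indicator_of_notMem (s := Set.Ioi k') hlt _
      rw [h3]
      exact Finset.sum_nonneg fun _ _ => sq_nonneg _
  have hvol : volume.real A ^ (2 / n : ℝ) ≤ (levelEnergy V x₀ s k / k) ^ (2 / n : ℝ) :=
    Real.rpow_le_rpow measureReal_nonneg (h.measure_level_le hsr hk) (by positivity)
  have hY0 : 0 ≤ levelEnergy V x₀ s k := levelEnergy_nonneg _ _ _ _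
  have hW0 : 0 ≤ ∑ j, ∑ i, ∫ x, cutGrad η c c' V N j i x ^ 2 ∂μ :=
    Finset.sum_nonneg fun _ _ => Finset.sum_nonneg fun _ _ => integral_nonneg fun _ => sq_nonneg _
  calc levelEnergy V x₀ s' k' ≤ _ := hlow.trans hsob
    _ ≤ Cs * (levelEnergy V x₀ s k / k) ^ (2 / n : ℝ) *
        (3 * (1 + (1 + 16 * L ^ 2) * (4 * Lam / lam)) * Cη * T ^ 2 / (s - s') ^ 2 *
        levelEnergy V x₀ s k) := by gcongr
    _ = _ := by ring

/-- If Y_j decays like q^j, then Y_j^α gains q^(αj), which exactly cancels the growth of the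
coefficient; the smallness of DY₀^α yields the next factor q. -/
theorem le_geometric_of_superlinear {Y : ℕ → ℝ} {D q α : ℝ} (hY : ∀ j, 0 ≤ Y j) (hD : 0 ≤ D)
    (hq : 0 < q) (hα : 0 < α)
    (hstep : ∀ j, Y (j + 1) ≤ D * ((q ^ α)⁻¹) ^ j * Y j ^ α * Y j) (h0 : D * Y 0 ^ α ≤ q) (j : ℕ) :
    Y j ≤ q ^ j * Y 0 := by
  induction j with
  | zero => simp
  | succ j ih =>
    have h1 : Y j ^ α ≤ (q ^ j * Y 0) ^ α := Real.rpow_le_rpow (hY j) ih hα.le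
    rw [Real.mul_rpow (by positivity) (hY 0), ← Real.rpow_natCast, ← Real.rpow_mul hq.le,
      mul_comm (j : ℝ), Real.rpow_mul hq.le, Real.rpow_natCast] at h1
    have hqa : 0 < q ^ α := Real.rpow_pos_of_pos hq α
    calc Y (j + 1) ≤ D * ((q ^ α)⁻¹) ^ j * Y j ^ α * Y j := hstep j
      _ ≤ D * ((q ^ α)⁻¹) ^ j * ((q ^ α) ^ j * Y 0 ^ α) * Y j := by
        have := hY j
        gcongr
      _ = D * Y 0 ^ α * Y j := by
        rw [inv_pow]
        field_simp
      _ ≤ q * (q ^ j * Y 0) := by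
        have := hY j
        gcongr
      _ = q ^ (j + 1) * Y 0 := by ring

/-- Local boundedness of the flux. -/
theorem exists_sup_bound_const (hn : 2 < n) {lam Lam : ℝ} (hlam : 0 < lam) (hLam : 0 ≤ Lam) :
    ∃ C : ℝ, 0 < C ∧ ∀ (x₀ : Euc n) (r : ℝ) (V p : Fin n → Euc n → ℝ)
      (N : Fin n → Fin n → Euc n → ℝ) (Vm pm : ℕ → Fin n → Euc n → ℝ) (b b' : ℕ → ℝ → ℝ)
      (m : ℕ → ℝ), IsApproximation x₀ r V p N Vm pm →
      IsDualFamily (Metric.ball x₀ r) V p lam Lam b b' m → ∀ s' : ℝ, 0 < s' → s' < r →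
        ∀ᵐ x ∂(volume.restrict (Metric.ball x₀ s')), normSq V x ≤
          C / (r - s') ^ n * ∫ x in Metric.ball x₀ r, normSq V x := by
  obtain ⟨C, hC0, hC⟩ := exists_levelEnergy_const hn hlam hLam
  have hn0 : (0 : ℝ) < n := by positivity
  set α : ℝ := 2 / n with hα
  have hα0 : 0 < α := by positivity
  -- Halving the radius increments and the level gaps costs a factor 4 each per step, since both
  -- enter squared; q is chosen with q^α = 1/16.
  set q : ℝ := (1 / 16 : ℝ) ^ (1 / α) with hq
  have hq0 : 0 < q := by positivity
  have hqα : (q ^ α)⁻¹ = 16 := by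
    rw [hq, ← Real.rpow_mul (by norm_num), one_div_mul_cancel hα0.ne', Real.rpow_one]
    norm_num
  have hq1 : q < 1 := Real.rpow_lt_one (by norm_num) (by norm_num) (by positivity)
  -- As αn = 2, the bound 2Y₀/K ≤ c₀dⁿ gives (64C/d²)(2Y₀/K)^α ≤ q, the smallness required to start
  -- the iteration.
  set c₀ : ℝ := (q / (64 * C)) ^ (1 / α) with hc₀
  have hc₀0 : 0 < c₀ := by positivity
  refine ⟨2 / c₀, by positivity, ?_⟩
  intro x₀ r V p N Vm pm b b' m h hD s' hs' hs'r
  set d := r - s' with hd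
  have hd0 : 0 < d := sub_pos.2 hs'r
  set I := ∫ x in Metric.ball x₀ r, normSq V x with hI
  have hI0 : 0 ≤ I := integral_nonneg fun x => normSq_nonneg V x
  -- For each K above the target bound, radii decrease to s' and levels increase from K/2 to K; the
  -- level energies tend to zero, so |V|² ≤ K almost everywhere.
  have key : ∀ K, 2 / c₀ / d ^ n * I < K →
      ∀ᵐ x ∂(volume.restrict (Metric.ball x₀ s')), normSq V x ≤ K := fun K hK => by
    have hK0 : 0 < K := lt_of_le_of_lt (by positivity) hK
    set ρ : ℕ → ℝ := fun j => s' + d * (1 / 2) ^ j with hρ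
    set κ : ℕ → ℝ := fun j => K * (1 - (1 / 2) ^ (j + 1)) with hκ
    have hhalf : ∀ j : ℕ, (0 : ℝ) < (1 / 2) ^ j ∧ ((1 : ℝ) / 2) ^ j ≤ 1 := fun j =>
      ⟨by positivity, pow_le_one₀ (by norm_num) (by norm_num)⟩
    have hρr : ∀ j, ρ j ≤ r := fun j => by
      have := mul_le_mul_of_nonneg_left (hhalf j).2 hd0.le
      simp only [hρ]
      linarith
    have hρs : ∀ j, s' ≤ ρ j := fun j => by
      have := mul_pos hd0 (hhalf j).1
      simp only [hρ]
      linarith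
    have hκK : ∀ j, κ j ≤ K := fun j =>
      mul_le_of_le_one_right hK0.le (by linarith [(hhalf (j + 1)).1])
    have hκ2 : ∀ j, K / 2 ≤ κ j := fun j => by
      have : K * (1 / 2) ^ (j + 1) ≤ K * (1 / 2) := by
        rw [pow_succ]
        exact mul_le_mul_of_nonneg_left (by linarith [(hhalf j).2]) hK0.le
      simp only [hκ]
      linarith
    set Y : ℕ → ℝ := fun j => levelEnergy V x₀ (ρ j) (κ j) with hY
    have hY0 : ∀ j, 0 ≤ Y j := fun j => levelEnergy_nonneg _ _ _ _
    have hYI : Y 0 ≤ I := by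
      have e : ρ 0 = r := by simp [hρ, hd]
      simp only [hY, e]
      exact integral_mono (h.integrable_indicator_Ioi _) h.integrable_normSq fun x =>
        indicator_Ioi_le (normSq_nonneg V x)
    set D : ℝ := 64 * C / d ^ 2 * (2 / K) ^ α with hDdef
    have hstep : ∀ j, Y (j + 1) ≤ D * ((q ^ α)⁻¹) ^ j * Y j ^ α * Y j := fun j => by
      have hp := (hhalf j).1
      have hρlt : ρ (j + 1) < ρ j := by
        simp only [hρ, pow_succ]
        nlinarith [mul_pos hd0 hp]
      have hκlt : κ j < κ (j + 1) := by
        simp only [hκ, pow_succ]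
        nlinarith [mul_pos hK0 hp]
      have h1 := hC x₀ r V p N Vm pm b b' m h hD (ρ (j + 1)) (ρ j) (κ j) (κ (j + 1))
        (hs'.trans_le (hρs _)) hρlt (hρr j) (by linarith [hκ2 j]) hκlt
      have hY0j := hY0 j
      have e1 : (κ (j + 1) / (κ (j + 1) - κ j)) ^ 2 ≤ 16 * 4 ^ j := by
        have e2 : κ (j + 1) - κ j = K * (1 / 2) ^ j / 4 := by
          simp only [hκ]; ring
        have e3 : κ (j + 1) / (κ (j + 1) - κ j) ≤ 4 * 2 ^ j := by
          rw [e2, div_le_iff₀ (by positivity)]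
          have : (4 * 2 ^ j) * (K * (1 / 2) ^ j / 4) = K := by
            rw [one_div, inv_pow]
            field_simp
          rw [this]
          exact hκK _
        have e4 : 0 ≤ κ (j + 1) / (κ (j + 1) - κ j) :=
          div_nonneg (by linarith [hκ2 (j + 1)]) (by linarith)
        calc _ ≤ (4 * 2 ^ j : ℝ) ^ 2 := pow_le_pow_left₀ e4 e3 2
          _ = _ := by
            rw [mul_pow, ← pow_mul, mul_comm j, pow_mul]
            norm_num
      have e5 : (ρ j - ρ (j + 1)) ^ 2 = d ^ 2 / (4 * 4 ^ j) := by
        have : ρ j - ρ (j + 1) = d / (2 * 2 ^ j) := by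
          simp only [hρ, one_div, inv_pow, pow_succ]
          field_simp
          ring
        rw [this, div_pow, mul_pow, ← pow_mul, mul_comm j, pow_mul]
        norm_num
      have e6 : (Y j / κ j) ^ α ≤ (2 / K) ^ α * Y j ^ α := by
        rw [← Real.mul_rpow (by positivity) hY0j]
        refine Real.rpow_le_rpow (div_nonneg hY0j (by linarith [hκ2 j])) ?_ hα0.le
        rw [div_le_iff₀ (by linarith [hκ2 j])]
        have := mul_le_mul_of_nonneg_left (hκ2 j) (show 0 ≤ 2 / K * Y j by positivity)
        calc Y j = 2 / K * Y j * (K / 2) := by field_simp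
          _ ≤ _ := this
      have hYα : 0 ≤ Y j ^ α := by positivity
      calc Y (j + 1) ≤ _ := h1
        _ ≤ C * (16 * 4 ^ j) / (d ^ 2 / (4 * 4 ^ j)) * ((2 / K) ^ α * Y j ^ α) * Y j := by
          rw [e5]
          have : 0 ≤ (levelEnergy V x₀ (ρ j) (κ j) / κ j) ^ α :=
            Real.rpow_nonneg (div_nonneg hY0j (by linarith [hκ2 j])) _
          gcongr
        _ = D * 16 ^ j * Y j ^ α * Y j := by
          have : (16 : ℝ) ^ j = 4 ^ j * 4 ^ j := by rw [← mul_pow]; norm_num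
          rw [hDdef, this]
          field_simp
          ring
        _ = _ := by rw [hqα]
    have hD0 : 0 ≤ D := by positivity
    have hinit : D * Y 0 ^ α ≤ q := by
      have e1 : 2 / K * Y 0 ≤ c₀ * d ^ n := by
        rw [div_mul_eq_mul_div, div_le_iff₀ hK0]
        have : 2 / c₀ / d ^ n * I = 2 * I / (c₀ * d ^ n) := by field_simp
        rw [this, div_lt_iff₀ (by positivity)] at hK
        linarith
      have e2 : (2 / K) ^ α * Y 0 ^ α ≤ q / (64 * C) * d ^ 2 := by
        rw [← Real.mul_rpow (by positivity) (hY0 0)]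
        refine (Real.rpow_le_rpow (mul_nonneg (by positivity) (hY0 0)) e1 hα0.le).trans_eq ?_
        rw [Real.mul_rpow hc₀0.le (by positivity), hc₀, ← Real.rpow_mul (by positivity),
          one_div_mul_cancel hα0.ne', Real.rpow_one, ← Real.rpow_natCast d n,
          ← Real.rpow_mul hd0.le, hα, mul_div_cancel₀ _ hn0.ne']
        norm_cast
      calc D * Y 0 ^ α = 64 * C / d ^ 2 * ((2 / K) ^ α * Y 0 ^ α) := by rw [hDdef]; ring
        _ ≤ 64 * C / d ^ 2 * (q / (64 * C) * d ^ 2) := by gcongr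
        _ = q := by field_simp
    have hgeo := le_geometric_of_superlinear hY0 hD0 hq0 hα0 hstep hinit
    have hlim : Tendsto (fun j => q ^ j * Y 0) atTop (𝓝 0) := by
      simpa using (tendsto_pow_atTop_nhds_zero_of_lt_one hq0.le hq1).mul_const (Y 0)
    have hz : levelEnergy V x₀ s' K ≤ 0 := ge_of_tendsto' hlim fun j =>
      (h.levelEnergy_mono (hρs j) (hρr j) (hκK j)).trans (hgeo j)
    have hz' := (integral_eq_zero_iff_of_nonneg (fun x => indicator_Ioi_nonneg (normSq_nonneg V x))
      (IntegrableOn.mono_set (h.integrable_indicator_Ioi K)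
        (Metric.ball_subset_ball hs'r.le))).1 (hz.antisymm (levelEnergy_nonneg _ _ _ _))
    filter_upwards [hz'] with x hx
    by_contra hlt
    rw [not_le] at hlt
    have h3 : (Set.Ioi K).indicator id (normSq V x) = normSq V x :=
      Set.indicator_of_mem (s := Set.Ioi K) hlt _
    rw [h3, Pi.zero_apply] at hx
    linarith
  have hall := ae_all_iff.2 fun j : ℕ => key (2 / c₀ / d ^ n * I + 1 / (j + 1))
    (lt_add_of_pos_right _ (by positivity))
  filter_upwards [hall] with x hx
  refine ge_of_tendsto' (x := atTop) ?_ hx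
  simpa using tendsto_one_div_add_atTop_nhds_zero_nat.const_add (2 / c₀ / d ^ n * I)

end CompressibleFlow

end

/-! ### From the weak solution to a monotone flow with a dual family. -/

noncomputable section

namespace CompressibleFlow

variable {n : ℕ}

theorem IsTestFunction.isH10 {Ω : Set (Euc n)} {ψ : Euc n → ℝ} (h : IsTestFunction Ω ψ) :
    IsH10 Ω ψ (gradient ψ) := by
  have hc : Continuous (gradient ψ) :=
    (InnerProductSpace.toDual ℝ (Euc n)).symm.continuous.comp
      (h.1.continuous_fderiv (by norm_num))
  have hs : HasCompactSupport (gradient ψ) :=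
    (h.2.1.fderiv ℝ).comp_left (map_zero (InnerProductSpace.toDual ℝ (Euc n)).symm)
  exact ⟨(h.1.continuous.memLp_of_hasCompactSupport h.2.1).restrict _,
    (hc.memLp_of_hasCompactSupport hs).restrict _, fun _ => ψ, fun _ => h, by simp, by simp⟩

theorem sum_sq_eq_norm_sq (v : Euc n) : ∑ j, v j ^ 2 = ‖v‖ ^ 2 := by
  rw [EuclideanSpace.norm_sq_eq]
  simp_rw [Real.norm_eq_abs, sq_abs]

theorem sum_mul_eq_inner (v w : Euc n) : ∑ j, v j * w j = inner ℝ v w := by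
  rw [PiLp.inner_apply]
  exact Finset.sum_congr rfl fun j _ => by simp [mul_comm]

theorem measurableSet_subsonicRange (Qcrit : EReal) : MeasurableSet (subsonicRange Qcrit) :=
  (measurableSet_Ici (a := (0 : ℝ))).inter
    (measurable_coe_real_ereal (measurableSet_Iio (a := Qcrit)))

/-- Monotonicity of the map sending a flux to the corresponding gradient. -/
theorem IsSubsonicDensity.inner_flux_sub_ge {ρ : ℝ → ℝ} {Qcrit : EReal}
    (hρ : IsSubsonicDensity ρ Qcrit) (hQ : 0 < Qcrit)
    (hρ' : ∀ s ∈ subsonicRange Qcrit, derivWithin ρ (subsonicRange Qcrit) s ≤ 0)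
    {v w : Euc n} (hv : ‖v‖ ^ 2 ∈ subsonicRange Qcrit) (hw : ‖w‖ ^ 2 ∈ subsonicRange Qcrit) :
    (ρ 0)⁻¹ * ‖ρ (‖v‖ ^ 2) • v - ρ (‖w‖ ^ 2) • w‖ ^ 2 ≤
      inner ℝ (ρ (‖v‖ ^ 2) • v - ρ (‖w‖ ^ 2) • w) (v - w) := by
  -- With ‖v‖ ≤ ‖w‖ both monotonicities become usable: ρ at v is at least ρ at w, while the flux at
  -- v is no longer than the flux at w.
  wlog hvw : ‖v‖ ≤ ‖w‖ generalizing v w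
  · have := this hw hv (le_of_not_ge hvw)
    rwa [norm_sub_rev, ← neg_sub v w, ← neg_sub (ρ (‖v‖ ^ 2) • v), inner_neg_neg] at this
  have h0 : (0 : ℝ) ∈ subsonicRange Qcrit := subsonicRange_mem_of_le hv le_rfl hv.1
  have hsq : ‖v‖ ^ 2 ≤ ‖w‖ ^ 2 := pow_le_pow_left₀ (norm_nonneg _) hvw 2
  have hanti := hρ.antitoneOn hρ'
  have hmono := (hρ.strictMonoOn hQ).monotoneOn hv hw hsq
  have h1 := hanti hv hw hsq
  have h2 := hanti h0 hv hv.1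
  set a := ρ (‖v‖ ^ 2) with ha
  set c := ρ (‖w‖ ^ 2) with hc
  have ha0 : 0 < a := hρ.pos _ hv
  have hc0 : 0 < c := hρ.pos _ hw
  have hr0 : 0 < ρ 0 := hρ.pos _ h0
  have hnorm : a * ‖v‖ ≤ c * ‖w‖ := by
    refine le_of_sq_le_sq ?_ (by positivity)
    calc (a * ‖v‖) ^ 2 = ‖v‖ ^ 2 * a ^ 2 := by ring
      _ ≤ ‖w‖ ^ 2 * c ^ 2 := hmono
      _ = _ := by ring
  have hcs : inner ℝ v w ≤ ‖v‖ * ‖w‖ := real_inner_le_norm v w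
  have e1 : ‖a • v - c • w‖ ^ 2 = (a * ‖v‖) ^ 2 - 2 * (a * c * inner ℝ v w) + (c * ‖w‖) ^ 2 := by
    rw [norm_sub_sq_real, norm_smul, norm_smul, real_inner_smul_left, real_inner_smul_right,
      Real.norm_of_nonneg ha0.le, Real.norm_of_nonneg hc0.le]
    ring
  have e2 : inner ℝ (a • v - c • w) (v - w) =
      a * ‖v‖ ^ 2 - (a + c) * inner ℝ v w + c * ‖w‖ ^ 2 := by
    rw [inner_sub_left, inner_sub_right, inner_sub_right, real_inner_smul_left,
      real_inner_smul_left, real_inner_smul_left, real_inner_smul_left,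
      real_inner_self_eq_norm_sq, real_inner_self_eq_norm_sq, real_inner_comm v w]
    ring
  rw [e1, e2, inv_mul_le_iff₀ hr0]
  -- After multiplication by ρ(0), the right side minus the left is affine in ⟨v, w⟩ with slope
  -- -(ρ(0)(a + c) - 2ac) ≤ 0. The worst case is ⟨v, w⟩ = ‖v‖‖w‖, where it factors as the product in
  -- `h5`.
  have h3 : 0 ≤ (ρ 0 - a) * (a * c) * (‖v‖ * ‖w‖ - inner ℝ v w) :=
    mul_nonneg (mul_nonneg (by linarith) (by positivity)) (by linarith)
  have h4 : 0 ≤ (ρ 0 * (a + c) - 2 * a * c) := by nlinarith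
  have h5 : 0 ≤ (c * ‖w‖ - a * ‖v‖) * ((ρ 0 - c) * ‖w‖ - (ρ 0 - a) * ‖v‖) := by
    refine mul_nonneg (by linarith) ?_
    have := mul_le_mul (show ρ 0 - a ≤ ρ 0 - c by linarith) hvw (norm_nonneg _) (by linarith)
    linarith
  have h6 := mul_le_mul_of_nonneg_left hcs h4
  nlinarith

section Extension

/-- The gradient, extended by zero. -/
def gradExt (Ω : Set (Euc n)) (du : Euc n → Euc n) : Euc n → Euc n := Ω.indicator du

/-- The flux, extended by zero. -/
def fluxExt (ρ : ℝ → ℝ) (Qcrit : EReal) (Ω : Set (Euc n)) (du : Euc n → Euc n) (x : Euc n) :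
    Euc n :=
  (subsonicRange Qcrit).indicator ρ (‖gradExt Ω du x‖ ^ 2) • gradExt Ω du x

variable {Ω : Set (Euc n)} {Qcrit : EReal} {ρ : ℝ → ℝ} {u : Euc n → ℝ} {du : Euc n → Euc n}

theorem fluxExt_eq {x : Euc n} (hx : ‖gradExt Ω du x‖ ^ 2 ∈ subsonicRange Qcrit) :
    fluxExt ρ Qcrit Ω du x = ρ (‖gradExt Ω du x‖ ^ 2) • gradExt Ω du x := by
  rw [fluxExt, Set.indicator_of_mem hx]

theorem ae_gradExt_mem (hΩ : IsOpen Ω) (hQ : 0 < Qcrit)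
    (hQr : ∀ᵐ x ∂(volume.restrict Ω), ‖du x‖ ^ 2 ∈ subsonicRange Qcrit) :
    ∀ᵐ x, ‖gradExt Ω du x‖ ^ 2 ∈ subsonicRange Qcrit := by
  filter_upwards [(ae_restrict_iff' hΩ.measurableSet).1 hQr] with x hx
  by_cases h : x ∈ Ω
  · rw [gradExt, Set.indicator_of_mem h]
    exact hx h
  · rw [gradExt, Set.indicator_of_notMem h]
    simpa [subsonicRange] using hQ

variable {κ₀ : ℝ}

theorem mul_le_energyDensity (hρ : IsSubsonicDensity ρ Qcrit)
    (hκ : ∀ s ∈ subsonicRange Qcrit, κ₀ ≤ ρ s ∧ ρ s ≤ ρ 0) {x : Euc n}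
    (hx : ‖du x‖ ^ 2 ∈ subsonicRange Qcrit) : κ₀ * ‖du x‖ ^ 2 ≤ energyDensity ρ du x := by
  have hsub : Set.Icc 0 (‖du x‖ ^ 2) ⊆ subsonicRange Qcrit := fun s hs =>
    subsonicRange_mem_of_le hx hs.1 hs.2
  have h1 := intervalIntegral.integral_mono_on (μ := volume) (f := fun _ => κ₀) (g := ρ)
    (sq_nonneg ‖du x‖) intervalIntegrable_const
    ((hρ.continuousOn.mono hsub).intervalIntegrable_of_Icc (sq_nonneg _))
    fun s hs => (hκ s (hsub hs)).1
  rw [intervalIntegral.integral_const, sub_zero, smul_eq_mul, mul_comm] at h1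
  exact h1

theorem energyDensity_nonneg (hρ : IsSubsonicDensity ρ Qcrit) {x : Euc n}
    (hx : ‖du x‖ ^ 2 ∈ subsonicRange Qcrit) : 0 ≤ energyDensity ρ du x :=
  intervalIntegral.integral_nonneg (sq_nonneg _) fun s hs =>
    (hρ.pos s (subsonicRange_mem_of_le hx hs.1 hs.2)).le

theorem memLp_gradExt (hΩ : IsOpen Ω) (hρ : IsSubsonicDensity ρ Qcrit) (hκ₀ : 0 < κ₀)
    (hκ : ∀ s ∈ subsonicRange Qcrit, κ₀ ≤ ρ s ∧ ρ s ≤ ρ 0) (hsol : IsWeakSolution ρ Ω u du)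
    (hQr : ∀ᵐ x ∂(volume.restrict Ω), ‖du x‖ ^ 2 ∈ subsonicRange Qcrit) :
    MemLp (gradExt Ω du) 2 volume := by
  have hm : AEStronglyMeasurable du (volume.restrict Ω) :=
    hsol.hasWeakGradient.locInt_grad.aestronglyMeasurable
  rw [gradExt, memLp_indicator_iff_restrict hΩ.measurableSet, memLp_two_iff_integrable_sq_norm hm]
  refine (hsol.finiteEnergy.const_mul κ₀⁻¹).mono' (hm.norm.pow 2) ?_
  filter_upwards [hQr] with x hx
  rw [Real.norm_of_nonneg (sq_nonneg _), le_inv_mul_iff₀ hκ₀]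
  exact mul_le_energyDensity hρ hκ hx

theorem norm_fluxExt_le (hρ : IsSubsonicDensity ρ Qcrit) (hQ : 0 < Qcrit)
    (hκ : ∀ s ∈ subsonicRange Qcrit, κ₀ ≤ ρ s ∧ ρ s ≤ ρ 0) (x : Euc n) :
    ‖fluxExt ρ Qcrit Ω du x‖ ≤ ρ 0 * ‖gradExt Ω du x‖ := by
  rw [fluxExt, norm_smul]
  refine mul_le_mul_of_nonneg_right ?_ (norm_nonneg _)
  have h0 : 0 < ρ 0 := hρ.pos 0 ⟨le_rfl, by exact_mod_cast hQ⟩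
  by_cases hx : ‖gradExt Ω du x‖ ^ 2 ∈ subsonicRange Qcrit
  · rw [Set.indicator_of_mem hx, Real.norm_of_nonneg (hρ.pos _ hx).le]
    exact (hκ _ hx).2
  · rw [Set.indicator_of_notMem hx, norm_zero]
    exact h0.le

theorem memLp_fluxExt (hΩ : IsOpen Ω) (hρ : IsSubsonicDensity ρ Qcrit) (hQ : 0 < Qcrit)
    (hκ₀ : 0 < κ₀)
    (hκ : ∀ s ∈ subsonicRange Qcrit, κ₀ ≤ ρ s ∧ ρ s ≤ ρ 0) (hsol : IsWeakSolution ρ Ω u du)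
    (hQr : ∀ᵐ x ∂(volume.restrict Ω), ‖du x‖ ^ 2 ∈ subsonicRange Qcrit) :
    MemLp (fluxExt ρ Qcrit Ω du) 2 volume := by
  have hp := memLp_gradExt hΩ hρ hκ₀ hκ hsol hQr
  -- Nothing is known about ρ off the subsonic range; cutting it to zero there makes it Borel.
  have hmeas : Measurable ((subsonicRange Qcrit).indicator ρ) := by
    classical
    rw [← Set.piecewise_eq_indicator]
    exact hρ.continuousOn.measurable_piecewise continuousOn_const (measurableSet_subsonicRange _)
  refine hp.of_le_mul (c := ρ 0) ?_ (ae_of_all _ fun x => norm_fluxExt_le hρ hQ hκ x)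
  exact ((hmeas.comp_aemeasurable (hp.1.norm.pow 2).aemeasurable).aestronglyMeasurable).smul hp.1

/-- Extension by zero makes flux and gradient globally square integrable, and u is cut to the closed
ball to be locally integrable everywhere. Test functions of the ball do not see these changes; the
cocoercivity is `IsSubsonicDensity.inner_flux_sub_ge`. -/
theorem isMonotoneFlow_fluxExt (hΩ : IsOpen Ω) (hρ : IsSubsonicDensity ρ Qcrit) (hQ : 0 < Qcrit)
    (hκ₀ : 0 < κ₀)
    (hρ' : ∀ s ∈ subsonicRange Qcrit, derivWithin ρ (subsonicRange Qcrit) s ≤ 0)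
    (hκ : ∀ s ∈ subsonicRange Qcrit, κ₀ ≤ ρ s ∧ ρ s ≤ ρ 0) (hsol : IsWeakSolution ρ Ω u du)
    (hQr : ∀ᵐ x ∂(volume.restrict Ω), ‖du x‖ ^ 2 ∈ subsonicRange Qcrit)
    {x₀ : Euc n} {R : ℝ} (hR : Metric.closedBall x₀ R ⊆ Ω) :
    IsMonotoneFlow x₀ R (ρ 0)⁻¹ ((Metric.closedBall x₀ R).indicator u)
      (fun j x => fluxExt ρ Qcrit Ω du x j) (fun j x => gradExt Ω du x j) := by
  have hp := memLp_gradExt hΩ hρ hκ₀ hκ hsol hQr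
  have hV := memLp_fluxExt hΩ hρ hQ hκ₀ hκ hsol hQr
  have hae := ae_gradExt_mem (Ω := Ω) (du := du) hΩ hQ hQr
  have htest : ∀ ζ, IsTestFunction (Metric.ball x₀ R) ζ → IsTestFunction Ω ζ := fun ζ hζ =>
    ⟨hζ.1, hζ.2.1, hζ.2.2.trans (Metric.ball_subset_closedBall.trans hR)⟩
  refine ⟨hV.eval_piLp, hp.eval_piLp, ?_, fun ζ hζ => ?_, fun i ζ hζ => ?_,
    {x | ‖gradExt Ω du x‖ ^ 2 ∈ subsonicRange Qcrit}, ?_, fun x hx y hy => ?_⟩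
  · refine Integrable.locallyIntegrable ?_
    rw [integrable_indicator_iff measurableSet_closedBall]
    exact hsol.hasWeakGradient.locInt.integrableOn_compact_subset hR (isCompact_closedBall _ _)
  · have h1 := hsol.weak_eq ζ _ (htest ζ hζ).isH10
    rw [← integral_finsetSum _ fun i _ =>
      integrable_mul_of_memLp (hV.eval_piLp i) (hζ.memLp_fderiv _)]
    rw [← integral_indicator hΩ.measurableSet] at h1
    rw [← h1]
    refine integral_congr_ae ?_
    filter_upwards [hae] with x hx
    rw [← clm_apply_eq_sum, fluxExt_eq hx]
    by_cases h : x ∈ Ω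
    · rw [Set.indicator_of_mem h, gradExt, Set.indicator_of_mem h, real_inner_comm,
        inner_gradient_left]
    · rw [Set.indicator_of_notMem h, gradExt, Set.indicator_of_notMem h, smul_zero, map_zero]
  · have h1 := hsol.hasWeakGradient.integral_eq ζ (htest ζ hζ) (basisVec i)
    rw [← integral_indicator hΩ.measurableSet, ← integral_indicator hΩ.measurableSet] at h1
    refine (integral_congr_ae (ae_of_all _ fun x => ?_)).trans
      (h1.trans (congrArg Neg.neg (integral_congr_ae (ae_of_all _ fun x => ?_))))
    · by_cases h : x ∈ Metric.closedBall x₀ R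
      · rw [Set.indicator_of_mem h, Set.indicator_of_mem (hR h)]
      · rw [hζ.fderiv_eq_zero fun h' => h (Metric.ball_subset_closedBall h'), zero_apply, mul_zero]
        by_cases h' : x ∈ Ω
        · rw [Set.indicator_of_mem h', hζ.fderiv_eq_zero fun h' => h
            (Metric.ball_subset_closedBall h'), zero_apply, mul_zero]
        · rw [Set.indicator_of_notMem h']
    · dsimp only
      by_cases h : x ∈ Ω
      · rw [Set.indicator_of_mem h, gradExt, Set.indicator_of_mem h,
          EuclideanSpace.inner_single_right]
        simp
      · rw [Set.indicator_of_notMem h, gradExt, Set.indicator_of_notMem h]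
        simp
  · filter_upwards [hae] with x hx _ using hx
  · have h1 := hρ.inner_flux_sub_ge hQ hρ' hx hy
    rw [← fluxExt_eq (ρ := ρ) hx, ← fluxExt_eq (ρ := ρ) hy] at h1
    rw [← sum_sq_eq_norm_sq, ← sum_mul_eq_inner] at h1
    simpa using h1

theorem normSq_fluxExt (x : Euc n) :
    normSq (fun j x => fluxExt ρ Qcrit Ω du x j) x = ‖fluxExt ρ Qcrit Ω du x‖ ^ 2 :=
  sum_sq_eq_norm_sq _

theorem normSq_fluxExt_eq {x : Euc n} (hx : ‖gradExt Ω du x‖ ^ 2 ∈ subsonicRange Qcrit) :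
    normSq (fun j x => fluxExt ρ Qcrit Ω du x j) x =
      ‖gradExt Ω du x‖ ^ 2 * ρ (‖gradExt Ω du x‖ ^ 2) ^ 2 := by
  rw [normSq_fluxExt, fluxExt_eq hx, norm_smul, mul_pow, Real.norm_eq_abs, sq_abs, mul_comm]

theorem exists_seq_subsonicRange (hQ : 0 < Qcrit) : ∃ M : ℕ → ℝ,
    (∀ l, M l ∈ subsonicRange Qcrit) ∧ ∀ s ∈ subsonicRange Qcrit, ∀ᶠ l in atTop, s < M l := by
  obtain ⟨e, -, he, hlim⟩ := exists_seq_strictMono_tendsto' hQ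
  have hcoe : ∀ l, ((e l).toReal : EReal) = e l := fun l =>
    EReal.coe_toReal ((he l).2.trans_le le_top).ne (bot_le.trans_lt (he l).1).ne'
  refine ⟨fun l => (e l).toReal, fun l => ⟨?_, ?_⟩, fun s hs => ?_⟩
  · exact EReal.toReal_nonneg (he l).1.le
  · rw [hcoe]
    exact (he l).2
  · filter_upwards [hlim.eventually_const_lt hs.2] with l hl
    rw [← hcoe l] at hl
    exact_mod_cast hl

/-- For levels M_l increasing to the critical value the dual density is exact up to Q = M_l, that is
up to |V|² = M_lρ(M_l)²; the bounds do not depend on l. -/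
theorem exists_isDualFamily (hΩ : IsOpen Ω) (hρ : IsSubsonicDensity ρ Qcrit) (hQ : 0 < Qcrit)
    (hκ₀ : 0 < κ₀)
    (hρ' : ∀ s ∈ subsonicRange Qcrit, derivWithin ρ (subsonicRange Qcrit) s ≤ 0)
    (hκ : ∀ s ∈ subsonicRange Qcrit, κ₀ ≤ ρ s ∧ ρ s ≤ ρ 0)
    (hQr : ∀ᵐ x ∂(volume.restrict Ω), ‖du x‖ ^ 2 ∈ subsonicRange Qcrit) (U : Set (Euc n)) :
    ∃ b b' m, IsDualFamily U (fun j x => fluxExt ρ Qcrit Ω du x j) (fun j x => gradExt Ω du x j)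
      (ρ 0)⁻¹ (2 * κ₀⁻¹) b b' m := by
  obtain ⟨M, hM, hMlim⟩ := exists_seq_subsonicRange hQ
  choose b b' h1 h2 h3 h4 h5 h6 using fun l => hρ.exists_dual hQ hκ₀ hρ' hκ (hM l)
  have h0 : 0 < (ρ 0)⁻¹ := inv_pos.2 (hρ.pos 0 ⟨le_rfl, by exact_mod_cast hQ⟩)
  have hae := ae_restrict_of_ae (s := U) (ae_gradExt_mem (Ω := Ω) (du := du) hΩ hQ hQr)
  have hmono := hρ.strictMonoOn hQ
  refine ⟨b, b', fun l => M l * ρ (M l) ^ 2, fun l => ?_, h3, h5, fun l => ?_, ?_⟩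
  · obtain ⟨T, hT⟩ := h4 l
    refine BddC1.of_deriv_eq_zero (h1 l) (h2 l) hT (C := 2 * κ₀⁻¹) fun t ht => ?_
    rw [abs_of_nonneg (h0.le.trans (h5 l t ht).1)]
    exact (h5 l t ht).2
  · filter_upwards [hae] with x hx hle j
    rw [normSq_fluxExt_eq hx] at hle ⊢
    have hQM := (hmono.le_iff_le hx (hM l)).1 hle
    rw [h6 l _ hx.1 hQM, fluxExt_eq hx, PiLp.smul_apply, smul_eq_mul,
      inv_mul_cancel_left₀ (hρ.pos _ hx).ne']
  · filter_upwards [hae] with x hx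
    filter_upwards [hMlim _ hx] with l hl
    rw [normSq_fluxExt_eq hx]
    exact hmono hx (hM l) hl

end Extension

end CompressibleFlow

end

/-! ### Conclusion and the constant. -/

theorem theorem1 (n : ℕ) (hn : 2 < n) (δ κ₀ ρ₀ : ℝ) (hδ₀ : 0 < δ) (hδ₁ : δ < 1)
    (hκ₀ : 0 < κ₀) :
    ∃ κ₁ : ℝ, 0 < κ₁ ∧
      ∀ (Ω : Set (EuclideanSpace ℝ (Fin n))), IsOpen Ω → IsConnected Ω →
        Bornology.IsBounded Ω → IsTypeA Ω →
      ∀ (Qcrit : EReal), 0 < Qcrit →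
      ∀ (ρ : ℝ → ℝ), IsSubsonicDensity ρ Qcrit → ρ 0 = ρ₀ →
        (∀ s ∈ subsonicRange Qcrit, derivWithin ρ (subsonicRange Qcrit) s ≤ 0) →
        (∀ s ∈ subsonicRange Qcrit, κ₀ ≤ ρ s ∧ ρ s ≤ ρ 0) →
      ∀ (u : EuclideanSpace ℝ (Fin n) → ℝ)
        (du : EuclideanSpace ℝ (Fin n) → EuclideanSpace ℝ (Fin n)),
        IsWeakSolution ρ Ω u du →
        (∀ᵐ x ∂(volume.restrict Ω), ‖du x‖ ^ 2 ∈ subsonicRange Qcrit) →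
      ∀ (x₀ : EuclideanSpace ℝ (Fin n)) (R : ℝ), 0 < R → Metric.ball x₀ R ⊆ Ω →
        ∀ᵐ x ∂(volume.restrict (Metric.ball x₀ (R * (1 - δ)))),
          ‖du x‖ ^ 2 ≤ κ₁ * (R ^ n)⁻¹ * energy ρ du (Metric.ball x₀ R) := by
  -- If κ₀ > ρ₀ no density is admissible, and any constant will do.
  by_cases hκρ : κ₀ ≤ ρ₀
  swap
  · refine ⟨1, one_pos, fun Ω _ _ _ _ Qcrit hQ ρ _ h0 _ hκ => absurd ?_ hκρ⟩
    exact h0 ▸ (hκ 0 ⟨le_rfl, by exact_mod_cast hQ⟩).1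
  have hρ₀ : 0 < ρ₀ := hκ₀.trans_le hκρ
  obtain ⟨C, hC0, hC⟩ := exists_sup_bound_const hn (inv_pos.2 hρ₀)
    (show 0 ≤ 2 * κ₀⁻¹ by positivity)
  -- A factor ρ₀²/κ₀ comes from |V|² ≤ ρ₀²Q together with κ₀Q ≤ energy density, a factor 1/κ₀² from
  -- κ₀²Q ≤ |V|², and (Rδ/2)ⁿ from the gap between the radii.
  refine ⟨C * ρ₀ ^ 2 / (κ₀ ^ 3 * (δ / 2) ^ n), by positivity, ?_⟩
  intro Ω hΩ _ _ _ Qcrit hQ ρ hρ hρ0 hρ' hκ u du hsol hQr x₀ R hR hball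
  -- Three nested radii: the flow lives on R(1 - δ/4), whose closed ball lies in Ω, the
  -- approximations on R(1 - δ/2), the bound on R(1 - δ).
  have hflow := isMonotoneFlow_fluxExt hΩ hρ hQ hκ₀ hρ' hκ hsol hQr (x₀ := x₀)
    (R := R * (1 - δ / 4)) ((Metric.closedBall_subset_ball (by nlinarith)).trans hball)
  rw [hρ0] at hflow
  obtain ⟨N, Vm, pm, happ⟩ := hflow.exists_approximation (r := R * (1 - δ / 2)) (inv_pos.2 hρ₀)
    (mul_pos hR (by linarith)) (by nlinarith)
  obtain ⟨b, b', m, hdual⟩ := exists_isDualFamily hΩ hρ hQ hκ₀ hρ' hκ hQr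
    (Metric.ball x₀ (R * (1 - δ / 2)))
  rw [hρ0] at hdual
  have hsup := hC _ _ _ _ _ _ _ _ _ _ happ hdual (R * (1 - δ)) (mul_pos hR (by linarith))
    (by nlinarith)
  have hrad : R * (1 - δ / 2) - R * (1 - δ) = R * (δ / 2) := by ring
  rw [hrad] at hsup
  have hsub : Metric.ball x₀ (R * (1 - δ / 2)) ⊆ Metric.ball x₀ R :=
    Metric.ball_subset_ball (by nlinarith)
  have hinteg : IntegrableOn (energyDensity ρ du) (Metric.ball x₀ R) :=
    hsol.finiteEnergy.mono_set hball
  have hQb : ∀ᵐ x ∂(volume.restrict (Metric.ball x₀ R)),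
      ‖du x‖ ^ 2 ∈ subsonicRange Qcrit ∧ gradExt Ω du x = du x := by
    filter_upwards [ae_restrict_of_ae_restrict_of_subset hball hQr,
      ae_restrict_mem measurableSet_ball] with x hx hxb
    exact ⟨hx, Set.indicator_of_mem (hball hxb) _⟩
  have hle : ∫ x in Metric.ball x₀ (R * (1 - δ / 2)),
      normSq (fun j x => fluxExt ρ Qcrit Ω du x j) x ≤
      ρ₀ ^ 2 / κ₀ * energy ρ du (Metric.ball x₀ R) := by
    calc _ ≤ ∫ x in Metric.ball x₀ (R * (1 - δ / 2)), ρ₀ ^ 2 / κ₀ * energyDensity ρ du x := by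
          refine integral_mono_ae happ.integrable_normSq ((hinteg.mono_set hsub).const_mul _) ?_
          filter_upwards [ae_restrict_of_ae_restrict_of_subset hsub hQb] with x hx
          have h1 := norm_fluxExt_le (Ω := Ω) (du := du) hρ hQ hκ x
          rw [hx.2, hρ0] at h1
          have h2 := mul_le_energyDensity hρ hκ hx.1
          rw [normSq_fluxExt]
          calc ‖fluxExt ρ Qcrit Ω du x‖ ^ 2 ≤ (ρ₀ * ‖du x‖) ^ 2 :=
                pow_le_pow_left₀ (norm_nonneg _) h1 2
            _ = ρ₀ ^ 2 / κ₀ * (κ₀ * ‖du x‖ ^ 2) := by field_simp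
            _ ≤ _ := by gcongr
      _ = ρ₀ ^ 2 / κ₀ * ∫ x in Metric.ball x₀ (R * (1 - δ / 2)), energyDensity ρ du x :=
          integral_const_mul _ _
      _ ≤ _ := by
          refine mul_le_mul_of_nonneg_left ?_ (by positivity)
          refine setIntegral_mono_set hinteg ?_ hsub.eventuallyLE
          filter_upwards [hQb] with x hx
          exact energyDensity_nonneg hρ hx.1
  have hsub' : Metric.ball x₀ (R * (1 - δ)) ⊆ Metric.ball x₀ R :=
    Metric.ball_subset_ball (by nlinarith)
  filter_upwards [hsup, ae_restrict_of_ae_restrict_of_subset hsub' hQb] with x hx hxb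
  have hmem : ‖gradExt Ω du x‖ ^ 2 ∈ subsonicRange Qcrit := by
    rw [hxb.2]
    exact hxb.1
  rw [normSq_fluxExt_eq hmem, hxb.2] at hx
  have h1 : ‖du x‖ ^ 2 * κ₀ ^ 2 ≤ ‖du x‖ ^ 2 * ρ (‖du x‖ ^ 2) ^ 2 := by
    have := (hκ _ hxb.1).1
    gcongr
  have h2 : ‖du x‖ ^ 2 * κ₀ ^ 2 ≤ C / (R * (δ / 2)) ^ n *
      (ρ₀ ^ 2 / κ₀ * energy ρ du (Metric.ball x₀ R)) :=
    (h1.trans hx).trans (by gcongr)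
  rw [← le_div_iff₀ (by positivity)] at h2
  refine h2.trans_eq ?_
  rw [mul_pow]
  field_simp
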